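/- Let $dA=\frac1\pi\,d^2\zeta$ be the normalised area measure on $\mathbb{C}$. Fix $\mathcal{S}\in\mathbb{R}$, and for $N\ge 1$ put $a=a_N=1+\frac{\mathcal{S}}{2\sqrt N}$ and $Q(\zeta)=|\zeta-a|^2$. For $c>-1$ let $p^c_{j,N}$ $(j\ge 0)$ be the orthonormal polynomials, $\deg p^c_{j,N}=j$, with respect to the measure $|\zeta|^{2c}e^{-NQ(\zeta)}\,dA(\zeta)$, and let $$\widehat{\mathbf K}^c_N(\zeta,\eta)=(\zeta\bar\eta)^c e^{-\frac N2(Q(\zeta)+Q(\eta))}\sum_{j=0}^{N-1}p^c_{j,N}(\zeta)\overline{p^c_{j,N}(\eta)},\qquad \widehat K^c_N(z,w)=\frac1N\,\widehat{\mathbf K}^c_N\Big(\frac z{\sqrt N},\frac w{\sqrt N}\Big),$$ where $(\zeta\bar\eta)^c$ means $\zeta^c\,\overline{\eta^c}$ with the principal branch. Kernels are considered up to cocycles, i.e. up to multiplication by $g(z)\overline{g(w)}$ with $|g|=1$. A limiting edge kernel $\widehat K^c_{\rm edge}$ is a limit, as $N\to\infty$, of $g_N(z)\overline{g_N(w)}\,\widehat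 K_N^c(z,w)$ for some functions $g_N$ with $|g_N|=1$, where the convergence is uniform on compact subsets of $\mathbb{C}^2$ if $c\ge 0$, and of $(\mathbb{C}\setminus\{0\})^2$ if $c<0$. Write $\widehat R^c_{\rm edge}(z)=\widehat K^c_{\rm edge}(z,z)$. Then for every $c>-1$ the limiting edge kernel $\widehat K^c_{\rm edge}$ exists, and for any limiting edge kernels of charges $c$ and $c+1$ one has $\widehat R^c_{\rm edge}(w)>0$ for all $w\neq 0$ close to $0$ and $$\widehat R^{c+1}_{\rm edge}(z)=\widehat R^c_{\rm edge}(z)-\frac{|\widehat K^c_{\rm edge}(0,z)|^2}{\widehat R^c_{\rm edge}(0)}$$ for every $z\in\mathbb{C}$ (with $z\ne 0$ if $c<0$). Here the quotient stands for $\lim_{w\to 0}|\widehat K^c_{\rm edge}(w,z)|^2/\widehat R^c_{\rm edge}(w)$, which exists; this is needed for $c\neq0$, where numerator and denominator both vanish or are both infinite at $w=0$. For $c=0$ one has $\widehat R^0_{\rm edge}(0)>0$, and the formula also holds with the literal quotient. -/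

import Mathlib

open Filter Topology MeasureTheory Polynomial
open scoped ComplexConjugate

noncomputable section

namespace EdgeRecursion

/-- The normalised area measure `dA = d²ζ / π` on the complex plane. -/
def areaMeasure : Measure ℂ := ENNReal.ofReal (Real.pi⁻¹) • volume

/-- The shifted Gaussian potential `Q(ζ) = |ζ - a|²`. -/
def Q (a : ℝ) (ζ : ℂ) : ℝ := ‖ζ - (a : ℂ)‖ ^ 2

/-- The critical parameter `a`, determined by `S = 2 √N (a - 1)`. -/
def critA (S : ℝ) (N : ℕ) : ℝ := 1 + S / (2 * √(N : ℝ))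

/-- `p j` (`j = 0, 1, 2, …`) is an orthonormal polynomial of degree exactly `j` with respect to
the measure `|ζ|^{2c} e^{-N Q(ζ)} dA(ζ)`. -/
def IsOrthonormalPolys (c a : ℝ) (N : ℕ) (p : ℕ → ℂ[X]) : Prop :=
  (∀ j, (p j).degree = (j : WithBot ℕ)) ∧
  ∀ j k, ∫ ζ, (p j).eval ζ * conj ((p k).eval ζ) *
      ((‖ζ‖ ^ (2 * c) * Real.exp (-(N : ℝ) * Q a ζ) : ℝ) : ℂ) ∂areaMeasure
    = if j = k then 1 else 0

/-- The correlation kernel of the `N`-point ensemble,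
`(ζ η̄)^c e^{-N (Q(ζ) + Q(η)) / 2} ∑_{j < N} p_j(ζ) conj (p_j(η))`,
where `(ζ η̄)^c` is read as `ζ^c · conj (η^c)`. -/
def kernel (c a : ℝ) (N : ℕ) (p : ℕ → ℂ[X]) (ζ η : ℂ) : ℂ :=
  ζ ^ (c : ℂ) * conj (η ^ (c : ℂ)) *
    ((Real.exp (-((N : ℝ) / 2) * (Q a ζ + Q a η)) : ℝ) : ℂ) *
    ∑ j ∈ Finset.range N, (p j).eval ζ * conj ((p j).eval η)

/-- The kernel of the point process rescaled by `√N` at the origin. -/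
def rescaledKernel (c a : ℝ) (N : ℕ) (p : ℕ → ℂ[X]) (z w : ℂ) : ℂ :=
  (1 / (N : ℂ)) * kernel c a N p (z / ((√(N : ℝ) : ℝ) : ℂ)) (w / ((√(N : ℝ) : ℝ) : ℂ))

/-- The points at which the kernels of charge `c` are finite: the factor `|z|^c` is infinite
at the origin when `c < 0`. -/
def finiteDomain (c : ℝ) : Set ℂ := {z | z ≠ 0 ∨ 0 ≤ c}

/-- `K` is a limiting edge correlation kernel of charge `c` at the scaled parameter `S`: with
`a = 1 + S / (2 √N)`, the rescaled `N`-point kernels converge to `K` uniformly on compact sets.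
As always for correlation kernels, they are taken up to cocycles `g(z) conj (g(w))` with `|g| = 1`,
which change neither the point process nor the modulus of the kernel. -/
def IsEdgeKernel (S c : ℝ) (K : ℂ → ℂ → ℂ) : Prop :=
  ∃ p : ℕ → ℕ → ℂ[X], (∀ N, 1 ≤ N → IsOrthonormalPolys c (critA S N) N (p N)) ∧
  ∃ g : ℕ → ℂ → ℂ, (∀ N z, ‖g N z‖ = 1) ∧
  ∀ C : Set (ℂ × ℂ), IsCompact C → C ⊆ finiteDomain c ×ˢ finiteDomain c →
    TendstoUniformlyOn
      (fun (N : ℕ) (q : ℂ × ℂ) =>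
        g N q.1 * conj (g N q.2) * rescaledKernel c (critA S N) N (p N) q.1 q.2)
      (fun q => K q.1 q.2) atTop C

/-- The one-point function `R(z) = K(z, z)` of a kernel `K`; `K(z, z)` is a non-negative real
number for a limiting edge kernel `K`. -/
def onePoint (K : ℂ → ℂ → ℂ) (z : ℂ) : ℝ := (K z z).re

end EdgeRecursion

end

open scoped ENNReal NNReal

noncomputable section

namespace EdgeRecursion

/-! After rescaling by `√N` the weight is `|z|^{2c} e^{-|z-b|²}` with `b = √N a = √N + S/2`. Since
`|e^{bz-b²/2}|² e^{-|z|²} = e^{-|z-b|²}`, the rescaled kernel is, up to the cocycle `e^{ib Im z}`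
and the factor `z^c conj(w^c) e^{-(|z|²+|w|²)/2}`, the reproducing kernel `L` of the functions `p(z)
e^{bz}`, `deg p < N`, in the fixed space `L²(|z|^{2c} e^{-|z|²} dA)`.

The recursion is exact before the limit. Multiplication by `z` maps degree `< n` at charge `c+1`
isometrically onto the functions of degree `< n+1` at charge `c` that vanish at `0`. Comparing
kernels, `z w̄ L'_n(z,w) = L_{n+1}(z,w) - L_{n+1}(z,0) L_{n+1}(0,w) / L_{n+1}(0,0)` with the same
`b` (`IsReproducing.mul_conj_mul_eq`). It passes to the limit once the kernels of each charge
converge, to a limit that does not see the shift from `n` to `n+1` and is nonzero at `(0,0)`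
(`exists_edge_limit`). In `|K(w,z)|²/R(w)` the factor `|w|^{2c} e^{-|w|²}` cancels.

For charge `0` the kernel is `e^{z w̄}` times a truncated exponential series at its transition
point, and Stirling's formula gives the limit. Other charges have no such formula and are compared
with charge `0`. Point evaluations are bounded by the energy, so the kernels `L_k(·,w)` are
precompact; the issue is whether two subsequential limits `f`, `g` agree. If `u_k → h` are weighted
polynomials bounded at charge `c+1`, no mass escapes to infinity in `u_k(w) = ⟨u_k, L_k(·,w)⟩`,
hence `h(w) = ⟨h,f⟩ = ⟨h,g⟩`.

Such `h` come from averages of `e^{āz} f((1-δā)z - a)` over small `a`. With `δ = 1/b` these preserve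
the functions `p e^{bz}`; they are uniformly bounded on the energy space, gain one unit of charge by
integration by parts, and tend to the identity as the averages shrink. A subsequential limit is thus
raised to charge at least `1`, transferred to the whole sequence by the convergent projections of
charge `0`, and raised to charge at least `c+1`. Undoing the averages shows `f - g ⟂ f, g`, so `f =
g` (`kernel_limit_unique`). The same device gives `K(0,0) ≠ 0`, and interlacing two sequences makes
the limit independent of the sequence. -/

/-! ### Weighted Fock spaces of charge `c`. -/

/-- The weight `|z|^{2c} e^{-|z|²}`. -/
def wt (c : ℝ) (z : ℂ) : ℝ := ‖z‖ ^ (2 * c) * Real.exp (-‖z‖ ^ 2)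

/-- The measure `|z|^{2c} e^{-|z|²} dA`. -/
def fockMeasure (c : ℝ) : Measure ℂ := areaMeasure.withDensity fun z => ENNReal.ofReal (wt c z)

/-- The squared norm in `L²(|z|^{2c} e^{-|z|²} dA)`. -/
def energy (c : ℝ) (f : ℂ → ℂ) : ℝ≥0∞ := ∫⁻ z, ‖f z‖ₑ ^ 2 ∂fockMeasure c

lemma wt_nonneg (c : ℝ) (z : ℂ) : 0 ≤ wt c z := by unfold wt; positivity

lemma measurable_wt (c : ℝ) : Measurable (wt c) := by unfold wt; fun_prop

lemma wt_add_one (c : ℝ) {z : ℂ} (hz : z ≠ 0) : wt (c + 1) z = ‖z‖ ^ 2 * wt c z := by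
  have h : 0 < ‖z‖ := norm_pos_iff.2 hz
  unfold wt
  rw [show 2 * (c + 1) = 2 * c + (2 : ℕ) by push_cast; ring, Real.rpow_add_natCast h.ne']
  ring

lemma lintegral_areaMeasure (f : ℂ → ℝ≥0∞) :
    ∫⁻ z, f z ∂areaMeasure = ENNReal.ofReal Real.pi⁻¹ * ∫⁻ z, f z := by
  unfold areaMeasure; rw [lintegral_smul_measure, smul_eq_mul]

lemma lintegral_fockMeasure (c : ℝ) (f : ℂ → ℝ≥0∞) :
    ∫⁻ z, f z ∂fockMeasure c = ∫⁻ z, ENNReal.ofReal (wt c z) * f z ∂areaMeasure := by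
  unfold fockMeasure
  exact lintegral_withDensity_eq_lintegral_mul_non_measurable _
    (measurable_wt c).ennreal_ofReal (Eventually.of_forall fun _ => ENNReal.ofReal_lt_top) f

lemma integral_fockMeasure (c : ℝ) (f : ℂ → ℂ) :
    ∫ z, f z ∂fockMeasure c = ∫ z, f z * ((wt c z : ℝ) : ℂ) ∂areaMeasure := by
  unfold fockMeasure
  rw [integral_withDensity_eq_integral_toReal_smul (measurable_wt c).ennreal_ofReal
    (Eventually.of_forall fun _ => ENNReal.ofReal_lt_top)]
  refine integral_congr_ae (Eventually.of_forall fun z => ?_)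
  simp [ENNReal.toReal_ofReal (wt_nonneg c z), mul_comm]

lemma areaMeasure_singleton_zero : areaMeasure {(0 : ℂ)} = 0 := by
  unfold areaMeasure; simp

lemma ae_ne_zero_areaMeasure : ∀ᵐ z ∂areaMeasure, z ≠ (0 : ℂ) :=
  measure_eq_zero_iff_ae_notMem.1 areaMeasure_singleton_zero

/-- Since `|z|^{2c+2} = |z|² |z|^{2c}` off the origin, one unit of charge is one factor `z`. This
converts charge into decay; the polarised form `integral_fockMeasure_add_one` drives the recursion.
-/
lemma energy_mul_id (c : ℝ) (f : ℂ → ℂ) : energy c (fun z => z * f z) = energy (c + 1) f := by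
  unfold energy
  rw [lintegral_fockMeasure, lintegral_fockMeasure]
  refine lintegral_congr_ae (ae_ne_zero_areaMeasure.mono fun z hz => ?_)
  simp only [wt_add_one c hz, enorm_mul]
  rw [ENNReal.ofReal_mul (by positivity), ENNReal.ofReal_pow (norm_nonneg _), ofReal_norm]
  ring

lemma integral_fockMeasure_add_one (c : ℝ) (f g : ℂ → ℂ) :
    ∫ z, f z * conj (g z) ∂fockMeasure (c + 1)
      = ∫ z, (z * f z) * conj (z * g z) ∂fockMeasure c := by
  rw [integral_fockMeasure, integral_fockMeasure]
  refine integral_congr_ae (ae_ne_zero_areaMeasure.mono fun z hz => ?_)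
  simp only [wt_add_one c hz, map_mul]
  push_cast
  rw [← Complex.mul_conj']
  ring

/-! ### Point evaluations. -/

lemma polar_circleMap (r θ : ℝ) : Complex.polarCoord.symm (r, θ) = circleMap 0 r θ := by
  simp [circleMap, Complex.exp_mul_I]

/-- Sub-mean value estimate for the square of an entire function on a circle. -/
lemma enorm_sq_le_circle {f : ℂ → ℂ} (hf : Differentiable ℂ f) {M r : ℝ} (hr : M + 1 ≤ r)
    (hr' : r ≤ M + 2) {z : ℂ} (hz : ‖z‖ ≤ M) :
    ‖f z‖ₑ ^ 2 ≤ ENNReal.ofReal ((2 * Real.pi)⁻¹ * (M + 2)) *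
      ∫⁻ θ in Set.Ioo (-Real.pi) Real.pi, ‖f (circleMap 0 r θ)‖ₑ ^ 2 := by
  have hM : 0 ≤ M := (norm_nonneg z).trans hz
  have hr0 : 0 < r := by linarith
  have hzr : ‖z‖ < r := by linarith
  have hmem : z ∈ Metric.ball (0 : ℂ) r := by simpa using hzr
  -- Cauchy's formula for `f²`. The circle stays at distance at least `1` from `z`, so the Cauchy
  -- kernel times `r` is at most `M + 2`.
  have key := (((hf.pow 2).diffContOnCl (s := Metric.ball (0 : ℂ) |r|))).circleAverage_smul_div
    (w := z) (by rwa [abs_of_pos hr0])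
  have hper : Function.Periodic
      (fun θ => ((circleMap 0 r θ - 0) / (circleMap 0 r θ - z)) • (f ^ 2) (circleMap 0 r θ))
      (2 * Real.pi) := fun θ => by simp only [periodic_circleMap 0 r θ]
  rw [Real.circleAverage_def] at key
  have h2 : (∫ θ in (0:ℝ)..2 * Real.pi,
      ((circleMap 0 r θ - 0) / (circleMap 0 r θ - z)) • (f ^ 2) (circleMap 0 r θ))
      = ∫ θ in (-Real.pi)..Real.pi,
      ((circleMap 0 r θ - 0) / (circleMap 0 r θ - z)) • (f ^ 2) (circleMap 0 r θ) := by
    have := hper.intervalIntegral_add_eq 0 (-Real.pi)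
    convert this using 2 <;> ring
  rw [h2, intervalIntegral.integral_of_le (by linarith [Real.pi_pos]),
    integral_Ioc_eq_integral_Ioo] at key
  have h3 : ‖f z‖ₑ ^ 2 = ‖(f ^ 2) z‖ₑ := by simp
  rw [h3, ← key, enorm_smul, ENNReal.ofReal_mul (by positivity), mul_assoc]
  refine mul_le_mul' (by rw [Real.enorm_eq_ofReal (by positivity)]) ?_
  rw [← lintegral_const_mul' _ _ ENNReal.ofReal_ne_top]
  refine (enorm_integral_le_lintegral_enorm _).trans (lintegral_mono fun θ => ?_)
  simp only [sub_zero, enorm_smul, Pi.pow_apply, enorm_pow]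
  refine mul_le_mul_left ?_ _
  have hn : ‖circleMap 0 r θ‖ = r := by simp [abs_of_pos hr0]
  have h4 : 1 ≤ ‖circleMap 0 r θ - z‖ := by
    have := norm_sub_norm_le (circleMap 0 r θ) z
    linarith
  rw [← ofReal_norm, norm_div, hn]
  refine ENNReal.ofReal_le_ofReal ?_
  rw [div_le_iff₀ (by linarith)]
  nlinarith

/-- Point evaluations of entire functions are bounded, locally uniformly, by the energy. -/
lemma exists_enorm_sq_le_energy (c M : ℝ) : ∃ C : ℝ≥0, ∀ f : ℂ → ℂ, Differentiable ℂ f →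
    ∀ z, ‖z‖ ≤ M → ‖f z‖ₑ ^ 2 ≤ C * energy c f := by
  rcases lt_or_ge M 0 with hM | hM
  · exact ⟨0, fun f _ z hz => absurd (norm_nonneg z) (by linarith)⟩
  -- Only the annulus `M + 1 ≤ r ≤ M + 2` is used. It avoids the origin, so the weight is bounded
  -- below there whatever the sign of `c`.
  obtain ⟨m, hm, hmle⟩ : ∃ m > 0, ∀ r ∈ Set.Icc (M + 1) (M + 2),
      m ≤ r ^ (2 * c) * Real.exp (-r ^ 2) := by
    have hc : ContinuousOn (fun r : ℝ => r ^ (2 * c) * Real.exp (-r ^ 2))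
        (Set.Icc (M + 1) (M + 2)) := by
      refine ContinuousOn.mul (ContinuousOn.rpow_const continuousOn_id fun x hx => Or.inl ?_)
        (by fun_prop)
      have := hx.1
      linarith
    obtain ⟨x, hx, hxm⟩ := isCompact_Icc.exists_isMinOn
      (Set.nonempty_Icc.2 (by linarith)) hc
    refine ⟨_, ?_, fun r hr => hxm hr⟩
    have : 0 < x := by linarith [hx.1]
    positivity
  set D : ℝ := (2 * Real.pi)⁻¹ * (M + 2) with hD
  have hDpos : 0 < D := by positivity
  refine ⟨Real.toNNReal (D * (Real.pi * m⁻¹)), fun f hf z hz => ?_⟩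
  have hcont : Continuous f := hf.continuous
  have h1 : ENNReal.ofReal (Real.pi⁻¹ * m) * ∫⁻ r in Set.Ioo (M + 1) (M + 2),
      ∫⁻ θ in Set.Ioo (-Real.pi) Real.pi, ‖f (circleMap 0 r θ)‖ₑ ^ 2 ≤ energy c f := by
    unfold energy
    rw [lintegral_fockMeasure, lintegral_areaMeasure, ENNReal.ofReal_mul (by positivity), mul_assoc]
    refine mul_le_mul_right ?_ _
    rw [← Complex.lintegral_comp_polarCoord_symm, polarCoord_target]
    have hsub : Set.Ioo (M + 1) (M + 2) ×ˢ Set.Ioo (-Real.pi) Real.pi ⊆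
        Set.Ioi (0 : ℝ) ×ˢ Set.Ioo (-Real.pi) Real.pi :=
      Set.prod_mono (fun r hr => lt_of_lt_of_le (by linarith : (0:ℝ) < M + 1) hr.1.le) le_rfl
    refine le_trans ?_ (lintegral_mono_set hsub)
    have hmeas : Measurable fun p : ℝ × ℝ => ‖f (circleMap 0 p.1 p.2)‖ₑ ^ 2 := by
      have : Continuous fun p : ℝ × ℝ => f (circleMap 0 p.1 p.2) := by
        unfold circleMap; fun_prop
      exact this.measurable.enorm.pow_const 2
    rw [← lintegral_const_mul' _ _ ENNReal.ofReal_ne_top, Measure.volume_eq_prod,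
      ← Measure.prod_restrict]
    simp_rw [← lintegral_const_mul' _ _ ENNReal.ofReal_ne_top]
    rw [← lintegral_prod (μ := volume.restrict (Set.Ioo (M + 1) (M + 2)))
      (ν := volume.restrict (Set.Ioo (-Real.pi) Real.pi))
      (fun p : ℝ × ℝ => ENNReal.ofReal m * ‖f (circleMap 0 p.1 p.2)‖ₑ ^ 2)
      (hmeas.const_mul _).aemeasurable, Measure.prod_restrict]
    refine setLIntegral_mono' (measurableSet_Ioo.prod measurableSet_Ioo) fun p hp => ?_
    have hp1 : M + 1 < p.1 ∧ p.1 < M + 2 := hp.1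
    have hpos : 0 < p.1 := by linarith
    rw [show p = (p.1, p.2) from rfl, polar_circleMap, smul_eq_mul, ← mul_assoc,
      ← ENNReal.ofReal_mul hpos.le]
    refine mul_le_mul_left (ENNReal.ofReal_le_ofReal ?_) _
    have hw : wt c (circleMap 0 p.1 p.2) = p.1 ^ (2 * c) * Real.exp (-p.1 ^ 2) := by
      simp [wt, abs_of_pos hpos]
    have := hmle p.1 ⟨hp1.1.le, hp1.2.le⟩
    rw [hw]
    nlinarith
  have h2 : ‖f z‖ₑ ^ 2 ≤ ENNReal.ofReal D * ∫⁻ r in Set.Ioo (M + 1) (M + 2),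
      ∫⁻ θ in Set.Ioo (-Real.pi) Real.pi, ‖f (circleMap 0 r θ)‖ₑ ^ 2 := by
    rw [← lintegral_const_mul' _ _ ENNReal.ofReal_ne_top]
    calc ‖f z‖ₑ ^ 2 = ∫⁻ r in Set.Ioo (M + 1) (M + 2), ‖f z‖ₑ ^ 2 := by
          rw [setLIntegral_const, Real.volume_Ioo]; norm_num
      _ ≤ _ := setLIntegral_mono' measurableSet_Ioo fun r hr =>
          enorm_sq_le_circle hf hr.1.le hr.2.le hz
  have h3 : (ENNReal.ofReal (Real.pi * m⁻¹)) * ENNReal.ofReal (Real.pi⁻¹ * m) = 1 := by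
    rw [← ENNReal.ofReal_mul (by positivity)]
    have : Real.pi * m⁻¹ * (Real.pi⁻¹ * m) = 1 := by field_simp
    rw [this, ENNReal.ofReal_one]
  refine h2.trans ?_
  change _ ≤ ENNReal.ofReal (D * (Real.pi * m⁻¹)) * _
  rw [ENNReal.ofReal_mul hDpos.le, mul_assoc]
  refine mul_le_mul_right ?_ _
  calc _ = ENNReal.ofReal (Real.pi * m⁻¹) * (ENNReal.ofReal (Real.pi⁻¹ * m) *
        ∫⁻ r in Set.Ioo (M + 1) (M + 2),
      ∫⁻ θ in Set.Ioo (-Real.pi) Real.pi, ‖f (circleMap 0 r θ)‖ₑ ^ 2) := by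
        rw [← mul_assoc, h3, one_mul]
    _ ≤ _ := mul_le_mul_right h1 _

/-! ### Integrability of the weights and comparison of energies. -/

lemma integrable_wt_volume {c : ℝ} (hc : -1 < c) {b : ℝ} (hb : 0 < b) :
    Integrable (fun z : ℂ => ‖z‖ ^ (2 * c) * Real.exp (-b * ‖z‖ ^ 2)) := by
  have h := Complex.integral_rpow_mul_exp_neg_mul_rpow (p := 2) (q := 2 * c) (b := b)
    (by norm_num) (by linarith) hb
  have h2 : (fun z : ℂ => ‖z‖ ^ (2 * c) * Real.exp (-b * ‖z‖ ^ 2))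
      = fun z : ℂ => ‖z‖ ^ (2 * c) * Real.exp (-b * ‖z‖ ^ (2 : ℝ)) := by
    funext z; norm_num
  rw [h2]
  by_contra hni
  rw [integral_undef hni] at h
  have : 0 < Real.Gamma ((2 * c + 2) / 2) := Real.Gamma_pos_of_pos (by linarith)
  have : 0 < (2 * Real.pi / 2) * b ^ (-(2 * c + 2) / 2) * Real.Gamma ((2 * c + 2) / 2) := by
    positivity
  linarith

lemma lintegral_wt_lt_top {c : ℝ} (hc : -1 < c) {b : ℝ} (hb : 0 < b) :
    ∫⁻ z : ℂ, ENNReal.ofReal (‖z‖ ^ (2 * c) * Real.exp (-b * ‖z‖ ^ 2)) < ⊤ := by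
  have h := (integrable_wt_volume hc hb).hasFiniteIntegral
  rw [hasFiniteIntegral_iff_ofReal (Eventually.of_forall fun z => by positivity)] at h
  exact h

lemma isFiniteMeasure_fockMeasure {c : ℝ} (hc : -1 < c) : IsFiniteMeasure (fockMeasure c) := by
  constructor
  rw [← setLIntegral_one, setLIntegral_univ, lintegral_fockMeasure, lintegral_areaMeasure]
  refine ENNReal.mul_lt_top ENNReal.ofReal_lt_top ?_
  have := lintegral_wt_lt_top hc one_pos
  simpa [wt] using this

/-- Near the origin the translated weights `|z + a|^{2c}` are uniformly integrable. -/
lemma exists_lintegral_shift_le {c : ℝ} (hc : -1 < c) : ∃ C : ℝ≥0, ∀ a : ℂ, ‖a‖ ≤ 1 →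
    ∫⁻ z in Metric.closedBall (0 : ℂ) 2, ENNReal.ofReal (‖z + a‖ ^ (2 * c)) ∂areaMeasure ≤ C := by
  set T := ∫⁻ z : ℂ, ENNReal.ofReal (‖z‖ ^ (2 * c) * Real.exp (-1 * ‖z‖ ^ 2)) with hT
  have hTtop : T < ⊤ := lintegral_wt_lt_top hc one_pos
  have hfin : ENNReal.ofReal Real.pi⁻¹ * (ENNReal.ofReal (Real.exp 9) * T) ≠ ⊤ :=
    (ENNReal.mul_lt_top ENNReal.ofReal_lt_top
      (ENNReal.mul_lt_top ENNReal.ofReal_lt_top hTtop)).ne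
  refine ⟨(ENNReal.ofReal Real.pi⁻¹ * (ENNReal.ofReal (Real.exp 9) * T)).toNNReal, fun a ha => ?_⟩
  rw [ENNReal.coe_toNNReal hfin, ← lintegral_indicator measurableSet_closedBall,
    lintegral_areaMeasure]
  refine mul_le_mul_right ?_ _
  rw [hT, ← lintegral_add_right_eq_self (μ := (volume : Measure ℂ))
      (fun z => ENNReal.ofReal (‖z‖ ^ (2 * c) * Real.exp (-1 * ‖z‖ ^ 2))) a,
    ← lintegral_const_mul' _ _ ENNReal.ofReal_ne_top]
  refine lintegral_mono fun z => ?_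
  by_cases hz : z ∈ Metric.closedBall (0 : ℂ) 2
  · rw [Set.indicator_of_mem hz, ← ENNReal.ofReal_mul (by positivity)]
    refine ENNReal.ofReal_le_ofReal ?_
    have h3 : ‖z + a‖ ≤ 3 := (norm_add_le _ _).trans (by
      have : ‖z‖ ≤ 2 := by simpa using hz
      linarith)
    -- On the disc `|z + a| ≤ 3`, so `e^9` pays for inserting a Gaussian in `z + a`; translation
    -- invariance then removes `a`.
    have h1 : 1 ≤ Real.exp 9 * Real.exp (-1 * ‖z + a‖ ^ 2) := by
      rw [← Real.exp_add]
      refine Real.one_le_exp ?_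
      nlinarith [norm_nonneg (z + a)]
    have : 0 ≤ ‖z + a‖ ^ (2 * c) := by positivity
    nlinarith
  · rw [Set.indicator_of_notMem hz]; exact zero_le

lemma enorm_sq_le_of_forall_ball {c : ℝ} {C : ℝ≥0} {f : ℂ → ℂ}
    (h : ∀ z, ‖z‖ ≤ 2 → ‖f z‖ₑ ^ 2 ≤ C * energy c f) {u : ℂ → ℝ≥0∞}
    (hu : Measurable u) :
    ∫⁻ z in Metric.closedBall (0 : ℂ) 2, u z * ‖f z‖ₑ ^ 2 ∂areaMeasure ≤
      (∫⁻ z in Metric.closedBall (0 : ℂ) 2, u z ∂areaMeasure) * (C * energy c f) := by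
  rw [← lintegral_mul_const _ hu]
  refine setLIntegral_mono' measurableSet_closedBall fun z hz => ?_
  exact mul_le_mul_right (h z (by simpa using hz)) _

/-- For entire functions the weights `|z + a|^{2c}`, `|a| ≤ 1`, are dominated by `|z|^{2c}`. -/
lemma exists_lintegral_shift_le_energy {c : ℝ} (hc : -1 < c) : ∃ C : ℝ≥0, ∀ a : ℂ, ‖a‖ ≤ 1 →
    ∀ f : ℂ → ℂ, Differentiable ℂ f →
    ∫⁻ z, ENNReal.ofReal (‖z + a‖ ^ (2 * c) * Real.exp (-‖z‖ ^ 2)) * ‖f z‖ₑ ^ 2 ∂areaMeasure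
      ≤ C * energy c f := by
  obtain ⟨C₁, h₁⟩ := exists_lintegral_shift_le hc
  obtain ⟨C₂, h₂⟩ := exists_enorm_sq_le_energy c 2
  refine ⟨C₁ * C₂ + Real.toNNReal (4 ^ |c|), fun a ha f hf => ?_⟩
  -- For `|z| ≤ 2` the translated singularity is harmless because `f` is bounded there by its
  -- energy; for `|z| > 2` the moduli `|z + a|` and `|z|` agree up to a factor `2`, whence `4^|c|`.
  rw [← lintegral_add_compl _ (measurableSet_closedBall (x := (0 : ℂ)) (ε := 2))]
  push_cast
  rw [add_mul]
  refine add_le_add ?_ ?_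
  · refine (enorm_sq_le_of_forall_ball (fun z hz => h₂ f hf z hz) (by fun_prop)).trans ?_
    rw [mul_assoc]
    refine mul_le_mul_left (le_trans ?_ (h₁ a ha)) _
    refine lintegral_mono fun z => ENNReal.ofReal_le_ofReal ?_
    exact mul_le_of_le_one_right (by positivity)
      (Real.exp_le_one_iff.2 (by nlinarith [norm_nonneg z]))
  · unfold energy
    rw [lintegral_fockMeasure, ← lintegral_const_mul' _ _ ENNReal.coe_ne_top]
    refine le_trans (setLIntegral_mono' (g := fun z => ((Real.toNNReal (4 ^ |c|) : ℝ≥0) : ℝ≥0∞) *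
      (ENNReal.ofReal (wt c z) * ‖f z‖ₑ ^ 2)) measurableSet_closedBall.compl fun z hz => ?_)
      (setLIntegral_le_lintegral _ _)
    rw [← mul_assoc]
    refine mul_le_mul_left ?_ _
    change _ ≤ ENNReal.ofReal (4 ^ |c|) * _
    rw [← ENNReal.ofReal_mul (by positivity)]
    refine ENNReal.ofReal_le_ofReal ?_
    unfold wt
    rw [← mul_assoc]
    refine mul_le_mul_of_nonneg_right ?_ (Real.exp_pos _).le
    have hz2 : 2 < ‖z‖ := by simpa using hz
    have hu : ‖z + a‖ ≤ 2 * ‖z‖ := (norm_add_le _ _).trans (by linarith)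
    have hl : ‖z‖ / 2 ≤ ‖z + a‖ := by
      have := norm_sub_le (z + a) a
      rw [add_sub_cancel_right] at this
      linarith
    rcases le_or_gt 0 c with h | h
    · rw [abs_of_nonneg h]
      calc ‖z + a‖ ^ (2 * c) ≤ (2 * ‖z‖) ^ (2 * c) :=
            Real.rpow_le_rpow (norm_nonneg _) hu (by linarith)
        _ = 4 ^ c * ‖z‖ ^ (2 * c) := by
            rw [Real.mul_rpow (by norm_num) (norm_nonneg _), Real.rpow_mul (by norm_num)]
            norm_num
    · rw [abs_of_neg h]
      calc ‖z + a‖ ^ (2 * c) ≤ (‖z‖ / 2) ^ (2 * c) :=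
            Real.rpow_le_rpow_of_nonpos (by linarith) hl (by linarith)
        _ = 4 ^ (-c) * ‖z‖ ^ (2 * c) := by
            rw [Real.div_rpow (norm_nonneg _) (by norm_num),
              Real.rpow_mul (by norm_num : (0:ℝ) ≤ 2),
              Real.rpow_neg (by norm_num)]
            norm_num
            ring

/-- On entire functions the energies increase with the charge, up to constants. -/
lemma exists_energy_le_energy {c₁ c₂ : ℝ} (hc : -1 < c₁) (h : c₁ ≤ c₂) : ∃ C : ℝ≥0,
    ∀ f : ℂ → ℂ, Differentiable ℂ f → energy c₁ f ≤ C * energy c₂ f := by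
  obtain ⟨C₁, h₁⟩ := exists_lintegral_shift_le hc
  obtain ⟨C₂, h₂⟩ := exists_enorm_sq_le_energy c₂ 2
  refine ⟨C₁ * C₂ + 1, fun f hf => ?_⟩
  nth_rw 1 [energy]
  -- The power of `|z|` increases with the charge outside the disc; inside it, the bound on point
  -- evaluations of charge `c₂` replaces the comparison of weights, which fails at the origin.
  rw [lintegral_fockMeasure,
    ← lintegral_add_compl _ (measurableSet_closedBall (x := (0 : ℂ)) (ε := 2))]
  push_cast
  rw [add_mul, one_mul]
  refine add_le_add ?_ ?_
  · refine (enorm_sq_le_of_forall_ball (fun z hz => h₂ f hf z hz)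
      (measurable_wt c₁).ennreal_ofReal).trans ?_
    rw [mul_assoc]
    refine mul_le_mul_left (le_trans ?_ (h₁ 0 (by simp))) _
    refine lintegral_mono fun z => ENNReal.ofReal_le_ofReal ?_
    rw [add_zero]
    exact mul_le_of_le_one_right (by positivity)
      (Real.exp_le_one_iff.2 (by nlinarith [norm_nonneg z]))
  · unfold energy
    rw [lintegral_fockMeasure]
    refine le_trans (setLIntegral_mono' (g := fun z => 
      (ENNReal.ofReal (wt c₂ z) * ‖f z‖ₑ ^ 2)) measurableSet_closedBall.compl fun z hz => ?_)
      (setLIntegral_le_lintegral _ _)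
    refine mul_le_mul_left (ENNReal.ofReal_le_ofReal ?_) _
    have hz2 : 2 < ‖z‖ := by simpa using hz
    exact mul_le_mul_of_nonneg_right (Real.rpow_le_rpow_of_exponent_le (by linarith) (by linarith))
      (Real.exp_pos _).le

/-! ### Normal families of bounded energy. -/

lemma exists_norm_le_of_energy_le (c M : ℝ) {A : ℝ≥0∞} (hA : A ≠ ⊤) : ∃ B : ℝ, 0 ≤ B ∧
    ∀ f : ℂ → ℂ, Differentiable ℂ f → energy c f ≤ A → ∀ z, ‖z‖ ≤ M → ‖f z‖ ≤ B := by
  obtain ⟨C, hC⟩ := exists_enorm_sq_le_energy c M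
  have hfin : (C : ℝ≥0∞) * A ≠ ⊤ := ENNReal.mul_ne_top ENNReal.coe_ne_top hA
  refine ⟨√((C : ℝ≥0∞) * A).toReal, Real.sqrt_nonneg _, fun f hf hfA z hz => ?_⟩
  refine Real.le_sqrt_of_sq_le ?_
  have h := (hC f hf z hz).trans (mul_le_mul_right hfA (C : ℝ≥0∞))
  have := ENNReal.toReal_mono hfin h
  simpa [ENNReal.toReal_pow] using this

lemma exists_lipschitz_of_energy_le (c M : ℝ) {A : ℝ≥0∞} (hA : A ≠ ⊤) : ∃ K : ℝ, 0 ≤ K ∧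
    ∀ f : ℂ → ℂ, Differentiable ℂ f → energy c f ≤ A → ∀ z z', ‖z‖ ≤ M → ‖z'‖ ≤ M →
      ‖f z - f z'‖ ≤ K * ‖z - z'‖ := by
  obtain ⟨B, hB0, hB⟩ := exists_norm_le_of_energy_le c (M + 1) hA
  refine ⟨B, hB0, fun f hf hfA z z' hz hz' => ?_⟩
  refine Convex.norm_image_sub_le_of_norm_deriv_le (s := Metric.closedBall (0 : ℂ) M)
    (fun x _ => hf x) (fun x hx => ?_) (convex_closedBall _ _) (by simpa using hz')
    (by simpa using hz)
  have hx' : ‖x‖ ≤ M := by simpa using hx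
  have := Complex.norm_deriv_le_of_forall_mem_sphere_norm_le (f := f) (c := x) (C := B) one_pos
    hf.diffContOnCl (fun y hy => hB f hf hfA y ?_)
  · simpa using this
  · have h1 : ‖y - x‖ = 1 := by simpa [dist_eq_norm] using hy
    calc ‖y‖ = ‖x + (y - x)‖ := by ring_nf
      _ ≤ M + 1 := (norm_add_le _ _).trans (by linarith)

/-- Pointwise convergence of entire functions of bounded energy is locally uniform. -/
lemma tendstoLocallyUniformly_of_energy_le {ι : Type*} {l : Filter ι} [l.NeBot] {c : ℝ}
    {A : ℝ≥0∞} (hA : A ≠ ⊤) {f : ι → ℂ → ℂ} {g : ℂ → ℂ} (hf : ∀ᶠ k in l, Differentiable ℂ (f k))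
    (hfA : ∀ᶠ k in l, energy c (f k) ≤ A) (h : ∀ z, Tendsto (fun k => f k z) l (𝓝 (g z))) :
    TendstoLocallyUniformly f g l := by
  rw [Metric.tendstoLocallyUniformly_iff]
  intro ε hε x
  obtain ⟨K, hK0, hK⟩ := exists_lipschitz_of_energy_le c (‖x‖ + 1) hA
  have hgK : ∀ z z', ‖z‖ ≤ ‖x‖ + 1 → ‖z'‖ ≤ ‖x‖ + 1 → ‖g z - g z'‖ ≤ K * ‖z - z'‖ := by
    intro z z' hz hz'
    refine le_of_tendsto ((h z).sub (h z')).norm ?_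
    filter_upwards [hf, hfA] with k h1 h2 using hK _ h1 h2 z z' hz hz'
  set r := min 1 (ε / (3 * (K + 1))) with hr
  have hr0 : 0 < r := by positivity
  refine ⟨Metric.ball x r, Metric.ball_mem_nhds x hr0, ?_⟩
  have hx := (Metric.tendsto_nhds.1 (h x)) (ε / 3) (by positivity)
  filter_upwards [hf, hfA, hx] with k h1 h2 h3 y hy
  have hyx : ‖y - x‖ < r := by simpa [dist_eq_norm] using hy
  have hy1 : ‖y‖ ≤ ‖x‖ + 1 := by
    have : ‖y‖ ≤ ‖x‖ + ‖y - x‖ := by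
      calc ‖y‖ = ‖x + (y - x)‖ := by ring_nf
        _ ≤ _ := norm_add_le _ _
    linarith [min_le_left 1 (ε / (3 * (K + 1)))]
  have hx1 : ‖x‖ ≤ ‖x‖ + 1 := by linarith
  have hKr : K * ‖y - x‖ ≤ ε / 3 := by
    calc K * ‖y - x‖ ≤ (K + 1) * (ε / (3 * (K + 1))) := by
          refine mul_le_mul (by linarith) (hyx.le.trans (min_le_right _ _)) (norm_nonneg _)
            (by linarith)
      _ = ε / 3 := by field_simp
  have e1 := hgK y x hy1 hx1
  have e2 := hK _ h1 h2 y x hy1 hx1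
  rw [dist_eq_norm] at h3 ⊢
  have : ‖g y - f k y‖ < K * ‖y - x‖ + ε / 3 + K * ‖y - x‖ := by
    calc ‖g y - f k y‖ = ‖(g y - g x) - (f k x - g x) - (f k y - f k x)‖ := by ring_nf
      _ ≤ ‖g y - g x‖ + ‖f k x - g x‖ + ‖f k y - f k x‖ :=
        (norm_sub_le _ _).trans (by gcongr; exact norm_sub_le _ _)
      _ < _ := by linarith
  linarith

lemma differentiable_of_tendsto_of_energy_le {ι : Type*} {l : Filter ι} [l.NeBot] {c : ℝ}
    {A : ℝ≥0∞} (hA : A ≠ ⊤) {f : ι → ℂ → ℂ} {g : ℂ → ℂ} (hf : ∀ᶠ k in l, Differentiable ℂ (f k))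
    (hfA : ∀ᶠ k in l, energy c (f k) ≤ A) (h : ∀ z, Tendsto (fun k => f k z) l (𝓝 (g z))) :
    Differentiable ℂ g := by
  have := (tendstoLocallyUniformlyOn_univ.2 (tendstoLocallyUniformly_of_energy_le hA hf hfA h))
  exact differentiableOn_univ.1 (this.differentiableOn (hf.mono fun k hk => hk.differentiableOn)
    isOpen_univ)

lemma setLIntegral_le_of_tendsto {c : ℝ} {f : ℕ → ℂ → ℂ} {g : ℂ → ℂ} {s : Set ℂ} {A : ℝ≥0∞}
    (hf : ∀ᶠ k in atTop, Measurable (f k))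
    (hfA : ∀ᶠ k in atTop, ∫⁻ z in s, ‖f k z‖ₑ ^ 2 ∂fockMeasure c ≤ A)
    (h : ∀ z, Tendsto (fun k => f k z) atTop (𝓝 (g z))) :
    ∫⁻ z in s, ‖g z‖ₑ ^ 2 ∂fockMeasure c ≤ A := by
  obtain ⟨k₀, hk₀⟩ := eventually_atTop.1 (hf.and hfA)
  have h' : ∀ z, Tendsto (fun k => ‖f (k + k₀) z‖ₑ ^ 2) atTop (𝓝 (‖g z‖ₑ ^ 2)) := fun z =>
    ENNReal.Tendsto.pow ((tendsto_add_atTop_iff_nat k₀).2 (h z)).enorm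
  calc ∫⁻ z in s, ‖g z‖ₑ ^ 2 ∂fockMeasure c
      = ∫⁻ z in s, liminf (fun k => ‖f (k + k₀) z‖ₑ ^ 2) atTop ∂fockMeasure c :=
        lintegral_congr fun z => (h' z).liminf_eq.symm
    _ ≤ liminf (fun k => ∫⁻ z in s, ‖f (k + k₀) z‖ₑ ^ 2 ∂fockMeasure c) atTop :=
        lintegral_liminf_le fun k => (hk₀ _ (Nat.le_add_left _ _)).1.enorm.pow_const 2
    _ ≤ A := by
        refine liminf_le_of_le (by isBoundedDefault) fun x hx => ?_
        obtain ⟨k, hk⟩ := hx.exists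
        exact hk.trans (hk₀ _ (Nat.le_add_left _ _)).2

lemma energy_le_of_tendsto {c : ℝ} {A : ℝ≥0∞} {f : ℕ → ℂ → ℂ} {g : ℂ → ℂ}
    (hf : ∀ᶠ k in atTop, Differentiable ℂ (f k))
    (hfA : ∀ᶠ k in atTop, energy c (f k) ≤ A)
    (h : ∀ z, Tendsto (fun k => f k z) atTop (𝓝 (g z))) : energy c g ≤ A := by
  have := setLIntegral_le_of_tendsto (s := Set.univ) (c := c) (A := A)
    (hf.mono fun k hk => hk.continuous.measurable) (by simpa [energy] using hfA) h
  simpa [energy] using this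

/-- A sequence of entire functions of bounded energy has a pointwise convergent subsequence. -/
lemma exists_subseq_tendsto_of_energy_le {c : ℝ} {A : ℝ≥0∞} (hA : A ≠ ⊤) {f : ℕ → ℂ → ℂ}
    (hf : ∀ k, Differentiable ℂ (f k)) (hfA : ∀ k, energy c (f k) ≤ A) :
    ∃ (g : ℂ → ℂ) (φ : ℕ → ℕ), StrictMono φ ∧
      ∀ z, Tendsto (fun k => f (φ k) z) atTop (𝓝 (g z)) := by
  choose B hB0 hB using fun M : ℝ => exists_norm_le_of_energy_le c M hA
  choose K hK0 hK using fun M : ℝ => exists_lipschitz_of_energy_le c M hA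
  -- Retaining only the pointwise and Lipschitz bounds gives a set closed under pointwise limits,
  -- hence compact in the product topology, as Arzelà–Ascoli asks.
  set T : Set (ℂ → ℂ) := {h | (∀ z, ‖h z‖ ≤ B ‖z‖) ∧ ∀ M z z', ‖z‖ ≤ M → ‖z'‖ ≤ M →
    ‖h z - h z'‖ ≤ K M * ‖z - z'‖} with hT
  have hTcont : ∀ h ∈ T, Continuous h := by
    intro h hh
    rw [Metric.continuous_iff]
    intro x ε hε
    refine ⟨min 1 (ε / (K (‖x‖ + 1) + 1)),
      lt_min one_pos (div_pos hε (by linarith [hK0 (‖x‖ + 1)])),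
      fun y hy => ?_⟩
    rw [dist_eq_norm] at hy ⊢
    have hy1 : ‖y‖ ≤ ‖x‖ + 1 := by
      have : ‖y‖ ≤ ‖x‖ + ‖y - x‖ := by
        calc ‖y‖ = ‖x + (y - x)‖ := by ring_nf
          _ ≤ _ := norm_add_le _ _
      linarith [min_le_left 1 (ε / (K (‖x‖ + 1) + 1))]
    refine (hh.2 (‖x‖ + 1) y x hy1 (by linarith)).trans_lt ?_
    have hp : 0 < K (‖x‖ + 1) + 1 := by linarith [hK0 (‖x‖ + 1)]
    calc K (‖x‖ + 1) * ‖y - x‖ ≤ (K (‖x‖ + 1) + 1) * ‖y - x‖ := by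
          gcongr; linarith
      _ < (K (‖x‖ + 1) + 1) * (ε / (K (‖x‖ + 1) + 1)) := by
          gcongr; exact hy.trans_le (min_le_right _ _)
      _ = ε := by field_simp
  have hTclosed : IsClosed T := by
    have : T = (⋂ z : ℂ, {a : ℂ → ℂ | ‖a z‖ ≤ B ‖z‖}) ∩
        ⋂ (M : ℝ) (z : ℂ) (z' : ℂ) (_ : ‖z‖ ≤ M) (_ : ‖z'‖ ≤ M),
          {a : ℂ → ℂ | ‖a z - a z'‖ ≤ K M * ‖z - z'‖} := by
      ext a; simp [hT]
    rw [this]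
    exact (isClosed_iInter fun z => isClosed_le (by fun_prop) (by fun_prop)).inter
      (isClosed_iInter fun M => isClosed_iInter fun z => isClosed_iInter fun z' =>
        isClosed_iInter fun _ => isClosed_iInter fun _ =>
          isClosed_le (by fun_prop) (by fun_prop))
  have hTcomp : IsCompact T := by
    refine IsCompact.of_isClosed_subset (isCompact_univ_pi fun z =>
      isCompact_closedBall (0 : ℂ) (B ‖z‖)) hTclosed fun h hh z _ => ?_
    simpa using hh.1 z
  set S : Set C(ℂ, ℂ) := {h | (h : ℂ → ℂ) ∈ T} with hS
  have hSim : ContinuousMap.toFun '' S = T := by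
    ext h
    constructor
    · rintro ⟨g, hg, rfl⟩; exact hg
    · intro hh; exact ⟨⟨h, hTcont h hh⟩, hh, rfl⟩
  have hScomp : IsCompact S := by
    refine ArzelaAscoli.isCompact_of_equicontinuous S (by rw [hSim]; exact hTcomp) ?_
    intro x
    rw [Metric.equicontinuousAt_iff]
    intro ε hε
    have hp : 0 < K (‖x‖ + 1) + 1 := by linarith [hK0 (‖x‖ + 1)]
    refine ⟨min 1 (ε / (K (‖x‖ + 1) + 1)), lt_min one_pos (div_pos hε hp), fun y hy i => ?_⟩
    rw [dist_comm, dist_eq_norm]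
    rw [dist_eq_norm] at hy
    have hy1 : ‖y‖ ≤ ‖x‖ + 1 := by
      have : ‖y‖ ≤ ‖x‖ + ‖y - x‖ := by
        calc ‖y‖ = ‖x + (y - x)‖ := by ring_nf
          _ ≤ _ := norm_add_le _ _
      linarith [min_le_left 1 (ε / (K (‖x‖ + 1) + 1))]
    refine (i.2.2 (‖x‖ + 1) y x hy1 (by linarith)).trans_lt ?_
    calc K (‖x‖ + 1) * ‖y - x‖ ≤ (K (‖x‖ + 1) + 1) * ‖y - x‖ := by
          gcongr; linarith
      _ < (K (‖x‖ + 1) + 1) * (ε / (K (‖x‖ + 1) + 1)) := by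
          gcongr; exact hy.trans_le (min_le_right _ _)
      _ = ε := by field_simp
  obtain ⟨g, -, φ, hφ, hlim⟩ := hScomp.tendsto_subseq
    (x := fun k => (⟨f k, (hf k).continuous⟩ : C(ℂ, ℂ)))
    (fun k => ⟨fun z => hB _ _ (hf k) (hfA k) z le_rfl,
      fun M z z' hz hz' => hK M _ (hf k) (hfA k) z z' hz hz'⟩)
  refine ⟨g, φ, hφ, fun z => ?_⟩
  exact ((continuous_eval_const z).tendsto g).comp hlim

/-! ### Tightness and convergence of pairings. -/

lemma sq_lintegral_mul_le {α : Type*} [MeasurableSpace α] (μ : Measure α) {u v : α → ℝ≥0∞}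
    (hu : AEMeasurable u μ) (hv : AEMeasurable v μ) :
    (∫⁻ x, u x * v x ∂μ) ^ 2 ≤ (∫⁻ x, u x ^ 2 ∂μ) * ∫⁻ x, v x ^ 2 ∂μ := by
  have h := ENNReal.lintegral_mul_le_Lp_mul_Lq μ Real.HolderConjugate.two_two hu hv
  have h2 := pow_le_pow_left' h 2
  have e : ∀ x : ℝ≥0∞, (x ^ (1 / 2 : ℝ)) ^ 2 = x := fun x => by
    rw [← ENNReal.rpow_natCast, ← ENNReal.rpow_mul]; norm_num
  simpa [mul_pow, e, ← one_div] using h2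

lemma sq_enorm_integral_mul_conj_le {α : Type*} [MeasurableSpace α] (μ : Measure α) {f g : α → ℂ}
    (hf : AEMeasurable f μ) (hg : AEMeasurable g μ) :
    ‖∫ x, f x * conj (g x) ∂μ‖ₑ ^ 2 ≤ (∫⁻ x, ‖f x‖ₑ ^ 2 ∂μ) * ∫⁻ x, ‖g x‖ₑ ^ 2 ∂μ := by
  refine le_trans (pow_le_pow_left' (enorm_integral_le_lintegral_enorm _) 2) ?_
  refine le_trans (le_of_eq ?_) (sq_lintegral_mul_le μ hf.enorm hg.enorm)
  simp

lemma integrable_mul_conj {α : Type*} [MeasurableSpace α] {μ : Measure α} {f g : α → ℂ}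
    (hf : AEMeasurable f μ) (hg : AEMeasurable g μ) (hf' : ∫⁻ x, ‖f x‖ₑ ^ 2 ∂μ ≠ ⊤)
    (hg' : ∫⁻ x, ‖g x‖ₑ ^ 2 ∂μ ≠ ⊤) : Integrable (fun x => f x * conj (g x)) μ := by
  refine ⟨(hf.mul (Complex.continuous_conj.measurable.comp_aemeasurable hg)).aestronglyMeasurable,
    ?_⟩
  have h : (∫⁻ x, ‖f x * conj (g x)‖ₑ ∂μ) ^ 2 < ⊤ := by
    refine lt_of_le_of_lt (le_trans (le_of_eq ?_) (sq_lintegral_mul_le μ hf.enorm hg.enorm))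
      (ENNReal.mul_lt_top hf'.lt_top hg'.lt_top)
    simp
  by_contra hcon
  rw [hasFiniteIntegral_iff_enorm, not_lt, top_le_iff] at hcon
  rw [hcon] at h
  simp at h

/-- A sequence is tight in `L²(fockMeasure c)` if it loses no mass at infinity. -/
def Tight (c : ℝ) (f : ℕ → ℂ → ℂ) : Prop :=
  ∀ η : ℝ≥0∞, 0 < η → ∃ M : ℝ, ∀ᶠ k in atTop,
    ∫⁻ z in (Metric.closedBall (0 : ℂ) M)ᶜ, ‖f k z‖ₑ ^ 2 ∂fockMeasure c ≤ η

lemma tight_const {c : ℝ} {f : ℂ → ℂ} (hfE : energy c f ≠ ⊤) :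
    Tight c fun _ => f := by
  intro η hη
  have hanti : Antitone fun n : ℕ => (Metric.closedBall (0 : ℂ) (n : ℝ))ᶜ := fun m n hmn =>
    Set.compl_subset_compl.2 (Metric.closedBall_subset_closedBall (by exact_mod_cast hmn))
  have hint : (⋂ n : ℕ, (Metric.closedBall (0 : ℂ) (n : ℝ))ᶜ) = ∅ := by
    rw [← Set.compl_iUnion, Metric.iUnion_closedBall_nat, Set.compl_univ]
  have hlim : Tendsto (fun n : ℕ => ∫⁻ z in (Metric.closedBall (0 : ℂ) (n : ℝ))ᶜ, ‖f z‖ₑ ^ 2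
      ∂fockMeasure c) atTop (𝓝 0) := by
    have h := tendsto_measure_iInter_atTop
      (μ := (fockMeasure c).withDensity fun z => ‖f z‖ₑ ^ 2)
      (s := fun n : ℕ => (Metric.closedBall (0 : ℂ) (n : ℝ))ᶜ)
      (fun n => (measurableSet_closedBall.compl).nullMeasurableSet) hanti ⟨0, ?_⟩
    · rw [hint, measure_empty] at h
      refine h.congr fun n => ?_
      simp [withDensity_apply _ measurableSet_closedBall.compl]
    · rw [withDensity_apply _ measurableSet_closedBall.compl]
      exact ne_top_of_le_ne_top hfE (setLIntegral_le_lintegral _ _)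
  obtain ⟨n, hn⟩ := ((ENNReal.tendsto_nhds_zero.1 hlim) η hη).exists
  exact ⟨n, Eventually.of_forall fun _ => hn⟩

/-- Chebyshev's inequality: on `|z| > n ≥ 1` the extra weight `|z|²` is at least `n`. This is why a
gain of one charge prevents the escape of mass. -/
lemma tight_of_energy_add_one_le {c : ℝ} {A : ℝ≥0∞} (hA : A ≠ ⊤) {f : ℕ → ℂ → ℂ}
    (hf : ∀ᶠ k in atTop, energy (c + 1) (f k) ≤ A) : Tight c f := by
  intro η hη
  have hlim : Tendsto (fun n : ℕ => A / (n : ℝ≥0∞)) atTop (𝓝 0) := by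
    have := ENNReal.Tendsto.const_div (a := A) ENNReal.tendsto_nat_nhds_top (Or.inr hA)
    simpa using this
  obtain ⟨n, hn, hn1⟩ := (((ENNReal.tendsto_nhds_zero.1 hlim) η hη).and
    (eventually_ge_atTop 1)).exists
  refine ⟨n, hf.mono fun k hk => ?_⟩
  refine le_trans ?_ hn
  rw [ENNReal.le_div_iff_mul_le (Or.inl (by simp; omega)) (Or.inl (ENNReal.natCast_ne_top n)),
    ← lintegral_mul_const' _ _ (ENNReal.natCast_ne_top n)]
  rw [← energy_mul_id] at hk
  refine le_trans (le_trans ?_ (setLIntegral_le_lintegral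
    (Metric.closedBall (0 : ℂ) (n : ℝ))ᶜ _)) hk
  refine setLIntegral_mono' measurableSet_closedBall.compl fun z hz => ?_
  have hz' : (n : ℝ) < ‖z‖ := by simpa using hz
  have hn1' : (1 : ℝ) ≤ n := by exact_mod_cast hn1
  rw [enorm_mul, mul_pow, mul_comm]
  refine mul_le_mul_left ?_ _
  rw [← ofReal_norm, ← ENNReal.ofReal_pow (norm_nonneg _), ← ENNReal.ofReal_natCast]
  exact ENNReal.ofReal_le_ofReal (by nlinarith)

/-- Pairings converge when both factors converge pointwise with bounded energy and one of them is
tight. -/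
lemma tendsto_integral_mul_conj {c : ℝ} (hc : -1 < c) {A : ℝ≥0∞} (hA : A ≠ ⊤)
    {f g : ℕ → ℂ → ℂ} {f₀ g₀ : ℂ → ℂ}
    (hf : ∀ᶠ k in atTop, Differentiable ℂ (f k)) (hg : ∀ᶠ k in atTop, Differentiable ℂ (g k))
    (hfA : ∀ᶠ k in atTop, energy c (f k) ≤ A) (hgA : ∀ᶠ k in atTop, energy c (g k) ≤ A)
    (hf₀ : ∀ z, Tendsto (fun k => f k z) atTop (𝓝 (f₀ z)))
    (hg₀ : ∀ z, Tendsto (fun k => g k z) atTop (𝓝 (g₀ z))) (htight : Tight c f) :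
    Tendsto (fun k => ∫ z, f k z * conj (g k z) ∂fockMeasure c) atTop
      (𝓝 (∫ z, f₀ z * conj (g₀ z) ∂fockMeasure c)) := by
  have := isFiniteMeasure_fockMeasure hc
  have hf₀d := differentiable_of_tendsto_of_energy_le hA hf hfA hf₀
  have hg₀d := differentiable_of_tendsto_of_energy_le hA hg hgA hg₀
  have hf₀A := energy_le_of_tendsto hf hfA hf₀
  have hg₀A := energy_le_of_tendsto hg hgA hg₀
  have hint : ∀ u v : ℂ → ℂ, Differentiable ℂ u → Differentiable ℂ v → energy c u ≤ A →
      energy c v ≤ A → Integrable (fun z => u z * conj (v z)) (fockMeasure c) :=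
    fun u v hu hv huA hvA => integrable_mul_conj hu.continuous.aemeasurable
      hv.continuous.aemeasurable (ne_top_of_le_ne_top hA huA) (ne_top_of_le_ne_top hA hvA)
  have htail : ∀ u v : ℂ → ℂ, Differentiable ℂ u → Differentiable ℂ v → energy c v ≤ A →
      ∀ (s : Set ℂ) (η : ℝ≥0∞), ∫⁻ z in s, ‖u z‖ₑ ^ 2 ∂fockMeasure c ≤ η →
      (∫⁻ z in s, ‖u z * conj (v z)‖ₑ ∂fockMeasure c) ^ 2 ≤ η * A := by
    intro u v hu hv hvA s η hη
    refine le_trans (le_trans (le_of_eq ?_) (sq_lintegral_mul_le _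
      hu.continuous.aemeasurable.enorm hv.continuous.aemeasurable.enorm))
      (mul_le_mul' hη ((setLIntegral_le_lintegral _ _).trans hvA))
    simp
  refine tendsto_integral_of_L1 _ (hint _ _ hf₀d hg₀d hf₀A hg₀A).aestronglyMeasurable
    (by filter_upwards [hf, hg, hfA, hgA] with k h1 h2 h3 h4 using hint _ _ h1 h2 h3 h4) ?_
  rw [ENNReal.tendsto_nhds_zero]
  intro ε hε
  obtain ⟨e, he0, heε⟩ : ∃ e : ℝ≥0, 0 < e ∧ 3 * (e : ℝ≥0∞) ≤ ε := by
    obtain ⟨e, he0, he⟩ := ENNReal.lt_iff_exists_nnreal_btwn.1 hε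
    have he0' : 0 < e := by exact_mod_cast he0
    refine ⟨e / 3, by positivity, le_trans (le_of_eq ?_) he.le⟩
    rw [ENNReal.coe_div (by norm_num)]
    exact ENNReal.mul_div_cancel (by norm_num) (by norm_num)
  have he2 : ((e : ℝ≥0∞)) ^ 2 ≠ 0 := by positivity
  -- With this tolerance Cauchy–Schwarz bounds the tail of the pairing by `e`, although only `f` is
  -- tight. The three errors (ball, tail of `f k`, tail of `f₀`) add up to `3e`.
  obtain ⟨M, hM⟩ := htight ((e : ℝ≥0∞) ^ 2 / (A + 1))
    (ENNReal.div_pos he2 (by simp [hA]))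
  have hηA : (e : ℝ≥0∞) ^ 2 / (A + 1) * A ≤ (e : ℝ≥0∞) ^ 2 := by
    calc (e : ℝ≥0∞) ^ 2 / (A + 1) * A ≤ (e : ℝ≥0∞) ^ 2 / (A + 1) * (A + 1) :=
          mul_le_mul_right le_self_add _
      _ = _ := ENNReal.div_mul_cancel (by simp) (by simp [hA])
  set s := Metric.closedBall (0 : ℂ) M with hs
  obtain ⟨B, hB0, hB⟩ := exists_norm_le_of_energy_le c M hA
  have hM₀ : ∫⁻ z in sᶜ, ‖f₀ z‖ₑ ^ 2 ∂fockMeasure c ≤ (e : ℝ≥0∞) ^ 2 / (A + 1) :=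
    setLIntegral_le_of_tendsto (hf.mono fun k hk => hk.continuous.measurable) hM hf₀
  have hball : Tendsto (fun k => ∫⁻ z in s, ‖f k z * conj (g k z) - f₀ z * conj (g₀ z)‖ₑ
      ∂fockMeasure c) atTop (𝓝 0) := by
    have h := tendsto_lintegral_filter_of_dominated_convergence
      (μ := (fockMeasure c).restrict s) (l := atTop)
      (F := fun k z => ‖f k z * conj (g k z) - f₀ z * conj (g₀ z)‖ₑ) (f := fun _ => 0)
      (fun _ => ENNReal.ofReal (2 * (B * B))) ?_ ?_ ?_ ?_
    · simpa using h
    · filter_upwards [hf, hg] with k h1 h2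
      exact (((h1.continuous.mul (Complex.continuous_conj.comp h2.continuous)).sub
        (hf₀d.continuous.mul (Complex.continuous_conj.comp hg₀d.continuous))).measurable).enorm
    · filter_upwards [hf, hg, hfA, hgA] with k h1 h2 h3 h4
      refine (ae_restrict_iff' measurableSet_closedBall).2 (Eventually.of_forall fun z hz => ?_)
      have hz' : ‖z‖ ≤ M := by simpa [hs] using hz
      rw [← ofReal_norm]
      refine ENNReal.ofReal_le_ofReal ((norm_sub_le _ _).trans ?_)
      have e1 := hB _ h1 h3 z hz'
      have e2 := hB _ h2 h4 z hz'
      have e3 := hB _ hf₀d hf₀A z hz'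
      have e4 := hB _ hg₀d hg₀A z hz'
      rw [norm_mul, norm_mul, RCLike.norm_conj, RCLike.norm_conj]
      have := mul_le_mul e1 e2 (norm_nonneg _) hB0
      have := mul_le_mul e3 e4 (norm_nonneg _) hB0
      linarith
    · rw [lintegral_const]
      exact ENNReal.mul_ne_top ENNReal.ofReal_ne_top (measure_ne_top _ _)
    · refine Eventually.of_forall fun z => ?_
      have h1 := ((hf₀ z).mul ((Complex.continuous_conj.tendsto _).comp (hg₀ z))).sub_const
        (f₀ z * conj (g₀ z))
      have h2 := h1.enorm
      simpa using h2
  filter_upwards [hf, hg, hgA, hM, (ENNReal.tendsto_nhds_zero.1 hball) e (by exact_mod_cast he0)]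
    with k h1 h2 h3 h4 h5
  rw [← lintegral_add_compl _ (measurableSet_closedBall (x := (0 : ℂ)) (ε := M))]
  have t1 : ∫⁻ z in sᶜ, ‖f k z * conj (g k z)‖ₑ ∂fockMeasure c ≤ e :=
    (ENNReal.pow_le_pow_left_iff two_ne_zero).1 ((htail _ _ h1 h2 h3 _ _ h4).trans hηA)
  have t2 : ∫⁻ z in sᶜ, ‖f₀ z * conj (g₀ z)‖ₑ ∂fockMeasure c ≤ e :=
    (ENNReal.pow_le_pow_left_iff two_ne_zero).1 ((htail _ _ hf₀d hg₀d hg₀A _ _ hM₀).trans hηA)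
  have t3 : ∫⁻ z in sᶜ, ‖f k z * conj (g k z) - f₀ z * conj (g₀ z)‖ₑ ∂fockMeasure c ≤ e + e := by
    refine le_trans (lintegral_mono fun z => enorm_sub_le) ?_
    rw [lintegral_add_left]
    · exact add_le_add t1 t2
    · exact ((h1.continuous.mul (Complex.continuous_conj.comp h2.continuous))).measurable.enorm
  refine le_trans (add_le_add h5 t3) (le_trans (le_of_eq ?_) heε)
  ring

/-! ### Deformed Weyl translations. -/

lemma lintegral_comp_mul_sub {α : ℂ} (hα : α ≠ 0) (a : ℂ) {G : ℂ → ℝ≥0∞} (hG : Measurable G) :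
    ∫⁻ z, G (α * z - a) = ENNReal.ofReal (‖α‖ ^ 2)⁻¹ * ∫⁻ z, G z := by
  have hdet : LinearMap.det (LinearMap.mulLeft ℝ α) = ‖α‖ ^ 2 := by
    rw [← Complex.normSq_eq_norm_sq, ← Algebra.norm_complex_apply]
    rfl
  have hne : LinearMap.det (LinearMap.mulLeft ℝ α) ≠ 0 := by
    rw [hdet]; exact pow_ne_zero 2 (norm_ne_zero_iff.2 hα)
  have hmap := Measure.map_linearMap_addHaar_eq_smul_addHaar (volume : Measure ℂ) hne
  have h1 : ∫⁻ z, G (α * z - a) =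
      ∫⁻ z, G (z - a) ∂(Measure.map (LinearMap.mulLeft ℝ α) volume) := by
    rw [lintegral_map (f := fun z => G (z - a)) (hG.comp (measurable_id.sub_const a))]
    · rfl
    · exact (continuous_const.mul continuous_id : Continuous fun z => α * z).measurable
  rw [h1, hmap, lintegral_smul_measure, smul_eq_mul, lintegral_sub_right_eq_self G a, hdet,
    abs_of_nonneg (by positivity)]

/-- The deformed Weyl translation `f ↦ e^{ā z} f((1 - δ ā) z - a)`. -/
def weyl (δ : ℝ) (a : ℂ) (f : ℂ → ℂ) (z : ℂ) : ℂ :=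
  Complex.exp (conj a * z) * f ((1 - δ * conj a) * z - a)

/-- The difference of the two sides is `|a - δ ā z|² + 2δ (Re a - δ|a|²) |z|²`. For `δ = 0` it is
`|a|²`: the translation is then the usual one, with `2 Re(ā z) - |z|² = -|z-a|² + |a|²`. -/
lemma weyl_exponent_le {δ : ℝ} (hδ : 0 ≤ δ) {a : ℂ} (ha : δ * ‖a‖ ^ 2 ≤ a.re) (z : ℂ) :
    2 * (conj a * z).re - ‖z‖ ^ 2 ≤ -‖(1 - δ * conj a) * z - a‖ ^ 2 + 2 * ‖a‖ ^ 2 := by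
  set x := z.re; set y := z.im; set p := a.re with hp; set q := a.im
  have ha2 : ‖a‖ ^ 2 = p ^ 2 + q ^ 2 := by rw [Complex.sq_norm, Complex.normSq_apply]; ring
  have hz2 : ‖z‖ ^ 2 = x ^ 2 + y ^ 2 := by rw [Complex.sq_norm, Complex.normSq_apply]; ring
  have hw2 : ‖(1 - δ * conj a) * z - a‖ ^ 2 =
      ((1 - δ * p) * x - δ * q * y - p) ^ 2 + ((1 - δ * p) * y + δ * q * x - q) ^ 2 := by
    rw [Complex.sq_norm, Complex.normSq_apply]
    simp only [Complex.sub_re, Complex.mul_re, Complex.one_re, Complex.ofReal_re, Complex.conj_re,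
      Complex.ofReal_im, Complex.conj_im, Complex.sub_im, Complex.mul_im, Complex.one_im]
    ring
  have hre : (conj a * z).re = p * x + q * y := by
    simp [Complex.mul_re, p, q, x, y]
  rw [hw2, hz2, hre, ha2]
  rw [ha2] at ha
  have hfin : 0 ≤ δ * (p - δ * (p ^ 2 + q ^ 2)) * (x ^ 2 + y ^ 2) :=
    mul_nonneg (mul_nonneg hδ (by linarith)) (by positivity)
  linarith [sq_nonneg (p - δ * (p * x + q * y)), sq_nonneg (q - δ * (p * y - q * x))]

/-- After the substitution `ζ = αz - a`, `α = 1 - δā`, the weight becomes `|α|^{-2c} |ζ + a|^{2c}`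
times a Gaussian in `ζ`, which the shifted-weight estimate controls. Together with the Jacobian
`|α|^{-2}` this costs `|α|^{-2(c+1)} ≤ 2^{2(c+1)}`, as `|α| ≥ 1/2` and `c > -1`. -/
lemma exists_energy_weyl_le {c : ℝ} (hc : -1 < c) : ∃ C : ℝ≥0, ∀ (δ : ℝ) (a : ℂ), 0 ≤ δ →
    δ ≤ 1 / 2 → ‖a‖ ≤ 1 → δ * ‖a‖ ^ 2 ≤ a.re → ∀ f : ℂ → ℂ, Differentiable ℂ f →
    energy c (weyl δ a f) ≤ C * energy c f := by
  obtain ⟨C, hC⟩ := exists_lintegral_shift_le_energy hc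
  refine ⟨Real.toNNReal (Real.exp 2 * 2 ^ (2 * (c + 1))) * C, fun δ a hδ hδ2 ha hre f hf => ?_⟩
  set α : ℂ := 1 - δ * conj a with hα
  have hα2 : 1 / 2 ≤ ‖α‖ := by
    have h1 : ‖(δ : ℂ) * conj a‖ ≤ 1 / 2 := by
      rw [norm_mul, RCLike.norm_conj, Complex.norm_real, Real.norm_of_nonneg hδ]
      nlinarith [norm_nonneg a]
    have h2 := norm_sub_norm_le (1 : ℂ) (δ * conj a)
    rw [norm_one] at h2
    linarith
  have hα0 : α ≠ 0 := norm_pos_iff.1 (by linarith)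
  set G : ℂ → ℝ≥0∞ := fun ζ =>
    ENNReal.ofReal (Real.exp 2 * (‖α‖ ^ (-(2 * c)) * (‖ζ + a‖ ^ (2 * c) * Real.exp (-‖ζ‖ ^ 2)))) *
      ‖f ζ‖ₑ ^ 2 with hG
  have hGm : Measurable G := by
    have := hf.continuous.measurable
    fun_prop
  have h1 : energy c (weyl δ a f) ≤ ∫⁻ z, G (α * z - a) ∂areaMeasure := by
    unfold energy
    rw [lintegral_fockMeasure]
    refine lintegral_mono fun z => ?_
    simp only [weyl, hG, enorm_mul, mul_pow]
    rw [← mul_assoc]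
    refine mul_le_mul_left ?_ _
    rw [← ofReal_norm, ← ENNReal.ofReal_pow (norm_nonneg _), ← ENNReal.ofReal_mul (wt_nonneg _ _)]
    refine ENNReal.ofReal_le_ofReal ?_
    rw [sub_add_cancel, norm_mul, Real.mul_rpow (norm_nonneg _) (norm_nonneg _), Complex.norm_exp,
      ← mul_assoc (‖α‖ ^ (-(2 * c))), ← mul_assoc (‖α‖ ^ (-(2 * c))),
      ← Real.rpow_add (by linarith), neg_add_cancel, Real.rpow_zero, one_mul, wt, mul_assoc,
      ← Real.exp_nat_mul, ← Real.exp_add, mul_left_comm, ← Real.exp_add]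
    refine mul_le_mul_of_nonneg_left (Real.exp_le_exp.2 ?_) (by positivity)
    have := weyl_exponent_le hδ hre z
    rw [← hα] at this
    push_cast
    nlinarith [norm_nonneg a]
  refine h1.trans ?_
  rw [lintegral_areaMeasure, lintegral_comp_mul_sub hα0 a hGm, mul_left_comm,
    ← lintegral_areaMeasure]
  have h2 : ∫⁻ z, G z ∂areaMeasure ≤ ENNReal.ofReal (Real.exp 2 * ‖α‖ ^ (-(2 * c))) *
      (C * energy c f) := by
    refine le_trans (le_of_eq ?_) (mul_le_mul_right (hC a ha f hf) _)
    rw [← lintegral_const_mul' _ _ ENNReal.ofReal_ne_top]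
    refine lintegral_congr fun z => ?_
    rw [← mul_assoc, ← ENNReal.ofReal_mul (by positivity)]
    simp only [hG, mul_assoc]
  refine (mul_le_mul_right h2 _).trans ?_
  rw [← mul_assoc, ← ENNReal.ofReal_mul (by positivity), ENNReal.coe_mul, mul_assoc]
  refine mul_le_mul_left ?_ _
  change _ ≤ ENNReal.ofReal _
  refine ENNReal.ofReal_le_ofReal ?_
  have hpos : 0 < ‖α‖ := by linarith
  have e1 : (‖α‖ ^ 2)⁻¹ * (Real.exp 2 * ‖α‖ ^ (-(2 * c))) =
      Real.exp 2 * ‖α‖ ^ (-(2 * (c + 1))) := by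
    rw [show -(2 * (c + 1)) = -(2 * c) - (2 : ℕ) by push_cast; ring, Real.rpow_sub_natCast hpos.ne']
    field_simp
  rw [e1]
  refine mul_le_mul_of_nonneg_left ?_ (Real.exp_pos _).le
  rw [Real.rpow_neg hpos.le, ← Real.inv_rpow hpos.le]
  refine Real.rpow_le_rpow (by positivity) ?_ (by linarith)
  rw [inv_le_comm₀ hpos (by norm_num)]
  linarith

lemma continuous_weyl (δ : ℝ) {f : ℂ → ℂ} (hf : Continuous f) :
    Continuous fun p : ℂ × ℂ => weyl δ p.1 f p.2 := by
  unfold weyl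
  have := Complex.continuous_conj
  fun_prop

/-- The average of the deformed translations against a density. -/
def weylAvg (δ : ℝ) (σ : ℂ → ℂ) (f : ℂ → ℂ) (z : ℂ) : ℂ := ∫ a, σ a * weyl δ a f z

/-- Minkowski's inequality in quadratic form: Cauchy–Schwarz against `|σ(a)| d²a`, then Tonelli.
Only the `L¹` norm of the density enters, so `C` serves all `δ` and `σ` at once. -/
lemma exists_energy_weylAvg_le {c : ℝ} (hc : -1 < c) : ∃ C : ℝ≥0, ∀ (δ : ℝ) (σ : ℂ → ℂ), 0 ≤ δ →
    δ ≤ 1 / 2 → Continuous σ → (∀ a, σ a ≠ 0 → ‖a‖ ≤ 1 ∧ δ * ‖a‖ ^ 2 ≤ a.re) →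
    ∀ f : ℂ → ℂ, Differentiable ℂ f →
    energy c (weylAvg δ σ f) ≤ (∫⁻ a, ‖σ a‖ₑ) ^ 2 * (C * energy c f) := by
  have := isFiniteMeasure_fockMeasure hc
  obtain ⟨C, hC⟩ := exists_energy_weyl_le hc
  refine ⟨C, fun δ σ hδ hδ2 hσ hsupp f hf => ?_⟩
  have hσm : Measurable fun a => ‖σ a‖ₑ := hσ.measurable.enorm
  have hVm : Measurable fun p : ℂ × ℂ => ‖weyl δ p.2 f p.1‖ₑ ^ 2 :=
    ((continuous_weyl δ hf.continuous).comp continuous_swap).measurable.enorm.pow_const 2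
  have hW : Measurable fun p : ℂ × ℂ => ‖σ p.2‖ₑ * ‖weyl δ p.2 f p.1‖ₑ ^ 2 :=
    (hσm.comp measurable_snd).mul hVm
  have h1 : ∀ z, ‖weylAvg δ σ f z‖ₑ ^ 2 ≤
      (∫⁻ a, ‖σ a‖ₑ) * ∫⁻ a, ‖σ a‖ₑ * ‖weyl δ a f z‖ₑ ^ 2 := by
    intro z
    have hVz : Measurable fun a => ‖weyl δ a f z‖ₑ :=
      ((continuous_weyl δ hf.continuous).comp (.prodMk_left z)).measurable.enorm
    have h := sq_lintegral_mul_le (volume.withDensity fun a => ‖σ a‖ₑ) (u := fun _ => 1)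
      (v := fun a => ‖weyl δ a f z‖ₑ) aemeasurable_const hVz.aemeasurable
    simp only [one_mul, one_pow] at h
    rw [lintegral_withDensity_eq_lintegral_mul _ hσm hVz,
      lintegral_withDensity_eq_lintegral_mul _ hσm measurable_const,
      lintegral_withDensity_eq_lintegral_mul _ hσm (hVz.pow_const 2)] at h
    simp only [Pi.mul_apply, mul_one] at h
    refine le_trans (pow_le_pow_left' ?_ 2) h
    refine (enorm_integral_le_lintegral_enorm _).trans (le_of_eq ?_)
    simp
  unfold energy
  calc ∫⁻ z, ‖weylAvg δ σ f z‖ₑ ^ 2 ∂fockMeasure c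
      ≤ ∫⁻ z, ((∫⁻ a, ‖σ a‖ₑ) * ∫⁻ a, ‖σ a‖ₑ * ‖weyl δ a f z‖ₑ ^ 2) ∂fockMeasure c :=
        lintegral_mono h1
    _ = (∫⁻ a, ‖σ a‖ₑ) * ∫⁻ z, (∫⁻ a, ‖σ a‖ₑ * ‖weyl δ a f z‖ₑ ^ 2) ∂fockMeasure c := by
        rw [lintegral_const_mul]
        exact hW.lintegral_prod_right'
    _ = (∫⁻ a, ‖σ a‖ₑ) * ∫⁻ a, (∫⁻ z, ‖σ a‖ₑ * ‖weyl δ a f z‖ₑ ^ 2 ∂fockMeasure c) := by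
        rw [lintegral_lintegral_swap]
        exact hW.aemeasurable
    _ ≤ (∫⁻ a, ‖σ a‖ₑ) * ∫⁻ a, ‖σ a‖ₑ * (C * energy c f) := by
        refine mul_le_mul_right (lintegral_mono fun a => ?_) _
        rw [lintegral_const_mul' _ _ enorm_ne_top]
        by_cases ha : σ a = 0
        · simp [ha]
        · exact mul_le_mul_right (hC δ a hδ hδ2 (hsupp a ha).1 (hsupp a ha).2 f hf) _
    _ = _ := by rw [lintegral_mul_const _ hσm, energy]; ring

/-! ### Mollifiers and the regularisation that gains one charge. -/

/-- A smooth approximate identity supported in the disc of centre `2ε` and radius `ε`. -/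
structure Mollifier (ε : ℝ) where
  /-- The density. -/
  toFun : ℂ → ℂ
  contDiff : ContDiff ℝ 1 toFun
  tsupport_subset : tsupport toFun ⊆ Metric.closedBall ((2 * ε : ℝ) : ℂ) ε
  integral_eq_one : ∫ a, toFun a = 1
  lintegral_enorm : ∫⁻ a, ‖toFun a‖ₑ = 1

lemma nonempty_mollifier {ε : ℝ} (hε : 0 < ε) : Nonempty (Mollifier ε) := by
  let φ : ContDiffBump ((2 * ε : ℝ) : ℂ) := ⟨ε / 2, ε, by positivity, by linarith⟩
  have hsup : Function.support (fun a => ((φ.normed volume a : ℝ) : ℂ)) =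
      Function.support (φ.normed volume) := by ext a; simp
  refine ⟨⟨fun a => ((φ.normed volume a : ℝ) : ℂ), ?_, ?_, ?_, ?_⟩⟩
  · exact Complex.ofRealCLM.contDiff.comp (φ.contDiff_normed (n := 1))
  · rw [tsupport, hsup, ← tsupport, φ.tsupport_normed_eq]
  · rw [integral_complex_ofReal, φ.integral_normed, Complex.ofReal_one]
  · have h : ∀ a, ‖((φ.normed volume a : ℝ) : ℂ)‖ₑ = ENNReal.ofReal (φ.normed volume a) :=
      fun a => by
      rw [← ofReal_norm, Complex.norm_real, Real.norm_of_nonneg (φ.nonneg_normed a)]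
    simp_rw [h]
    rw [← ofReal_integral_eq_lintegral_ofReal φ.integrable_normed
      (Eventually.of_forall φ.nonneg_normed), φ.integral_normed, ENNReal.ofReal_one]

/-- The Wirtinger derivative `∂`. -/
def dz (ρ : ℂ → ℂ) (a : ℂ) : ℂ := (fderiv ℝ ρ a 1 - Complex.I * fderiv ℝ ρ a Complex.I) / 2

/-- The Wirtinger derivative `∂̄`. -/
def dzbar (ρ : ℂ → ℂ) (a : ℂ) : ℂ := (fderiv ℝ ρ a 1 + Complex.I * fderiv ℝ ρ a Complex.I) / 2

/-- The regularisation `f ↦ ∫ (ρ - δ ∂ρ)(a) e^{ā z} f((1 - δ ā) z - a) d²a`. -/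
def reg (δ : ℝ) (ρ : ℂ → ℂ) (f : ℂ → ℂ) : ℂ → ℂ := weylAvg δ (fun a => ρ a - δ * dz ρ a) f

namespace Mollifier

variable {ε : ℝ} (ρ : Mollifier ε)

lemma hasCompactSupport : HasCompactSupport ρ.toFun :=
  (isCompact_closedBall _ _).of_isClosed_subset (isClosed_tsupport _) ρ.tsupport_subset

lemma continuous_fderiv (v : ℂ) : Continuous fun a => fderiv ℝ ρ.toFun a v :=
  (ρ.contDiff.continuous_fderiv one_ne_zero).clm_apply continuous_const

lemma continuous_dz : Continuous (dz ρ.toFun) :=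
  ((ρ.continuous_fderiv 1).sub (continuous_const.mul (ρ.continuous_fderiv _))).div_const 2

lemma continuous_dzbar : Continuous (dzbar ρ.toFun) :=
  ((ρ.continuous_fderiv 1).add (continuous_const.mul (ρ.continuous_fderiv _))).div_const 2

lemma fderiv_eq_zero {a : ℂ} (ha : a ∉ tsupport ρ.toFun) : fderiv ℝ ρ.toFun a = 0 := by
  by_contra h
  exact ha (support_fderiv_subset ℝ h)

lemma dz_eq_zero {a : ℂ} (ha : a ∉ tsupport ρ.toFun) : dz ρ.toFun a = 0 := by
  simp [dz, ρ.fderiv_eq_zero ha]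

lemma dzbar_eq_zero {a : ℂ} (ha : a ∉ tsupport ρ.toFun) : dzbar ρ.toFun a = 0 := by
  simp [dzbar, ρ.fderiv_eq_zero ha]

lemma eq_zero {a : ℂ} (ha : a ∉ tsupport ρ.toFun) : ρ.toFun a = 0 :=
  image_eq_zero_of_notMem_tsupport ha

lemma continuous_density (δ : ℝ) : Continuous fun a => ρ.toFun a - δ * dz ρ.toFun a :=
  ρ.contDiff.continuous.sub (continuous_const.mul ρ.continuous_dz)

lemma norm_le_of_mem {a : ℂ} (ha : a ∈ tsupport ρ.toFun) : ‖a‖ ≤ 3 * ε ∧ ε ≤ a.re := by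
  have h : ‖a - ((2 * ε : ℝ) : ℂ)‖ ≤ ε := by
    simpa [dist_eq_norm] using ρ.tsupport_subset ha
  have hε : 0 ≤ ε := (norm_nonneg _).trans h
  constructor
  · have := norm_add_le (a - ((2 * ε : ℝ) : ℂ)) ((2 * ε : ℝ) : ℂ)
    rw [sub_add_cancel, Complex.norm_real, Real.norm_of_nonneg (by linarith)] at this
    linarith
  · have h1 := (abs_le.1 (Complex.abs_re_le_norm (a - ((2 * ε : ℝ) : ℂ)))).1
    rw [Complex.sub_re, Complex.ofReal_re] at h1
    linarith

/-- The disc is centred at `2ε` rather than `0` so that `Re a ≥ ε`. With `|a| ≤ 3ε`, this gives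
`δ|a|² ≤ 3ε² ≤ ε ≤ Re a`. -/
lemma support_cond (hε : ε ≤ 1 / 3) {δ : ℝ} (hδ2 : δ ≤ 1 / 3) {a : ℂ}
    (ha : a ∈ tsupport ρ.toFun) : ‖a‖ ≤ 1 ∧ δ * ‖a‖ ^ 2 ≤ a.re := by
  obtain ⟨h1, h2⟩ := ρ.norm_le_of_mem ha
  refine ⟨by linarith, ?_⟩
  nlinarith [norm_nonneg a, mul_le_mul h1 h1 (norm_nonneg a) (by linarith [norm_nonneg a])]

lemma integrable_mul {σ G : ℂ → ℂ} (hσ : Continuous σ) (hG : Continuous G)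
    (h0 : ∀ a ∉ tsupport ρ.toFun, σ a = 0) : Integrable fun a => σ a * G a :=
  (hσ.mul hG).integrable_of_hasCompactSupport
    (HasCompactSupport.intro ρ.hasCompactSupport fun a ha => by simp [h0 a ha])

lemma lintegral_enorm_ne_top {σ : ℂ → ℂ} (hσ : Continuous σ)
    (h0 : ∀ a ∉ tsupport ρ.toFun, σ a = 0) : ∫⁻ a, ‖σ a‖ₑ ≠ ⊤ := by
  have h := ρ.integrable_mul hσ (continuous_const (y := (1 : ℂ))) h0
  simp only [mul_one] at h
  exact h.hasFiniteIntegral.ne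

end Mollifier

/-- With `G = weyl δ a f z` and `H` the same for `f'`, the formula says `∂̄G = z(G - δH)` and `∂G =
-H` in the variable `a`. Hence `zG = ∂̄G - δz ∂G`. -/
lemma hasLineDerivAt_weyl (δ : ℝ) {f : ℂ → ℂ} (hf : Differentiable ℂ f) (z a v : ℂ) :
    HasLineDerivAt ℝ (fun a => weyl δ a f z)
      (conj v * (z * weyl δ a f z - δ * z * weyl δ a (deriv f) z) - v * weyl δ a (deriv f) z)
      a v := by
  unfold HasLineDerivAt weyl
  have hline : HasDerivAt (fun t : ℝ => a + t • v) v 0 := by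
    have := ((hasDerivAt_id (0 : ℝ)).smul_const v).const_add a
    simpa using this
  have hconj : HasDerivAt (fun t : ℝ => conj (a + t • v)) (conj v) 0 :=
    hline.star
  have h1 : HasDerivAt (fun t : ℝ => Complex.exp (conj (a + t • v) * z))
      (Complex.exp (conj (a + (0 : ℝ) • v) * z) * (conj v * z)) 0 :=
    (hconj.mul_const z).cexp
  have h2 : HasDerivAt (fun t : ℝ => (1 - δ * conj (a + t • v)) * z - (a + t • v))
      (-(δ * conj v) * z - v) 0 :=
    (((hconj.const_mul (δ : ℂ)).const_sub 1).mul_const z).sub hline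
  have h3 := (hf ((1 - δ * conj (a + (0 : ℝ) • v)) * z - (a + (0 : ℝ) • v))).hasDerivAt.comp 0 h2
  have h4 := h1.mul h3
  refine h4.congr_deriv ?_
  simp only [zero_smul, add_zero]
  simp only [Function.comp, zero_smul, add_zero]
  ring

lemma differentiable_deriv {f : ℂ → ℂ} (hf : Differentiable ℂ f) : Differentiable ℂ (deriv f) :=
  differentiableOn_univ.1 (hf.differentiableOn.deriv isOpen_univ)

lemma continuous_weyl_left (δ : ℝ) {f : ℂ → ℂ} (hf : Continuous f) (z : ℂ) :
    Continuous fun a => weyl δ a f z :=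
  (continuous_weyl δ hf).comp (.prodMk_left z)

/-- Integration by parts: multiplication by `z` falls on the density. -/
lemma mul_reg {ε : ℝ} (ρ : Mollifier ε) (δ : ℝ) {f : ℂ → ℂ} (hf : Differentiable ℂ f) (z : ℂ) :
    z * reg δ ρ.toFun f z = -weylAvg δ (dzbar ρ.toFun) f z := by
  set G : ℂ → ℂ := fun a => weyl δ a f z with hG
  set H : ℂ → ℂ := fun a => weyl δ a (deriv f) z with hH
  have hGc : Continuous G := continuous_weyl_left δ hf.continuous z
  have hHc : Continuous H := continuous_weyl_left δ (differentiable_deriv hf).continuous z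
  have hρc := ρ.contDiff.continuous
  -- Integrating `zG = ∂̄G - δz ∂G` against `ρ` gives `z ∫ (ρ - δ∂ρ) G = -∫ ∂̄ρ G`. This dictates
  -- the density in `reg`; the directions `1` and `I` supply the two Wirtinger derivatives.
  have hparts : ∀ v : ℂ, ∫ a, ρ.toFun a * (conj v * (z * G a - δ * z * H a) - v * H a) =
      -∫ a, fderiv ℝ ρ.toFun a v * G a := by
    intro v
    refine integral_bilinear_hasLineDerivAt_right_eq_neg_left_of_integrable
      (B := ContinuousLinearMap.mul ℝ ℂ) (v := v) ?_ ?_ ?_ ?_ ?_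
    · exact ρ.integrable_mul (ρ.continuous_fderiv v) hGc fun a ha => by simp [ρ.fderiv_eq_zero ha]
    · exact ρ.integrable_mul hρc (by fun_prop) fun a ha => ρ.eq_zero ha
    · exact ρ.integrable_mul hρc hGc fun a ha => ρ.eq_zero ha
    · intro a _
      exact ((ρ.contDiff.differentiable one_ne_zero) a).hasFDerivAt.hasLineDerivAt v
    · intro a _
      exact hasLineDerivAt_weyl δ hf z a v
  have iG := ρ.integrable_mul hρc hGc fun a ha => ρ.eq_zero ha
  have iH := ρ.integrable_mul hρc hHc fun a ha => ρ.eq_zero ha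
  have i1 := ρ.integrable_mul (ρ.continuous_fderiv 1) hGc fun a ha => by simp [ρ.fderiv_eq_zero ha]
  have i2 := ρ.integrable_mul (ρ.continuous_fderiv Complex.I) hGc
    fun a ha => by simp [ρ.fderiv_eq_zero ha]
  have e : ∀ v : ℂ, ∫ a, ρ.toFun a * (conj v * (z * G a - δ * z * H a) - v * H a) =
      conj v * (z * (∫ a, ρ.toFun a * G a) - δ * z * ∫ a, ρ.toFun a * H a) -
        v * ∫ a, ρ.toFun a * H a := by
    intro v
    have h : ∀ a, ρ.toFun a * (conj v * (z * G a - δ * z * H a) - v * H a) =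
        conj v * z * (ρ.toFun a * G a) - (conj v * δ * z + v) * (ρ.toFun a * H a) :=
      fun a => by ring
    simp_rw [h]
    rw [integral_sub (iG.const_mul _) (iH.const_mul _), integral_const_mul, integral_const_mul]
    ring
  have p1 := hparts 1
  have p2 := hparts Complex.I
  rw [e] at p1 p2
  set IG := ∫ a, ρ.toFun a * G a
  set IH := ∫ a, ρ.toFun a * H a
  set D1 := ∫ a, fderiv ℝ ρ.toFun a 1 * G a
  set D2 := ∫ a, fderiv ℝ ρ.toFun a Complex.I * G a
  have hreg : reg δ ρ.toFun f z = IG - δ * ((D1 - Complex.I * D2) / 2) := by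
    have h : ∀ a, (ρ.toFun a - δ * dz ρ.toFun a) * weyl δ a f z =
        ρ.toFun a * G a - δ / 2 * (fderiv ℝ ρ.toFun a 1 * G a) +
          δ * Complex.I / 2 * (fderiv ℝ ρ.toFun a Complex.I * G a) := fun a => by
      simp only [dz, hG]; ring
    unfold reg weylAvg
    simp_rw [h]
    have i3 : Integrable fun a => ρ.toFun a * G a - δ / 2 * (fderiv ℝ ρ.toFun a 1 * G a) :=
      iG.sub (i1.const_mul _)
    rw [integral_add i3 (i2.const_mul _), integral_sub iG (i1.const_mul _),
      integral_const_mul, integral_const_mul]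
    ring
  have hbar : weylAvg δ (dzbar ρ.toFun) f z = (D1 + Complex.I * D2) / 2 := by
    have h : ∀ a, dzbar ρ.toFun a * weyl δ a f z =
        1 / 2 * (fderiv ℝ ρ.toFun a 1 * G a) +
          Complex.I / 2 * (fderiv ℝ ρ.toFun a Complex.I * G a) := fun a => by
      simp only [dzbar, hG]; ring
    unfold weylAvg
    simp_rw [h]
    rw [integral_add (i1.const_mul _) (i2.const_mul _), integral_const_mul, integral_const_mul]
    ring
  rw [hreg, hbar]
  simp only [map_one, Complex.conj_I] at p1 p2
  have hI : Complex.I * Complex.I = -1 := Complex.I_mul_I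
  linear_combination (1 / 2 - δ * z / 2) * p1 + (Complex.I / 2 + δ * z * Complex.I / 2) * p2 +
    ((z * IG - δ * z * IH) / 2 * (1 + δ * z) + IH * (1 + δ * z) / 2) * hI

/-- `f = p e^{bz}` for a polynomial `p` of degree less than `n`. -/
def IsWeightedPoly (n : ℕ) (b : ℝ) (f : ℂ → ℂ) : Prop :=
  ∃ p : ℂ[X], p.degree < n ∧ ∀ z, f z = p.eval z * Complex.exp (b * z)

lemma IsWeightedPoly.differentiable {n : ℕ} {b : ℝ} {f : ℂ → ℂ} (hf : IsWeightedPoly n b f) :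
    Differentiable ℂ f := by
  obtain ⟨p, -, hp⟩ := hf
  rw [funext hp]
  exact p.differentiable.mul (by fun_prop)

/-- Here `C` depends neither on `ε` nor on `ρ`, only the admissible range of `δ` does. This
uniformity is needed when the mollifiers shrink. -/
lemma exists_energy_reg_le {c : ℝ} (hc : -1 < c) : ∃ C : ℝ≥0, ∀ (ε : ℝ) (ρ : Mollifier ε),
    ε ≤ 1 / 3 → ∃ δ₀ > 0, ∀ δ : ℝ, 0 ≤ δ → δ ≤ δ₀ → ∀ f : ℂ → ℂ, Differentiable ℂ f →
    energy c (reg δ ρ.toFun f) ≤ C * energy c f := by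
  obtain ⟨C, hC⟩ := exists_energy_weylAvg_le hc
  refine ⟨4 * C, fun ε ρ hε => ?_⟩
  have hfin := ρ.lintegral_enorm_ne_top ρ.continuous_dz fun a ha => ρ.dz_eq_zero ha
  set D := (∫⁻ a, ‖dz ρ.toFun a‖ₑ).toReal with hD
  have hD0 : 0 ≤ D := ENNReal.toReal_nonneg
  -- The second bound makes `δ ‖∂ρ‖₁ ≤ 1`, so the density has `L¹` norm at most `2`.
  refine ⟨min (1 / 3) (1 / (D + 1)), by positivity, fun δ hδ hδ₀ f hf => ?_⟩
  have hδ3 : δ ≤ 1 / 3 := hδ₀.trans (min_le_left _ _)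
  have hδD : δ * D ≤ 1 := by
    have h1 : δ ≤ 1 / (D + 1) := hδ₀.trans (min_le_right _ _)
    calc δ * D ≤ 1 / (D + 1) * (D + 1) := mul_le_mul h1 (by linarith) hD0 (by positivity)
      _ = 1 := by field_simp
  have h := hC δ (fun a => ρ.toFun a - δ * dz ρ.toFun a) hδ (by linarith) (ρ.continuous_density δ)
    (fun a ha => ρ.support_cond hε hδ3 (by
      by_contra hcon
      exact ha (by simp [ρ.eq_zero hcon, ρ.dz_eq_zero hcon]))) f hf
  refine h.trans ?_
  have hL1 : ∫⁻ a, ‖ρ.toFun a - δ * dz ρ.toFun a‖ₑ ≤ 2 := by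
    calc ∫⁻ a, ‖ρ.toFun a - δ * dz ρ.toFun a‖ₑ
        ≤ ∫⁻ a, (‖ρ.toFun a‖ₑ + ‖(δ : ℂ)‖ₑ * ‖dz ρ.toFun a‖ₑ) :=
          lintegral_mono fun a => enorm_sub_le.trans (by rw [enorm_mul])
      _ = 1 + ENNReal.ofReal δ * ∫⁻ a, ‖dz ρ.toFun a‖ₑ := by
          rw [lintegral_add_left ρ.contDiff.continuous.measurable.enorm, ρ.lintegral_enorm,
            lintegral_const_mul' _ _ enorm_ne_top, ← ofReal_norm, Complex.norm_real,
            Real.norm_of_nonneg hδ]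
      _ ≤ 1 + 1 := by
          refine add_le_add le_rfl ?_
          rw [← ENNReal.ofReal_toReal hfin, ← hD, ← ENNReal.ofReal_mul hδ]
          exact ENNReal.ofReal_le_one.2 hδD
      _ = 2 := by norm_num
  calc _ ≤ (2 : ℝ≥0∞) ^ 2 * (C * energy c f) := mul_le_mul_left (pow_le_pow_left' hL1 2) _
    _ = _ := by push_cast; ring

/-- By `mul_reg`, `z` times the regularisation is an average against `∂̄ρ`, which has finite `L¹`
norm. The constant depends on `ρ` but is uniform in `δ`. -/
lemma exists_energy_add_one_reg_le {c : ℝ} (hc : -1 < c) {ε : ℝ} (ρ : Mollifier ε)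
    (hε : ε ≤ 1 / 3) : ∃ C : ℝ≥0, ∀ δ : ℝ, 0 ≤ δ → δ ≤ 1 / 3 → ∀ f : ℂ → ℂ, Differentiable ℂ f →
    energy (c + 1) (reg δ ρ.toFun f) ≤ C * energy c f := by
  obtain ⟨C, hC⟩ := exists_energy_weylAvg_le hc
  have hfin := ρ.lintegral_enorm_ne_top ρ.continuous_dzbar fun a ha => ρ.dzbar_eq_zero ha
  refine ⟨(∫⁻ a, ‖dzbar ρ.toFun a‖ₑ).toNNReal ^ 2 * C, fun δ hδ hδ3 f hf => ?_⟩
  have h := hC δ (dzbar ρ.toFun) hδ (by linarith) ρ.continuous_dzbar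
    (fun a ha => ρ.support_cond hε hδ3 (by
      by_contra hcon
      exact ha (ρ.dzbar_eq_zero hcon))) f hf
  rw [← energy_mul_id]
  calc energy c (fun z => z * reg δ ρ.toFun f z) = energy c (weylAvg δ (dzbar ρ.toFun) f) := by
        unfold energy
        refine lintegral_congr fun z => ?_
        change ‖z * reg δ ρ.toFun f z‖ₑ ^ 2 = _
        rw [mul_reg ρ δ hf z, enorm_neg]
    _ ≤ _ := h
    _ = _ := by
        push_cast
        rw [ENNReal.coe_toNNReal hfin]
        ring

/-- The regularisation with `δ = 1/b` preserves the weighted polynomials. -/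
lemma IsWeightedPoly.reg {n : ℕ} {b : ℝ} (hb : b ≠ 0) {f : ℂ → ℂ} (hf : IsWeightedPoly n b f)
    {ε : ℝ} (ρ : Mollifier ε) : IsWeightedPoly n b (reg b⁻¹ ρ.toFun f) := by
  obtain ⟨p, hpn, hp⟩ := hf
  set σ : ℂ → ℂ := fun a => ρ.toFun a - (b⁻¹ : ℝ) * dz ρ.toFun a with hσ
  have hσ0 : ∀ a ∉ tsupport ρ.toFun, σ a = 0 := fun a ha => by
    simp [hσ, ρ.eq_zero ha, ρ.dz_eq_zero ha]
  set u : ℕ → ℂ → ℂ := fun j a => Complex.exp (-(b * a)) *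
    ((hasseDeriv j p).eval (-a) * (1 - (b⁻¹ : ℝ) * conj a) ^ j) with hu
  have huc : ∀ j, Continuous (u j) := fun j => by
    have h1 : Continuous fun a : ℂ => (hasseDeriv j p).eval (-a) :=
      (hasseDeriv j p).continuous.comp continuous_neg
    have h2 := Complex.continuous_conj
    simp only [hu]
    fun_prop
  refine ⟨∑ j ∈ Finset.range n, C (∫ a, σ a * u j a) * X ^ j, ?_, fun z => ?_⟩
  · refine mem_degreeLT.1 (Submodule.sum_mem _ fun j hj => mem_degreeLT.2 ?_)
    exact (degree_C_mul_X_pow_le _ _).trans_lt (by exact_mod_cast Finset.mem_range.1 hj)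
  · have hweyl : ∀ a, weyl b⁻¹ a f z =
        ∑ j ∈ Finset.range n, u j a * (z ^ j * Complex.exp (b * z)) := by
      intro a
      have hb' : (b : ℂ) ≠ 0 := by exact_mod_cast hb
      have h1 : p.eval ((1 - (b⁻¹ : ℝ) * conj a) * z - a) =
          ∑ j ∈ Finset.range n, (hasseDeriv j p).eval (-a) *
            ((1 - (b⁻¹ : ℝ) * conj a) * z) ^ j := by
        rw [sub_eq_add_neg, ← taylor_eval]
        have hdeg : (taylor (-a) p).degree < n := by rwa [degree_taylor]
        simp_rw [← taylor_coeff]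
        by_cases h0 : taylor (-a) p = 0
        · simp [h0]
        · rw [eval_eq_sum_range' ((natDegree_lt_iff_degree_lt h0).2 hdeg)]
      -- The choice `δ = 1/b` makes `āz` cancel against `-b · b⁻¹ ā z`, so the factor `e^{bz}` is
      -- restored. This is the purpose of the deformation.
      have h2 : Complex.exp (conj a * z) *
          Complex.exp (b * ((1 - (b⁻¹ : ℝ) * conj a) * z - a)) =
          Complex.exp (-(b * a)) * Complex.exp (b * z) := by
        rw [← Complex.exp_add, ← Complex.exp_add]
        congr 1
        push_cast
        field_simp
        ring
      simp only [weyl, hp, h1, hu]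
      rw [mul_left_comm, h2, Finset.sum_mul]
      refine Finset.sum_congr rfl fun j _ => ?_
      rw [mul_pow]
      ring
    unfold EdgeRecursion.reg weylAvg
    simp_rw [hweyl, Finset.mul_sum]
    rw [integral_finsetSum _ fun j _ => ?_]
    · rw [eval_finsetSum, Finset.sum_mul]
      refine Finset.sum_congr rfl fun j _ => ?_
      simp_rw [← mul_assoc]
      rw [integral_mul_const, integral_mul_const]
      simp [hσ]
    · exact ρ.integrable_mul (ρ.continuous_density _) ((huc j).mul continuous_const) hσ0

lemma tendsto_reg {c : ℝ} {A : ℝ≥0∞} (hA : A ≠ ⊤) {f : ℕ → ℂ → ℂ} {g : ℂ → ℂ} {δ : ℕ → ℝ}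
    (hδ : Tendsto δ atTop (𝓝 0)) (hf : ∀ᶠ k in atTop, Differentiable ℂ (f k))
    (hfA : ∀ᶠ k in atTop, energy c (f k) ≤ A)
    (h : ∀ z, Tendsto (fun k => f k z) atTop (𝓝 (g z))) {ε : ℝ} (ρ : Mollifier ε) (z : ℂ) :
    Tendsto (fun k => reg (δ k) ρ.toFun (f k) z) atTop (𝓝 (reg 0 ρ.toFun g z)) := by
  have hloc := tendstoLocallyUniformly_of_energy_le hA hf hfA h
  have hg := differentiable_of_tendsto_of_energy_le hA hf hfA h
  obtain ⟨B, hB0, hB⟩ := exists_norm_le_of_energy_le c ((1 + 3 * |ε|) * ‖z‖ + 3 * |ε|) hA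
  have hδ1 : ∀ᶠ k in atTop, |δ k| ≤ 1 := by
    have := (Metric.tendsto_nhds.1 hδ) 1 one_pos
    filter_upwards [this] with k hk
    simpa [Real.dist_eq] using hk.le
  unfold reg weylAvg
  refine tendsto_integral_filter_of_dominated_convergence
    (fun a => (‖ρ.toFun a‖ + ‖dz ρ.toFun a‖) * (Real.exp (3 * |ε| * ‖z‖) * B)) ?_ ?_ ?_ ?_
  · filter_upwards [hf] with k hk
    exact ((ρ.continuous_density _).mul
      (continuous_weyl_left _ hk.continuous z)).aestronglyMeasurable
  · filter_upwards [hf, hfA, hδ1] with k h1 h2 h3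
    refine Eventually.of_forall fun a => ?_
    by_cases ha : a ∈ tsupport ρ.toFun
    · have hae : ‖a‖ ≤ 3 * |ε| := (ρ.norm_le_of_mem ha).1.trans (by linarith [le_abs_self ε])
      rw [norm_mul]
      refine mul_le_mul ?_ ?_ (norm_nonneg _) (by positivity)
      · refine (norm_sub_le _ _).trans ?_
        rw [norm_mul, Complex.norm_real, Real.norm_eq_abs]
        nlinarith [norm_nonneg (dz ρ.toFun a)]
      · rw [weyl, norm_mul]
        refine mul_le_mul ?_ (hB _ h1 h2 _ ?_) (norm_nonneg _) (by positivity)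
        · rw [Complex.norm_exp]
          refine Real.exp_le_exp.2 ((Complex.re_le_norm _).trans ?_)
          rw [norm_mul, RCLike.norm_conj]
          exact mul_le_mul_of_nonneg_right hae (norm_nonneg z)
        · refine (norm_sub_le _ _).trans (add_le_add ?_ hae)
          rw [norm_mul]
          refine mul_le_mul_of_nonneg_right ((norm_sub_le _ _).trans ?_) (norm_nonneg z)
          rw [norm_one, norm_mul, RCLike.norm_conj, Complex.norm_real, Real.norm_eq_abs]
          nlinarith [norm_nonneg a, abs_nonneg (δ k)]
    · simp only [ρ.eq_zero ha, ρ.dz_eq_zero ha]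
      simp
  · have i1 := (ρ.contDiff.continuous.norm.add ρ.continuous_dz.norm)
    refine Continuous.integrable_of_hasCompactSupport (i1.mul continuous_const) ?_
    exact HasCompactSupport.intro ρ.hasCompactSupport fun a ha => by
      simp [ρ.eq_zero ha, ρ.dz_eq_zero ha]
  · refine Eventually.of_forall fun a => ?_
    have hδc : Tendsto (fun k => (δ k : ℂ)) atTop (𝓝 ((0 : ℝ) : ℂ)) :=
      (Complex.continuous_ofReal.tendsto 0).comp hδ
    have harg : Tendsto (fun k => (1 - (δ k : ℂ) * conj a) * z - a) atTop
        (𝓝 ((1 - ((0 : ℝ) : ℂ) * conj a) * z - a)) :=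
      (((hδc.mul_const _).const_sub 1).mul_const z).sub_const a
    exact ((hδc.mul_const _).const_sub _).mul
      ((hloc.tendsto_comp hg.continuous.continuousAt harg).const_mul _)

/-- For `δ = 0` the translation by `a = 0` is the identity and depends continuously on `a`, so
shrinking the mollifiers gives an approximate identity. -/
lemma tendsto_reg_zero {f : ℂ → ℂ} (hf : Continuous f) {ε : ℕ → ℝ}
    (hε : Tendsto ε atTop (𝓝 0)) (ρ : ∀ k, Mollifier (ε k)) (z : ℂ) :
    Tendsto (fun k => reg 0 (ρ k).toFun f z) atTop (𝓝 (f z)) := by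
  have hG : Continuous fun a => weyl 0 a f z := continuous_weyl_left 0 hf z
  have hG0 : weyl 0 0 f z = f z := by simp [weyl]
  rw [Metric.tendsto_nhds]
  intro η hη
  obtain ⟨r, hr, hr'⟩ := Metric.continuous_iff.1 hG 0 (η / 2) (by positivity)
  have h3 : ∀ᶠ k in atTop, 3 * ε k < r := by
    have : Tendsto (fun k => 3 * ε k) atTop (𝓝 (3 * 0)) := hε.const_mul 3
    rw [mul_zero] at this
    exact this.eventually (gt_mem_nhds hr)
  filter_upwards [h3] with k hk
  set σ := (ρ k).toFun with hσ
  have i1 := (ρ k).integrable_mul (ρ k).contDiff.continuous hG fun a ha => (ρ k).eq_zero ha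
  have i2 := (ρ k).integrable_mul (ρ k).contDiff.continuous (continuous_const (y := f z))
    fun a ha => (ρ k).eq_zero ha
  have e1 : reg 0 σ f z - f z = ∫ a, σ a * (weyl 0 a f z - f z) := by
    have e2 : f z = ∫ a, σ a * f z := by
      rw [integral_mul_const, (ρ k).integral_eq_one, one_mul]
    have e3 : reg 0 σ f z = ∫ a, σ a * weyl 0 a f z := by simp [reg, weylAvg]
    calc reg 0 σ f z - f z = (∫ a, σ a * weyl 0 a f z) - ∫ a, σ a * f z := by rw [e3, ← e2]
      _ = ∫ a, (σ a * weyl 0 a f z - σ a * f z) := (integral_sub i1 i2).symm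
      _ = _ := by simp_rw [mul_sub]
  have hint : Integrable σ := by
    have := (ρ k).integrable_mul (ρ k).contDiff.continuous (continuous_const (y := (1 : ℂ)))
      fun a ha => (ρ k).eq_zero ha
    simpa using this
  have hnorm : ∫ a, ‖σ a‖ = 1 := by
    rw [integral_norm_eq_lintegral_enorm hint.aestronglyMeasurable, (ρ k).lintegral_enorm,
      ENNReal.toReal_one]
  rw [dist_eq_norm, e1]
  calc ‖∫ a, σ a * (weyl 0 a f z - f z)‖ ≤ ∫ a, ‖σ a‖ * (η / 2) := by
        refine norm_integral_le_of_norm_le (hint.norm.mul_const _)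
          (Eventually.of_forall fun a => ?_)
        rw [norm_mul]
        by_cases ha : a ∈ tsupport σ
        · refine mul_le_mul_of_nonneg_left ?_ (norm_nonneg _)
          have := hr' a (by
            rw [dist_zero_right]
            exact ((ρ k).norm_le_of_mem ha).1.trans_lt hk)
          rw [hG0, dist_eq_norm] at this
          exact this.le
        · simp [hσ, (ρ k).eq_zero ha]
    _ = η / 2 := by rw [integral_mul_const, hnorm, one_mul]
    _ < η := by linarith

/-! ### Weighted polynomials and their reproducing kernels. -/

/-- The function `p(z) e^{bz - b²/2}`. -/
def expPoly (b : ℝ) (p : ℂ[X]) (z : ℂ) : ℂ := p.eval z * Complex.exp (b * z - b ^ 2 / 2)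

lemma isWeightedPoly_expPoly {n : ℕ} (b : ℝ) {p : ℂ[X]} (hp : p.degree < n) :
    IsWeightedPoly n b (expPoly b p) := by
  refine ⟨C (Complex.exp (-(b ^ 2 / 2))) * p, ?_, fun z => ?_⟩
  · rwa [degree_C_mul (Complex.exp_ne_zero _)]
  · rw [expPoly, eval_mul, eval_C, sub_eq_add_neg, Complex.exp_add]; ring

lemma IsWeightedPoly.exists_expPoly {n : ℕ} {b : ℝ} {f : ℂ → ℂ} (hf : IsWeightedPoly n b f) :
    ∃ p : ℂ[X], p.degree < n ∧ f = expPoly b p := by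
  obtain ⟨p, hp, hfp⟩ := hf
  refine ⟨C (Complex.exp (b ^ 2 / 2)) * p, ?_, funext fun z => ?_⟩
  · rwa [degree_C_mul (Complex.exp_ne_zero _)]
  · have h : Complex.exp (b * z) = Complex.exp (b ^ 2 / 2) * Complex.exp (b * z - b ^ 2 / 2) := by
      rw [← Complex.exp_add]; congr 1; ring
    rw [expPoly, eval_mul, eval_C, hfp, h]; ring

lemma expPoly_add (b : ℝ) (p q : ℂ[X]) : expPoly b (p + q) = expPoly b p + expPoly b q := by
  funext z; simp [expPoly, add_mul]

lemma expPoly_smul (b : ℝ) (r : ℂ) (p : ℂ[X]) : expPoly b (r • p) = r • expPoly b p := by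
  funext z; simp [expPoly, mul_assoc]

lemma differentiable_expPoly (b : ℝ) (p : ℂ[X]) : Differentiable ℂ (expPoly b p) :=
  p.differentiable.mul (by fun_prop)

lemma exists_norm_expPoly_le (b : ℝ) (p : ℂ[X]) : ∃ K : ℝ, 0 ≤ K ∧
    ∀ z, ‖expPoly b p z‖ ≤ K * Real.exp ((1 + |b|) * ‖z‖) := by
  induction p using Polynomial.induction_on' with
  | add p q hp hq =>
    obtain ⟨K₁, h₁, hK₁⟩ := hp
    obtain ⟨K₂, h₂, hK₂⟩ := hq
    refine ⟨K₁ + K₂, by positivity, fun z => ?_⟩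
    rw [expPoly_add, add_mul]
    exact (norm_add_le _ _).trans (add_le_add (hK₁ z) (hK₂ z))
  | monomial n a =>
    refine ⟨‖a‖ * n.factorial, by positivity, fun z => ?_⟩
    rw [expPoly, eval_monomial, norm_mul, norm_mul, norm_pow, Complex.norm_exp, mul_assoc,
      mul_assoc]
    refine mul_le_mul_of_nonneg_left ?_ (norm_nonneg _)
    have h1 : ‖z‖ ^ n ≤ n.factorial * Real.exp ‖z‖ := by
      have := Real.pow_div_factorial_le_exp ‖z‖ (norm_nonneg z) n
      rw [div_le_iff₀ (by positivity)] at this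
      linarith
    have h2 : (b * z - b ^ 2 / 2 : ℂ).re ≤ |b| * ‖z‖ := by
      have e : (b * z - b ^ 2 / 2 : ℂ).re = b * z.re - b ^ 2 / 2 := by
        have : (b : ℂ) ^ 2 / 2 = ((b ^ 2 / 2 : ℝ) : ℂ) := by push_cast; ring
        rw [this, Complex.sub_re, Complex.re_ofReal_mul, Complex.ofReal_re]
      rw [e]
      have h3 : b * z.re ≤ |b| * ‖z‖ := by
        calc b * z.re ≤ |b * z.re| := le_abs_self _
          _ = |b| * |z.re| := abs_mul _ _
          _ ≤ |b| * ‖z‖ := mul_le_mul_of_nonneg_left (Complex.abs_re_le_norm z) (abs_nonneg _)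
      nlinarith [sq_nonneg b]
    calc ‖z‖ ^ n * Real.exp (b * z - b ^ 2 / 2 : ℂ).re
        ≤ (n.factorial * Real.exp ‖z‖) * Real.exp (|b| * ‖z‖) :=
          mul_le_mul h1 (Real.exp_le_exp.2 h2) (Real.exp_pos _).le (by positivity)
      _ = n.factorial * Real.exp ((1 + |b|) * ‖z‖) := by
          rw [mul_assoc, ← Real.exp_add]; ring_nf

lemma energy_expPoly_ne_top {c : ℝ} (hc : -1 < c) (b : ℝ) (p : ℂ[X]) :
    energy c (expPoly b p) ≠ ⊤ := by
  obtain ⟨K, hK0, hK⟩ := exists_norm_expPoly_le b p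
  set t := 1 + |b|
  have hle : energy c (expPoly b p) ≤ ENNReal.ofReal Real.pi⁻¹ *
      (ENNReal.ofReal (K ^ 2 * Real.exp (2 * t ^ 2)) *
        ∫⁻ z : ℂ, ENNReal.ofReal (‖z‖ ^ (2 * c) * Real.exp (-(1 / 2) * ‖z‖ ^ 2))) := by
    unfold energy
    rw [lintegral_fockMeasure, lintegral_areaMeasure]
    refine mul_le_mul_right ?_ _
    rw [← lintegral_const_mul' _ _ ENNReal.ofReal_ne_top]
    refine lintegral_mono fun z => ?_
    rw [← ofReal_norm, ← ENNReal.ofReal_pow (norm_nonneg _), ← ENNReal.ofReal_mul (wt_nonneg _ _),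
      ← ENNReal.ofReal_mul (by positivity)]
    refine ENNReal.ofReal_le_ofReal ?_
    have h1 : ‖expPoly b p z‖ ^ 2 ≤ K ^ 2 * Real.exp (2 * (t * ‖z‖)) := by
      have := pow_le_pow_left₀ (norm_nonneg _) (hK z) 2
      rwa [mul_pow, ← Real.exp_nat_mul, Nat.cast_ofNat] at this
    have h2 : Real.exp (-‖z‖ ^ 2) * Real.exp (2 * (t * ‖z‖)) ≤
        Real.exp (2 * t ^ 2) * Real.exp (-(1 / 2) * ‖z‖ ^ 2) := by
      rw [← Real.exp_add, ← Real.exp_add]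
      refine Real.exp_le_exp.2 ?_
      nlinarith [sq_nonneg (‖z‖ - 2 * t)]
    calc wt c z * ‖expPoly b p z‖ ^ 2
        ≤ wt c z * (K ^ 2 * Real.exp (2 * (t * ‖z‖))) :=
          mul_le_mul_of_nonneg_left h1 (wt_nonneg _ _)
      _ = K ^ 2 * ‖z‖ ^ (2 * c) * (Real.exp (-‖z‖ ^ 2) * Real.exp (2 * (t * ‖z‖))) := by
          unfold wt; ring
      _ ≤ K ^ 2 * ‖z‖ ^ (2 * c) * (Real.exp (2 * t ^ 2) * Real.exp (-(1 / 2) * ‖z‖ ^ 2)) :=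
          mul_le_mul_of_nonneg_left h2 (by positivity)
      _ = _ := by ring
  refine ne_top_of_le_ne_top ?_ hle
  exact (ENNReal.mul_lt_top ENNReal.ofReal_lt_top (ENNReal.mul_lt_top ENNReal.ofReal_lt_top
    (lintegral_wt_lt_top hc (by norm_num)))).ne

lemma IsWeightedPoly.energy_ne_top {c : ℝ} (hc : -1 < c) {n : ℕ} {b : ℝ} {f : ℂ → ℂ}
    (hf : IsWeightedPoly n b f) : energy c f ≠ ⊤ := by
  obtain ⟨p, -, rfl⟩ := hf.exists_expPoly
  exact energy_expPoly_ne_top hc b p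

lemma integral_mul_conj_self (c : ℝ) {f : ℂ → ℂ} (hf : Continuous f) :
    ∫ z, f z * conj (f z) ∂fockMeasure c = ((energy c f).toReal : ℂ) := by
  have h : ∀ z, f z * conj (f z) = ((‖f z‖ ^ 2 : ℝ) : ℂ) := fun z => by
    rw [Complex.mul_conj']; push_cast; rfl
  simp_rw [h]
  rw [integral_complex_ofReal, integral_eq_lintegral_of_nonneg_ae
    (Eventually.of_forall fun z => by positivity) (by fun_prop)]
  congr 2
  unfold energy
  refine lintegral_congr fun z => ?_
  rw [ENNReal.ofReal_pow (norm_nonneg _), ofReal_norm]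

/-- `L` is the reproducing kernel of the weighted polynomials in `L²(fockMeasure c)`. -/
structure IsReproducing (c : ℝ) (n : ℕ) (b : ℝ) (L : ℂ → ℂ → ℂ) : Prop where
  mem : ∀ w, IsWeightedPoly n b fun z => L z w
  eval : ∀ f, IsWeightedPoly n b f → ∀ w, ∫ z, f z * conj (L z w) ∂fockMeasure c = f w

namespace IsReproducing

variable {c : ℝ} {n : ℕ} {b : ℝ} {L : ℂ → ℂ → ℂ}

lemma conj_symm (hL : IsReproducing c n b L) (z w : ℂ) : conj (L w z) = L z w := by
  rw [← hL.eval _ (hL.mem w) z, ← hL.eval _ (hL.mem z) w, ← integral_conj]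
  refine integral_congr_ae (Eventually.of_forall fun ζ => ?_)
  simp [mul_comm]

lemma self_eq (hL : IsReproducing c n b L) (w : ℂ) :
    L w w = ((energy c fun z => L z w).toReal : ℂ) := by
  rw [← integral_mul_conj_self c (hL.mem w).differentiable.continuous]
  exact (hL.eval _ (hL.mem w) w).symm

lemma energy_eq (hc : -1 < c) (hL : IsReproducing c n b L) (w : ℂ) :
    energy c (fun z => L z w) = ‖L w w‖ₑ := by
  rw [hL.self_eq w, ← ofReal_norm, Complex.norm_real, Real.norm_of_nonneg ENNReal.toReal_nonneg,
    ENNReal.ofReal_toReal ((hL.mem w).energy_ne_top hc)]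

lemma enorm_sq_le (hc : -1 < c) (hL : IsReproducing c n b L) {f : ℂ → ℂ}
    (hf : IsWeightedPoly n b f) (w : ℂ) : ‖f w‖ₑ ^ 2 ≤ energy c f * ‖L w w‖ₑ := by
  have := sq_enorm_integral_mul_conj_le (fockMeasure c) hf.differentiable.continuous.aemeasurable
    (hL.mem w).differentiable.continuous.aemeasurable
  rw [hL.eval f hf w] at this
  rwa [← hL.energy_eq hc w]

end IsReproducing

/-- The energy of `L(·,w)` is `L(w,w)`, so the bound on point evaluations reads `L(w,w)² ≤ C
L(w,w)`. The result is uniform in `n`, `b` and `L`. -/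
lemma exists_energy_kernel_le {c : ℝ} (hc : -1 < c) (M : ℝ) : ∃ A : ℝ≥0∞, A ≠ ⊤ ∧
    ∀ n b L, IsReproducing c n b L → ∀ w, ‖w‖ ≤ M → energy c (fun z => L z w) ≤ A := by
  obtain ⟨C, hC⟩ := exists_enorm_sq_le_energy c M
  refine ⟨C, ENNReal.coe_ne_top, fun n b L hL w hw => ?_⟩
  have h := hC _ (hL.mem w).differentiable w hw
  rw [hL.energy_eq hc w] at h ⊢
  by_cases h0 : ‖L w w‖ₑ = 0
  · rw [h0]; exact zero_le
  · rw [sq] at h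
    exact (ENNReal.mul_le_mul_iff_left h0 enorm_ne_top).1 h

/-- The kernel `∑_{j<n} ψ_j(z) conj ψ_j(w)` of the functions `ψ_j = p_j e^{bz - b²/2}`. -/
def sumKernel (b : ℝ) (n : ℕ) (p : ℕ → ℂ[X]) (z w : ℂ) : ℂ :=
  ∑ j ∈ Finset.range n, expPoly b (p j) z * conj (expPoly b (p j) w)

/-- `|e^{bz-b²/2}|² e^{-|z|²} = e^{-|z-b|²}`: the shift `b` moves from the measure into the
functions, so all the kernels live in one space. -/
lemma expPoly_mul_conj_mul_wt (c b : ℝ) (p q : ℂ[X]) (z : ℂ) :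
    expPoly b p z * conj (expPoly b q z) * (wt c z : ℂ) =
      p.eval z * conj (q.eval z) *
        ((‖z‖ ^ (2 * c) * Real.exp (-((1 : ℕ) : ℝ) * Q b z) : ℝ) : ℂ) := by
  have h1 : Complex.exp (b * z - b ^ 2 / 2) * conj (Complex.exp (b * z - b ^ 2 / 2)) =
      ((Real.exp (2 * (b * z.re) - b ^ 2) : ℝ) : ℂ) := by
    rw [Complex.mul_conj', Complex.norm_exp]
    have e : (b * z - b ^ 2 / 2 : ℂ).re = b * z.re - b ^ 2 / 2 := by
      have : (b : ℂ) ^ 2 / 2 = ((b ^ 2 / 2 : ℝ) : ℂ) := by push_cast; ring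
      rw [this, Complex.sub_re, Complex.re_ofReal_mul, Complex.ofReal_re]
    rw [e, ← Complex.ofReal_pow, ← Real.exp_nat_mul]
    push_cast; ring_nf
  have h2 : Real.exp (2 * (b * z.re) - b ^ 2) * Real.exp (-‖z‖ ^ 2) =
      Real.exp (-((1 : ℕ) : ℝ) * Q b z) := by
    rw [← Real.exp_add, Q]
    congr 1
    rw [Complex.sq_norm, Complex.sq_norm, Complex.normSq_apply, Complex.normSq_apply]
    simp
    ring
  rw [← h2]
  simp only [expPoly, map_mul, wt]
  push_cast
  push_cast at h1
  linear_combination (p.eval z * conj (q.eval z) * ((‖z‖ ^ (2 * c) : ℝ) : ℂ) *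
    Complex.exp (-(‖z‖ : ℂ) ^ 2)) * h1

lemma integral_expPoly_mul_conj (c b : ℝ) (p q : ℂ[X]) :
    ∫ z, expPoly b p z * conj (expPoly b q z) ∂fockMeasure c =
      ∫ z, p.eval z * conj (q.eval z) *
        ((‖z‖ ^ (2 * c) * Real.exp (-((1 : ℕ) : ℝ) * Q b z) : ℝ) : ℂ) ∂areaMeasure := by
  rw [integral_fockMeasure]
  simp_rw [expPoly_mul_conj_mul_wt]

lemma integrable_expPoly_mul_conj {c : ℝ} (hc : -1 < c) (b : ℝ) (p q : ℂ[X]) :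
    Integrable (fun z => expPoly b p z * conj (expPoly b q z)) (fockMeasure c) :=
  integrable_mul_conj (differentiable_expPoly b p).continuous.aemeasurable
    (differentiable_expPoly b q).continuous.aemeasurable (energy_expPoly_ne_top hc b p)
    (energy_expPoly_ne_top hc b q)

lemma IsOrthonormalPolys.integral_eq {c b : ℝ} {p : ℕ → ℂ[X]} (hp : IsOrthonormalPolys c b 1 p)
    (j k : ℕ) : ∫ z, expPoly b (p j) z * conj (expPoly b (p k) z) ∂fockMeasure c =
      if j = k then 1 else 0 := by
  rw [integral_expPoly_mul_conj, hp.2 j k]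

lemma isWeightedPoly_sum_expPoly {c b : ℝ} {p : ℕ → ℂ[X]} (hp : IsOrthonormalPolys c b 1 p)
    (n : ℕ) (u : ℕ → ℂ) :
    IsWeightedPoly n b fun z => ∑ j ∈ Finset.range n, u j * expPoly b (p j) z := by
  have h := isWeightedPoly_expPoly (n := n) b (p := ∑ j ∈ Finset.range n, C (u j) * p j)
    (mem_degreeLT.1 (Submodule.sum_mem _ fun j hj => ?_))
  · convert h using 1
    funext z
    simp only [expPoly, eval_finsetSum, eval_mul, eval_C, Finset.sum_mul, mul_assoc]
  · rw [← smul_eq_C_mul]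
    refine Submodule.smul_mem _ _ (mem_degreeLT.2 ?_)
    rw [hp.1 j]
    exact_mod_cast Finset.mem_range.1 hj

lemma IsOrthonormalPolys.isReproducing {c : ℝ} (hc : -1 < c) {b : ℝ} {p : ℕ → ℂ[X]}
    (hp : IsOrthonormalPolys c b 1 p) (n : ℕ) : IsReproducing c n b (sumKernel b n p) := by
  refine ⟨fun w => ?_, fun f hf w => ?_⟩
  · have := isWeightedPoly_sum_expPoly hp n fun j => conj (expPoly b (p j) w)
    convert this using 2
    simp only [sumKernel, mul_comm]
  · obtain ⟨q, hq, rfl⟩ := hf.exists_expPoly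
    let s : Polynomial.Sequence ℂ := ⟨p, hp.1⟩
    have hspan := s.span_degreeLT (m := n)
      fun i _ => (leadingCoeff_ne_zero.2 (s.ne_zero i)).isUnit
    have hmem : q ∈ Submodule.span ℂ (s '' Set.Iio n) := by
      rw [hspan]; exact mem_degreeLT.2 hq
    have hint : ∀ q : ℂ[X], ∀ j, Integrable (fun z => expPoly b q z *
        conj (expPoly b (p j) z)) (fockMeasure c) :=
      fun q j => integrable_expPoly_mul_conj hc b q (p j)
    have hexp : ∀ q : ℂ[X], ∫ z, expPoly b q z * conj (sumKernel b n p z w) ∂fockMeasure c =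
        ∑ j ∈ Finset.range n, expPoly b (p j) w *
          ∫ z, expPoly b q z * conj (expPoly b (p j) z) ∂fockMeasure c := by
      intro q
      have h : ∀ z, expPoly b q z * conj (sumKernel b n p z w) = ∑ j ∈ Finset.range n,
          expPoly b (p j) w * (expPoly b q z * conj (expPoly b (p j) z)) := fun z => by
        simp only [sumKernel, map_sum, map_mul, Complex.conj_conj, Finset.mul_sum]
        exact Finset.sum_congr rfl fun j _ => by ring
      simp_rw [h]
      rw [integral_finsetSum _ fun j _ => (hint q j).const_mul _]
      simp_rw [integral_const_mul]
    rw [hexp]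
    clear hf hq
    induction hmem using Submodule.span_induction with
    | mem x hx =>
      obtain ⟨i, hi, rfl⟩ := hx
      change ∑ j ∈ Finset.range n, expPoly b (p j) w *
        ∫ z, expPoly b (p i) z * conj (expPoly b (p j) z) ∂fockMeasure c = expPoly b (p i) w
      simp_rw [hp.integral_eq]
      rw [Finset.sum_eq_single_of_mem i (Finset.mem_range.2 hi)]
      · simp
      · intro j _ hj
        simp [Ne.symm hj]
    | zero => simp [expPoly]
    | add x y _ _ hx hy =>
      rw [expPoly_add, Pi.add_apply, ← hx, ← hy, ← Finset.sum_add_distrib]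
      refine Finset.sum_congr rfl fun j _ => ?_
      rw [← mul_add, ← integral_add (hint x j) (hint y j)]
      simp [add_mul]
    | smul r x _ hx =>
      rw [expPoly_smul, Pi.smul_apply, ← hx, smul_eq_mul, Finset.mul_sum]
      refine Finset.sum_congr rfl fun j _ => ?_
      simp only [Pi.smul_apply, smul_eq_mul, mul_assoc, integral_const_mul]
      ring

/-- Orthogonal projection onto the weighted polynomials does not increase the energy. -/
lemma IsOrthonormalPolys.projection {c : ℝ} (hc : -1 < c) {b : ℝ} {p : ℕ → ℂ[X]}
    (hp : IsOrthonormalPolys c b 1 p) (n : ℕ) {h : ℂ → ℂ} (hh : Continuous h)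
    (hhE : energy c h ≠ ⊤) :
    IsWeightedPoly n b (fun w => ∫ z, h z * conj (sumKernel b n p z w) ∂fockMeasure c) ∧
      energy c (fun w => ∫ z, h z * conj (sumKernel b n p z w) ∂fockMeasure c) ≤ energy c h := by
  set u : ℕ → ℂ := fun j => ∫ z, h z * conj (expPoly b (p j) z) ∂fockMeasure c with hu
  have hint : ∀ j, Integrable (fun z => h z * conj (expPoly b (p j) z)) (fockMeasure c) :=
    fun j => integrable_mul_conj hh.aemeasurable
      (differentiable_expPoly b (p j)).continuous.aemeasurable hhE (energy_expPoly_ne_top hc b _)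
  have hg : (fun w => ∫ z, h z * conj (sumKernel b n p z w) ∂fockMeasure c) =
      fun w => ∑ j ∈ Finset.range n, u j * expPoly b (p j) w := by
    funext w
    have e : ∀ z, h z * conj (sumKernel b n p z w) = ∑ j ∈ Finset.range n,
        expPoly b (p j) w * (h z * conj (expPoly b (p j) z)) := fun z => by
      simp only [sumKernel, map_sum, map_mul, Complex.conj_conj, Finset.mul_sum]
      exact Finset.sum_congr rfl fun j _ => by ring
    simp_rw [e]
    rw [integral_finsetSum _ fun j _ => (hint j).const_mul _]
    simp_rw [integral_const_mul]
    exact Finset.sum_congr rfl fun j _ => mul_comm _ _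
  have hmem : IsWeightedPoly n b (fun w => ∑ j ∈ Finset.range n, u j * expPoly b (p j) w) :=
    isWeightedPoly_sum_expPoly hp n u
  rw [hg]
  refine ⟨hmem, ?_⟩
  set g : ℂ → ℂ := fun w => ∑ j ∈ Finset.range n, u j * expPoly b (p j) w with hgdef
  have hgE := hmem.energy_ne_top hc
  have hpair : ∀ v : ℂ → ℂ, Continuous v → energy c v ≠ ⊤ →
      ∫ z, v z * conj (g z) ∂fockMeasure c = ∑ j ∈ Finset.range n, conj (u j) *
        ∫ z, v z * conj (expPoly b (p j) z) ∂fockMeasure c := by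
    intro v hv hvE
    have e : ∀ z, v z * conj (g z) = ∑ j ∈ Finset.range n,
        conj (u j) * (v z * conj (expPoly b (p j) z)) := fun z => by
      simp only [hgdef, map_sum, map_mul, Finset.mul_sum]
      exact Finset.sum_congr rfl fun j _ => by ring
    simp_rw [e]
    rw [integral_finsetSum _ fun j _ => (integrable_mul_conj hv.aemeasurable
      (differentiable_expPoly b (p j)).continuous.aemeasurable hvE
      (energy_expPoly_ne_top hc b _)).const_mul _]
    simp_rw [integral_const_mul]
  have hgg : ∫ z, g z * conj (g z) ∂fockMeasure c = ∫ z, h z * conj (g z) ∂fockMeasure c := by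
    rw [hpair g hmem.differentiable.continuous hgE, hpair h hh hhE]
    refine Finset.sum_congr rfl fun j hj => ?_
    congr 1
    have e : ∀ z, g z * conj (expPoly b (p j) z) = ∑ i ∈ Finset.range n,
        u i * (expPoly b (p i) z * conj (expPoly b (p j) z)) := fun z => by
      simp only [hgdef, Finset.sum_mul, mul_assoc]
    simp_rw [e]
    rw [integral_finsetSum _ fun i _ => (integrable_expPoly_mul_conj hc b _ _).const_mul _]
    simp_rw [integral_const_mul, hp.integral_eq]
    rw [Finset.sum_eq_single_of_mem j hj]
    · simp [hu]
    · intro i _ hi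
      simp [hi]
  have hcs := sq_enorm_integral_mul_conj_le (fockMeasure c) hh.aemeasurable
    hmem.differentiable.continuous.aemeasurable (f := h) (g := g)
  rw [← hgg, integral_mul_conj_self c hmem.differentiable.continuous, ← ofReal_norm,
    Complex.norm_real, Real.norm_of_nonneg ENNReal.toReal_nonneg, ENNReal.ofReal_toReal hgE] at hcs
  change energy c g ^ 2 ≤ energy c h * energy c g at hcs
  by_cases h0 : energy c g = 0
  · rw [h0]; exact zero_le
  · rw [sq] at hcs
    exact (ENNReal.mul_le_mul_iff_left h0 hgE).1 hcs

/-! ### Limits of weighted polynomials and uniqueness of limit kernels. -/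

/-- `h` is a limit of weighted polynomials along the sequence `(n k, b k)`, with energies of charge
`s` bounded. -/
def Approx (n : ℕ → ℕ) (b : ℕ → ℝ) (s : ℝ) (h : ℂ → ℂ) : Prop :=
  ∃ (u : ℕ → ℂ → ℂ) (A : ℝ≥0∞), A ≠ ⊤ ∧ (∀ᶠ k in atTop, IsWeightedPoly (n k) (b k) (u k)) ∧
    (∀ᶠ k in atTop, energy s (u k) ≤ A) ∧ ∀ z, Tendsto (fun k => u k z) atTop (𝓝 (h z))

namespace Approx

variable {n : ℕ → ℕ} {b : ℕ → ℝ} {s : ℝ} {h : ℂ → ℂ}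

lemma differentiable (hh : Approx n b s h) : Differentiable ℂ h := by
  obtain ⟨u, A, hA, h1, h2, h3⟩ := hh
  exact differentiable_of_tendsto_of_energy_le hA (h1.mono fun k hk => hk.differentiable) h2 h3

lemma energy_ne_top (hh : Approx n b s h) : energy s h ≠ ⊤ := by
  obtain ⟨u, A, hA, h1, h2, h3⟩ := hh
  exact ne_top_of_le_ne_top hA
    (energy_le_of_tendsto (h1.mono fun k hk => hk.differentiable) h2 h3)

lemma mono {s' : ℝ} (hs' : -1 < s') (hss : s' ≤ s) (hh : Approx n b s h) : Approx n b s' h := by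
  obtain ⟨u, A, hA, h1, h2, h3⟩ := hh
  obtain ⟨C, hC⟩ := exists_energy_le_energy hs' hss
  refine ⟨u, C * A, ENNReal.mul_ne_top ENNReal.coe_ne_top hA, h1, ?_, h3⟩
  filter_upwards [h1, h2] with k hk1 hk2
  exact (hC _ hk1.differentiable).trans (mul_le_mul_right hk2 _)

lemma reg (hs : -1 < s) (hb : Tendsto b atTop atTop) (hh : Approx n b s h) {ε : ℝ}
    (hε : ε ≤ 1 / 3) (ρ : Mollifier ε) : Approx n b (s + 1) (reg 0 ρ.toFun h) := by
  obtain ⟨u, A, hA, h1, h2, h3⟩ := hh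
  obtain ⟨C, hC⟩ := exists_energy_add_one_reg_le hs ρ hε
  have hδ : Tendsto (fun k => (b k)⁻¹) atTop (𝓝 0) := tendsto_inv_atTop_zero.comp hb
  refine ⟨fun k => EdgeRecursion.reg (b k)⁻¹ ρ.toFun (u k), C * A,
    ENNReal.mul_ne_top ENNReal.coe_ne_top hA, ?_, ?_, fun z =>
      tendsto_reg hA hδ (h1.mono fun k hk => hk.differentiable) h2 h3 ρ z⟩
  · filter_upwards [h1, hb.eventually_gt_atTop 0] with k hk1 hk2
    exact hk1.reg hk2.ne' ρ
  · filter_upwards [h1, h2, hb.eventually_ge_atTop 3] with k hk1 hk2 hk3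
    refine (hC _ (by positivity) ?_ _ hk1.differentiable).trans (mul_le_mul_right hk2 _)
    rw [inv_le_comm₀ (by linarith) (by norm_num)]
    linarith

/-- With the kernels of charge `0` converging, a limit along a subsequence is a limit along the
whole sequence. -/
lemma of_subseq {p : ℕ → ℕ → ℂ[X]} (hp : ∀ k, IsOrthonormalPolys 0 (b k) 1 (p k))
    {L₀ : ℂ → ℂ → ℂ}
    (hL₀ : ∀ z w, Tendsto (fun k => sumKernel (b k) (n k) (p k) z w) atTop (𝓝 (L₀ z w)))
    {φ : ℕ → ℕ} (hφ : Tendsto φ atTop atTop)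
    (hh : Approx (fun k => n (φ k)) (fun k => b (φ k)) 1 h) : Approx n b 0 h := by
  have hc : (-1 : ℝ) < 0 := by norm_num
  have hh0 := hh.mono hc zero_le_one
  have hd := hh.differentiable
  have hE := hh0.energy_ne_top
  have hRK := fun k => (hp k).isReproducing hc (n k)
  have hproj := fun k => (hp k).projection hc (n k) hd.continuous hE
  -- The approximants along the whole sequence are the orthogonal projections of `h` at charge `0`.
  -- They converge because the kernels do; the limit is identified with `h` through the subsequence,
  -- where tightness comes from the bound at charge `1`.
  refine ⟨fun k w => ∫ z, h z * conj (sumKernel (b k) (n k) (p k) z w) ∂fockMeasure 0, energy 0 h,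
    hE, Eventually.of_forall fun k => (hproj k).1, Eventually.of_forall fun k => (hproj k).2,
    fun w => ?_⟩
  obtain ⟨A, hA, hAle⟩ := exists_energy_kernel_le hc ‖w‖
  have hker : ∀ k, energy 0 (fun z => sumKernel (b k) (n k) (p k) z w) ≤ A :=
    fun k => hAle _ _ _ (hRK k) w le_rfl
  have hkd : ∀ k, Differentiable ℂ fun z => sumKernel (b k) (n k) (p k) z w :=
    fun k => ((hRK k).mem w).differentiable
  have hlim := tendsto_integral_mul_conj hc (A := A + energy 0 h) (ENNReal.add_ne_top.2 ⟨hA, hE⟩)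
    (f := fun _ => h) (g := fun k z => sumKernel (b k) (n k) (p k) z w)
    (Eventually.of_forall fun _ => hd) (Eventually.of_forall hkd)
    (Eventually.of_forall fun _ => le_add_self)
    (Eventually.of_forall fun k => (hker k).trans le_self_add)
    (fun z => tendsto_const_nhds) (fun z => hL₀ z w) (tight_const hE)
  obtain ⟨u, B, hB, h1, h2, h3⟩ := hh
  obtain ⟨C, hC⟩ := exists_energy_le_energy hc zero_le_one
  have h2' : ∀ᶠ k in atTop, energy 0 (u k) ≤ C * B := by
    filter_upwards [h1, h2] with k hk1 hk2
    exact (hC _ hk1.differentiable).trans (mul_le_mul_right hk2 _)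
  have hCB : (C : ℝ≥0∞) * B ≠ ⊤ := ENNReal.mul_ne_top ENNReal.coe_ne_top hB
  have hlim2 := tendsto_integral_mul_conj hc (A := A + C * B) (ENNReal.add_ne_top.2 ⟨hA, hCB⟩)
    (f := u) (g := fun k z => sumKernel (b (φ k)) (n (φ k)) (p (φ k)) z w)
    (h1.mono fun k hk => hk.differentiable) (Eventually.of_forall fun k => hkd _)
    (h2'.mono fun k hk => hk.trans le_add_self)
    (Eventually.of_forall fun k => (hker _).trans le_self_add)
    h3 (fun z => (hL₀ z w).comp hφ) (tight_of_energy_add_one_le hB (by simpa using h2))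
  have hlim3 : Tendsto (fun k => u k w) atTop
      (𝓝 (∫ z, h z * conj (L₀ z w) ∂fockMeasure 0)) :=
    hlim2.congr' (h1.mono fun k hk => (hRK (φ k)).eval _ hk w)
  rw [tendsto_nhds_unique (h3 w) hlim3]
  exact hlim

end Approx

lemma exists_mollifier_seq : ∃ (ε : ℕ → ℝ) (_ : ∀ k, Mollifier (ε k)),
    (∀ k, 0 < ε k) ∧ (∀ k, ε k ≤ 1 / 3) ∧ Tendsto ε atTop (𝓝 0) := by
  have hε0 : ∀ k : ℕ, 0 < 1 / ((k : ℝ) + 3) := fun k => by positivity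
  refine ⟨fun k => 1 / ((k : ℝ) + 3), fun k => (nonempty_mollifier (hε0 k)).some, hε0,
    fun k => ?_, ?_⟩
  · exact one_div_le_one_div_of_le (by norm_num) (by linarith [Nat.cast_nonneg (α := ℝ) k])
  · have : Tendsto (fun k : ℕ => (k : ℝ) + 3) atTop atTop :=
      tendsto_atTop_add_const_right _ _ tendsto_natCast_atTop_atTop
    simpa [Function.comp_def] using tendsto_inv_atTop_zero.comp this

/-- Orthogonality survives undoing the regularisation: `reg 0 ρ h → h` pointwise with bounded
energy, and the fixed factor `d` provides the tightness. -/
lemma integral_mul_conj_eq_zero_of_reg {c : ℝ} (hc : -1 < c) {h d : ℂ → ℂ}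
    (hh : Differentiable ℂ h) (hhE : energy c h ≠ ⊤) (hd : Differentiable ℂ d)
    (hdE : energy c d ≠ ⊤)
    (H : ∀ ε : ℝ, 0 < ε → ε ≤ 1 / 3 → ∀ ρ : Mollifier ε, Differentiable ℂ (reg 0 ρ.toFun h) ∧
      ∫ z, reg 0 ρ.toFun h z * conj (d z) ∂fockMeasure c = 0) :
    ∫ z, h z * conj (d z) ∂fockMeasure c = 0 := by
  obtain ⟨C, hC⟩ := exists_energy_reg_le hc
  obtain ⟨ε, ρ, hε0, hε1, hεlim⟩ := exists_mollifier_seq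
  have hA : (C : ℝ≥0∞) * energy c h + energy c d ≠ ⊤ :=
    ENNReal.add_ne_top.2 ⟨ENNReal.mul_ne_top ENNReal.coe_ne_top hhE, hdE⟩
  have hlim := tendsto_integral_mul_conj hc hA (f := fun _ => d)
    (g := fun k => reg 0 (ρ k).toFun h) (Eventually.of_forall fun _ => hd)
    (Eventually.of_forall fun k => (H _ (hε0 k) (hε1 k) (ρ k)).1)
    (Eventually.of_forall fun _ => le_add_self)
    (Eventually.of_forall fun k => by
      obtain ⟨δ₀, hδ₀, hle⟩ := hC _ (ρ k) (hε1 k)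
      exact (hle 0 le_rfl hδ₀.le h hh).trans le_self_add)
    (fun z => tendsto_const_nhds) (fun z => tendsto_reg_zero hh.continuous hεlim ρ z)
    (tight_const hdE)
  have hswap : ∀ v : ℂ → ℂ, ∫ z, v z * conj (d z) ∂fockMeasure c =
      conj (∫ z, d z * conj (v z) ∂fockMeasure c) := fun v => by
    rw [← integral_conj]
    exact integral_congr_ae (Eventually.of_forall fun z => by simp [mul_comm])
  have hzero : ∀ k, ∫ z, d z * conj (reg 0 (ρ k).toFun h z) ∂fockMeasure c = 0 := fun k => by
    have := (H _ (hε0 k) (hε1 k) (ρ k)).2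
    rwa [hswap, map_eq_zero] at this
  simp_rw [hzero] at hlim
  have h0 := tendsto_nhds_unique hlim tendsto_const_nhds
  rw [hswap, h0, map_zero]

lemma energy_reg_zero_ne_top {c : ℝ} (hc : -1 < c) {h : ℂ → ℂ} (hh : Differentiable ℂ h)
    (hhE : energy c h ≠ ⊤) {ε : ℝ} (hε : ε ≤ 1 / 3) (ρ : Mollifier ε) :
    energy c (reg 0 ρ.toFun h) ≠ ⊤ := by
  obtain ⟨C, hC⟩ := exists_energy_reg_le hc
  obtain ⟨δ₀, hδ₀, hle⟩ := hC _ ρ hε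
  exact ne_top_of_le_ne_top (ENNReal.mul_ne_top ENNReal.coe_ne_top hhE) (hle 0 le_rfl hδ₀.le h hh)

section Limit

variable {c : ℝ} {n : ℕ → ℕ} {b : ℕ → ℝ} {p : ℕ → ℕ → ℂ[X]} {L₀ : ℂ → ℂ → ℂ}
  {L : ℕ → ℂ → ℂ → ℂ}

lemma approx_kernel_subseq (hc : -1 < c) (hL : ∀ k, IsReproducing c (n k) (b k) (L k)) {w : ℂ}
    {φ : ℕ → ℕ} {f : ℂ → ℂ} (hf : ∀ z, Tendsto (fun k => L (φ k) z w) atTop (𝓝 (f z))) :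
    Approx (fun k => n (φ k)) (fun k => b (φ k)) c f := by
  obtain ⟨A, hA, hAle⟩ := exists_energy_kernel_le hc ‖w‖
  exact ⟨fun k z => L (φ k) z w, A, hA, Eventually.of_forall fun k => (hL _).mem w,
    Eventually.of_forall fun k => hAle _ _ _ (hL _) w le_rfl, hf⟩

/-- Limits of the kernels reproduce the limits of weighted polynomials. -/
lemma Approx.eval_eq_integral (hc : -1 < c) (hL : ∀ k, IsReproducing c (n k) (b k) (L k))
    {w : ℂ} {φ : ℕ → ℕ} (hφ : Tendsto φ atTop atTop) {f : ℂ → ℂ}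
    (hf : ∀ z, Tendsto (fun k => L (φ k) z w) atTop (𝓝 (f z))) {h : ℂ → ℂ}
    (hh : Approx n b (c + 1) h) : h w = ∫ z, h z * conj (f z) ∂fockMeasure c := by
  obtain ⟨A, hA, hAle⟩ := exists_energy_kernel_le hc ‖w‖
  obtain ⟨u, B, hB, h1, h2, h3⟩ := hh
  obtain ⟨C, hC⟩ := exists_energy_le_energy hc (c₂ := c + 1) (by linarith)
  have h2' : ∀ᶠ k in atTop, energy c (u k) ≤ C * B := by
    filter_upwards [h1, h2] with k hk1 hk2
    exact (hC _ hk1.differentiable).trans (mul_le_mul_right hk2 _)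
  have hCB : (C : ℝ≥0∞) * B ≠ ⊤ := ENNReal.mul_ne_top ENNReal.coe_ne_top hB
  have hlim := tendsto_integral_mul_conj hc (A := A + C * B) (ENNReal.add_ne_top.2 ⟨hA, hCB⟩)
    (f := fun k => u (φ k)) (g := fun k z => L (φ k) z w)
    (hφ.eventually (h1.mono fun k hk => hk.differentiable))
    (Eventually.of_forall fun k => ((hL (φ k)).mem w).differentiable)
    (hφ.eventually (h2'.mono fun k hk => hk.trans le_add_self))
    (Eventually.of_forall fun k => (hAle _ _ _ (hL (φ k)) w le_rfl).trans le_self_add)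
    (fun z => (h3 z).comp hφ) hf (tight_of_energy_add_one_le hB (hφ.eventually h2))
  refine tendsto_nhds_unique ((h3 w).comp hφ) (hlim.congr' ?_)
  filter_upwards [hφ.eventually h1] with k hk
  exact (hL (φ k)).eval _ hk w

/-- Limits of energy bounded at charge `c + 1` along the whole sequence cannot distinguish `f` from
`g`. Regularisation and the convergence at charge `0` extend this to `f` and `g` themselves, giving
`⟨f - g, f - g⟩ = 0`. -/
lemma kernel_limit_unique (hc : -1 < c) (hb : Tendsto b atTop atTop)
    (hp : ∀ k, IsOrthonormalPolys 0 (b k) 1 (p k))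
    (hL₀ : ∀ z w, Tendsto (fun k => sumKernel (b k) (n k) (p k) z w) atTop (𝓝 (L₀ z w)))
    (hL : ∀ k, IsReproducing c (n k) (b k) (L k)) {w : ℂ} {φ ψ : ℕ → ℕ}
    (hφ : Tendsto φ atTop atTop) (hψ : Tendsto ψ atTop atTop) {f g : ℂ → ℂ}
    (hf : ∀ z, Tendsto (fun k => L (φ k) z w) atTop (𝓝 (f z)))
    (hg : ∀ z, Tendsto (fun k => L (ψ k) z w) atTop (𝓝 (g z))) : f = g := by
  have hfA := approx_kernel_subseq hc hL hf
  have hgA := approx_kernel_subseq hc hL hg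
  have hfd := hfA.differentiable
  have hgd := hgA.differentiable
  have hfE := hfA.energy_ne_top
  have hgE := hgA.energy_ne_top
  have hint : ∀ u v : ℂ → ℂ, Differentiable ℂ u → Differentiable ℂ v → energy c u ≠ ⊤ →
      energy c v ≠ ⊤ → Integrable (fun z => u z * conj (v z)) (fockMeasure c) :=
    fun u v hu hv huA hvA => integrable_mul_conj hu.continuous.aemeasurable
      hv.continuous.aemeasurable huA hvA
  set d : ℂ → ℂ := fun z => f z - g z with hd
  have hdd : Differentiable ℂ d := hfd.sub hgd
  have hdE : energy c d ≠ ⊤ := by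
    have hle : energy c d ≤ ∫⁻ z, (2 * ‖f z‖ₑ ^ 2 + 2 * ‖g z‖ₑ ^ 2) ∂fockMeasure c := by
      refine lintegral_mono fun z => ?_
      rw [← ofReal_norm, ← ofReal_norm, ← ofReal_norm, ← ENNReal.ofReal_pow (norm_nonneg _),
        ← ENNReal.ofReal_pow (norm_nonneg _), ← ENNReal.ofReal_pow (norm_nonneg _),
        ← ENNReal.ofReal_ofNat, ← ENNReal.ofReal_mul (by norm_num),
        ← ENNReal.ofReal_mul (by norm_num), ← ENNReal.ofReal_add (by positivity) (by positivity)]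
      refine ENNReal.ofReal_le_ofReal ?_
      have h1 := norm_sub_le (f z) (g z)
      have h2 := pow_le_pow_left₀ (norm_nonneg _) h1 2
      nlinarith [sq_nonneg (‖f z‖ - ‖g z‖)]
    refine ne_top_of_le_ne_top ?_ hle
    rw [lintegral_add_left ((hfd.continuous.measurable.enorm.pow_const 2).const_mul 2),
      lintegral_const_mul' _ _ (by norm_num), lintegral_const_mul' _ _ (by norm_num)]
    exact ENNReal.add_ne_top.2 ⟨ENNReal.mul_ne_top (by norm_num) hfE,
      ENNReal.mul_ne_top (by norm_num) hgE⟩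
  have hsub : ∀ h : ℂ → ℂ, Differentiable ℂ h → energy c h ≠ ⊤ →
      ∫ z, h z * conj (d z) ∂fockMeasure c = (∫ z, h z * conj (f z) ∂fockMeasure c) -
        ∫ z, h z * conj (g z) ∂fockMeasure c := by
    intro h hh hhE
    rw [← integral_sub (hint h f hh hfd hhE hfE) (hint h g hh hgd hhE hgE)]
    refine integral_congr_ae (Eventually.of_forall fun z => ?_)
    simp only [hd, map_sub]
    ring
  have hbase : ∀ h, Approx n b (c + 1) h → ∫ z, h z * conj (d z) ∂fockMeasure c = 0 := by
    intro h hh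
    rw [hsub h hh.differentiable (hh.mono hc (by linarith)).energy_ne_top,
      ← hh.eval_eq_integral hc hL hφ hf, ← hh.eval_eq_integral hc hL hψ hg, sub_self]
  -- Induction on the number `i` of regularisations still needed to climb from charge `j` to at
  -- least `c + 1`.
  have hdesc : ∀ i j : ℕ, c + 1 ≤ (j + i : ℕ) → ∀ h, Approx n b j h → energy c h ≠ ⊤ →
      ∫ z, h z * conj (d z) ∂fockMeasure c = 0 := by
    intro i
    induction i with
    | zero =>
      intro j hj h hh _
      exact hbase h (hh.mono (by linarith) (by simpa using hj))
    | succ i ih =>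
      intro j hj h hh hhE
      refine integral_mul_conj_eq_zero_of_reg hc hh.differentiable hhE hdd hdE
        fun ε hε hε1 ρ => ?_
      have hr := hh.reg (by linarith [Nat.cast_nonneg (α := ℝ) j]) hb hε1 ρ
      refine ⟨hr.differentiable, ih (j + 1) (by convert hj using 2; ring) _ (by simpa using hr)
        (energy_reg_zero_ne_top hc hh.differentiable hhE hε1 ρ)⟩
  obtain ⟨m, hm⟩ := exists_nat_ge (c + 1)
  -- Two regularisations are used because `c + 2 > 1` for every `c > -1`; charge `1` is what
  -- `Approx.of_subseq` requires.
  have hsubseq : ∀ (χ : ℕ → ℕ) (h : ℂ → ℂ), Tendsto χ atTop atTop →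
      Approx (fun k => n (χ k)) (fun k => b (χ k)) c h →
      ∫ z, h z * conj (d z) ∂fockMeasure c = 0 := by
    intro χ h hχ hh
    have hbχ : Tendsto (fun k => b (χ k)) atTop atTop := hb.comp hχ
    refine integral_mul_conj_eq_zero_of_reg hc hh.differentiable hh.energy_ne_top hdd hdE
      fun ε hε hε1 ρ => ?_
    have hr := hh.reg hc hbχ hε1 ρ
    have hrE := energy_reg_zero_ne_top hc hh.differentiable hh.energy_ne_top hε1 ρ
    refine ⟨hr.differentiable, integral_mul_conj_eq_zero_of_reg hc hr.differentiable hrE hdd hdE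
      fun ε' hε' hε1' ρ' => ?_⟩
    have hr' := hr.reg (by linarith) hbχ hε1' ρ'
    refine ⟨hr'.differentiable, hdesc m 0 (by simpa using hm) _ ?_
      (energy_reg_zero_ne_top hc hr.differentiable hrE hε1' ρ')⟩
    rw [Nat.cast_zero]
    exact Approx.of_subseq hp hL₀ hχ (hr'.mono (by norm_num) (by linarith))
  have hzero : ∫ z, d z * conj (d z) ∂fockMeasure c = 0 := by
    have e : ∀ z, d z * conj (d z) = f z * conj (d z) - g z * conj (d z) := fun z => by
      simp only [hd]; ring
    simp_rw [e]
    rw [integral_sub (hint f d hfd hdd hfE hdE) (hint g d hgd hdd hgE hdE),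
      hsubseq φ f hφ hfA, hsubseq ψ g hψ hgA, sub_zero]
  rw [integral_mul_conj_self c hdd.continuous, Complex.ofReal_eq_zero,
    ENNReal.toReal_eq_zero_iff] at hzero
  have hE0 : energy c d = 0 := hzero.resolve_right hdE
  funext z
  obtain ⟨C, hC⟩ := exists_enorm_sq_le_energy c ‖z‖
  have h := hC d hdd z le_rfl
  rw [hE0, mul_zero, nonpos_iff_eq_zero, pow_eq_zero_iff two_ne_zero, enorm_eq_zero] at h
  exact sub_eq_zero.1 h

/-- Convergence of the kernels of charge `0` implies convergence of the kernels of any charge. -/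
lemma exists_kernel_limit (hc : -1 < c) (hb : Tendsto b atTop atTop)
    (hp : ∀ k, IsOrthonormalPolys 0 (b k) 1 (p k))
    (hL₀ : ∀ z w, Tendsto (fun k => sumKernel (b k) (n k) (p k) z w) atTop (𝓝 (L₀ z w)))
    (hL : ∀ k, IsReproducing c (n k) (b k) (L k)) :
    ∃ K : ℂ → ℂ → ℂ, ∀ z w, Tendsto (fun k => L k z w) atTop (𝓝 (K z w)) := by
  have key : ∀ w, ∃ f : ℂ → ℂ, ∀ z, Tendsto (fun k => L k z w) atTop (𝓝 (f z)) := by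
    intro w
    obtain ⟨A, hA, hAle⟩ := exists_energy_kernel_le hc ‖w‖
    have hsub : ∀ χ : ℕ → ℕ, ∃ (g : ℂ → ℂ) (φ : ℕ → ℕ), StrictMono φ ∧
        ∀ z, Tendsto (fun k => L (χ (φ k)) z w) atTop (𝓝 (g z)) := fun χ =>
      exists_subseq_tendsto_of_energy_le hA (f := fun k z => L (χ k) z w)
        (fun k => ((hL (χ k)).mem w).differentiable) (fun k => hAle _ _ _ (hL (χ k)) w le_rfl)
    obtain ⟨f, φ, hφ, hf⟩ := hsub id
    refine ⟨f, fun z => tendsto_of_subseq_tendsto fun χ hχ => ?_⟩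
    obtain ⟨g, ψ, hψ, hg⟩ := hsub χ
    refine ⟨ψ, ?_⟩
    rw [kernel_limit_unique hc hb hp hL₀ hL hφ.tendsto_atTop (hχ.comp hψ.tendsto_atTop) hf hg]
    exact hg z
  choose K hK using key
  exact ⟨fun z w => K w z, fun z w => hK w z⟩

/-- If the limit vanished at `(0,0)`, then `|u_k(0)|² ≤ energy(u_k) L_k(0,0)` would force `u_k(0) →
0` for all weighted polynomials of bounded energy. The kernel of charge `0`, regularised to a charge
at least `c`, is a counterexample. -/
lemma kernel_limit_ne_zero (hc : -1 < c) (hb : Tendsto b atTop atTop)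
    (hp : ∀ k, IsOrthonormalPolys 0 (b k) 1 (p k))
    (hL₀ : ∀ z w, Tendsto (fun k => sumKernel (b k) (n k) (p k) z w) atTop (𝓝 (L₀ z w)))
    (hL₀0 : L₀ 0 0 ≠ 0) (hL : ∀ k, IsReproducing c (n k) (b k) (L k)) {K : ℂ → ℂ → ℂ}
    (hK : ∀ z w, Tendsto (fun k => L k z w) atTop (𝓝 (K z w))) : K 0 0 ≠ 0 := by
  have hex : ∀ j : ℕ, ∃ h, Approx n b j h ∧ h 0 ≠ 0 := by
    intro j
    induction j with
    | zero =>
      refine ⟨fun z => L₀ z 0, ?_, hL₀0⟩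
      rw [Nat.cast_zero]
      exact approx_kernel_subseq (φ := id) (by norm_num)
        (fun k => (hp k).isReproducing (by norm_num) (n k)) (fun z => hL₀ z 0)
    | succ j ih =>
      obtain ⟨h, hh, h0⟩ := ih
      obtain ⟨ε, ρ, hε0, hε1, hεlim⟩ := exists_mollifier_seq
      -- A fine enough mollifier keeps the value at `0` nonzero.
      obtain ⟨k, hk⟩ := ((tendsto_reg_zero hh.differentiable.continuous hεlim ρ 0).eventually_ne
        h0).exists
      refine ⟨_, ?_, hk⟩
      have := hh.reg (by linarith [Nat.cast_nonneg (α := ℝ) j]) hb (hε1 k) (ρ k)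
      simpa using this
  obtain ⟨m, hm⟩ := exists_nat_ge c
  obtain ⟨h, hh, h0⟩ := hex m
  obtain ⟨u, A, hA, h1, h2, h3⟩ := hh.mono hc hm
  intro hK0
  have hz : Tendsto (fun k => A * ‖L k 0 0‖ₑ) atTop (𝓝 0) := by
    have := ENNReal.Tendsto.const_mul (a := A) (hK 0 0).enorm (Or.inr hA)
    simpa [hK0] using this
  have hu : Tendsto (fun k => ‖u k 0‖ₑ ^ 2) atTop (𝓝 0) := by
    refine tendsto_of_tendsto_of_tendsto_of_le_of_le' tendsto_const_nhds hz
      (Eventually.of_forall fun k => zero_le) ?_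
    filter_upwards [h1, h2] with k hk1 hk2
    exact ((hL k).enorm_sq_le hc hk1 0).trans (mul_le_mul_left hk2 _)
  have := tendsto_nhds_unique hu (ENNReal.Tendsto.pow (n := 2) (h3 0).enorm)
  rw [eq_comm, pow_eq_zero_iff two_ne_zero, enorm_eq_zero] at this
  exact h0 this

end Limit

/-! ### Charge `0`: the truncated exponential series at its transition point. -/

/-- The truncated exponential series `e^{-x} ∑_{j<n} x^j / j!`. -/
def expTail (n : ℕ) (x : ℂ) : ℂ := Complex.exp (-x) * ∑ j ∈ Finset.range n, x ^ j / j.factorial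

lemma hasDerivAt_expTail (m : ℕ) (x : ℂ) :
    HasDerivAt (expTail (m + 1)) (-(Complex.exp (-x) * (x ^ m / m.factorial))) x := by
  have hexp : HasDerivAt (fun x : ℂ => Complex.exp (-x)) (-Complex.exp (-x)) x := by
    simpa using (hasDerivAt_neg x).cexp
  induction m with
  | zero =>
    have : expTail (0 + 1) = fun x => Complex.exp (-x) := by funext x; simp [expTail]
    rw [this]
    simpa using hexp
  | succ m ih =>
    have : expTail (m + 1 + 1) = expTail (m + 1) +
        fun x => Complex.exp (-x) * (x ^ (m + 1) / (m + 1).factorial) := by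
      funext x
      rw [Pi.add_apply, expTail, Finset.sum_range_succ, mul_add, expTail]
    rw [this]
    refine (ih.add (hexp.mul ((hasDerivAt_pow (m + 1) x).div_const _))).congr_deriv ?_
    have h1 : (m.factorial : ℂ) ≠ 0 := by exact_mod_cast m.factorial_ne_zero
    have h2 : (m + 1 : ℂ) ≠ 0 := by exact_mod_cast m.succ_ne_zero
    rw [Nat.factorial_succ]
    push_cast
    field_simp
    ring

/-- The truncated exponential series around its transition point `n`, in the scale `√n`. -/
def scaledTail (n : ℕ) (τ : ℂ) : ℂ := expTail n (n + (√n : ℝ) * τ)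

/-- The constant `√n n^n e^{-n} / n!`. -/
def stirlingConst (n : ℕ) : ℝ := √n * (n ^ n * Real.exp (-n) / n.factorial)

/-- Minus the derivative of `scaledTail`. -/
def scaledDensity (n : ℕ) (τ : ℂ) : ℂ :=
  stirlingConst n * (Complex.exp (-((√n : ℝ) * τ)) * (1 + τ / (√n : ℝ)) ^ (n - 1))

lemma hasDerivAt_scaledTail {n : ℕ} (hn : 1 ≤ n) (τ : ℂ) :
    HasDerivAt (scaledTail n) (-scaledDensity n τ) τ := by
  obtain ⟨m, rfl⟩ : ∃ m, n = m + 1 := ⟨n - 1, by omega⟩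
  have h1 : HasDerivAt (fun τ : ℂ => ((m + 1 : ℕ) : ℂ) + (√(m + 1 : ℕ) : ℝ) * τ)
      (√(m + 1 : ℕ) : ℝ) τ := by
    simpa using ((hasDerivAt_id τ).const_mul ((√(m + 1 : ℕ) : ℝ) : ℂ)).const_add ((m + 1 : ℕ) : ℂ)
  refine ((hasDerivAt_expTail m _).comp τ h1).congr_deriv ?_
  have hs : (0 : ℝ) < √(m + 1 : ℕ) := by positivity
  set s : ℝ := √(m + 1 : ℕ) with hsdef
  have hss : ((m + 1 : ℕ) : ℂ) = (s : ℂ) ^ 2 := by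
    rw [← Complex.ofReal_pow, hsdef, Real.sq_sqrt (by positivity)]; simp
  have hs0 : (s : ℂ) ≠ 0 := by exact_mod_cast hs.ne'
  have h2 : ((m + 1 : ℕ) : ℂ) + s * τ = (m + 1 : ℕ) * (1 + τ / s) := by
    rw [hss]; field_simp
  have h3 : (m.factorial : ℂ) ≠ 0 := by exact_mod_cast m.factorial_ne_zero
  have h4 : ((m + 1 : ℕ) : ℂ) ≠ 0 := by exact_mod_cast m.succ_ne_zero
  rw [neg_add, Complex.exp_add, h2, mul_pow, scaledDensity, stirlingConst, Nat.factorial_succ]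
  have hs' : √((m : ℝ) + 1) = s := by rw [hsdef]; push_cast; rfl
  push_cast at h4 ⊢
  simp only [hs']
  field_simp
  ring_nf

lemma continuous_scaledDensity (n : ℕ) : Continuous (scaledDensity n) := by
  unfold scaledDensity; fun_prop

lemma tendsto_stirlingConst : Tendsto stirlingConst atTop (𝓝 (√(2 * Real.pi))⁻¹) := by
  have h := (Stirling.tendsto_stirlingSeq_sqrt_pi.const_mul (√2)).inv₀ (by positivity)
  rw [← Real.sqrt_mul (by norm_num)] at h
  refine h.congr' ?_
  filter_upwards [eventually_ge_atTop 1] with n hn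
  have hn0 : (0 : ℝ) < n := by exact_mod_cast hn
  rw [Stirling.stirlingSeq, stirlingConst, Real.sqrt_mul (by norm_num), div_pow, Real.exp_neg,
    ← Real.exp_nat_mul, mul_one]
  have := (Real.sqrt_pos.2 hn0).ne'
  have h2 : √(2 : ℝ) ^ 2 = 2 := Real.sq_sqrt (by norm_num)
  have h3 : √(n : ℝ) ^ 2 = n := Real.sq_sqrt hn0.le
  field_simp

lemma scaledDensity_eq {n : ℕ} (hn : 1 ≤ n) {τ : ℂ} (hτ : 1 + τ / (√n : ℝ) ≠ 0) :
    scaledDensity n τ = stirlingConst n * (Complex.exp (n * (Complex.log (1 + τ / (√n : ℝ)) -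
      τ / (√n : ℝ))) / (1 + τ / (√n : ℝ))) := by
  have hs : (0 : ℝ) < √n := Real.sqrt_pos.2 (by exact_mod_cast hn)
  have hs0 : ((√n : ℝ) : ℂ) ≠ 0 := by exact_mod_cast hs.ne'
  have hss : (n : ℂ) = ((√n : ℝ) : ℂ) ^ 2 := by
    rw [← Complex.ofReal_pow, Real.sq_sqrt (by positivity)]; simp
  have e : (n : ℂ) * (Complex.log (1 + τ / (√n : ℝ)) - τ / (√n : ℝ)) =
      n * Complex.log (1 + τ / (√n : ℝ)) + -((√n : ℝ) * τ) := by
    have : (n : ℂ) * (τ / (√n : ℝ)) = (√n : ℝ) * τ := by rw [hss]; field_simp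
    rw [mul_sub, this, sub_eq_add_neg]
  rw [e, Complex.exp_add, Complex.exp_nat_mul, Complex.exp_log hτ, scaledDensity]
  obtain ⟨m, rfl⟩ : ∃ m, n = m + 1 := ⟨n - 1, by omega⟩
  rw [add_tsub_cancel_right, pow_succ, mul_div_right_comm, mul_div_cancel_right₀ _ hτ,
    mul_comm (Complex.exp _)]

lemma norm_natCast_mul_div_sqrt_sq {n : ℕ} (hn : 1 ≤ n) (τ : ℂ) :
    (n : ℝ) * ‖τ / (√n : ℝ)‖ ^ 2 = ‖τ‖ ^ 2 := by
  have hn0 : (0 : ℝ) < n := by exact_mod_cast hn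
  rw [norm_div, div_pow, Complex.norm_real, Real.norm_of_nonneg (Real.sqrt_nonneg _),
    Real.sq_sqrt hn0.le]
  field_simp

lemma exists_norm_scaledDensity_le (M : ℝ) : ∃ B : ℝ, ∀ᶠ n : ℕ in atTop, ∀ τ : ℂ, ‖τ‖ ≤ M →
    ‖scaledDensity n τ‖ ≤ B := by
  obtain ⟨B, hB⟩ : ∃ B : ℝ, ∀ᶠ n in atTop, stirlingConst n ≤ B :=
    ⟨_, tendsto_stirlingConst.eventually (eventually_le_nhds (lt_add_one _))⟩
  refine ⟨B * (Real.exp (M ^ 2) * 2), ?_⟩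
  have hsq : Tendsto (fun n : ℕ => √(n : ℝ)) atTop atTop :=
    Real.tendsto_sqrt_atTop.comp tendsto_natCast_atTop_atTop
  filter_upwards [hB, eventually_ge_atTop 1, hsq.eventually_ge_atTop (2 * M)] with n hn hn1 hnM τ hτ
  have hs : (0 : ℝ) < √n := Real.sqrt_pos.2 (by exact_mod_cast hn1)
  set u : ℂ := τ / (√n : ℝ) with hu
  have hu2 : ‖u‖ ≤ 1 / 2 := by
    rw [hu, norm_div, Complex.norm_real, Real.norm_of_nonneg hs.le, div_le_iff₀ hs]
    linarith
  have h1u : 1 / 2 ≤ ‖1 + u‖ := by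
    have := norm_sub_norm_le (1 : ℂ) (-u)
    rw [sub_neg_eq_add, norm_neg, norm_one] at this
    linarith
  have hne : 1 + u ≠ 0 := norm_pos_iff.1 (by linarith)
  rw [scaledDensity_eq hn1 hne, norm_mul, norm_div, Complex.norm_real, Complex.norm_exp]
  have hst : 0 ≤ stirlingConst n := by unfold stirlingConst; positivity
  rw [Real.norm_of_nonneg hst]
  have hlog : ‖Complex.log (1 + u) - u‖ ≤ ‖u‖ ^ 2 := by
    refine (Complex.norm_log_one_add_sub_self_le (by linarith)).trans ?_
    have : (1 - ‖u‖)⁻¹ ≤ 2 := by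
      rw [inv_le_comm₀ (by linarith) (by norm_num)]; linarith
    nlinarith [sq_nonneg ‖u‖]
  have hre : (n * (Complex.log (1 + u) - u) : ℂ).re ≤ M ^ 2 := by
    refine (Complex.re_le_norm _).trans ?_
    rw [norm_mul, Complex.norm_natCast]
    calc (n : ℝ) * ‖Complex.log (1 + u) - u‖ ≤ n * ‖u‖ ^ 2 := by gcongr
      _ = ‖τ‖ ^ 2 := norm_natCast_mul_div_sqrt_sq hn1 τ
      _ ≤ M ^ 2 := by gcongr
  rw [div_eq_mul_inv]
  gcongr
  · linarith
  · rw [inv_le_comm₀ (by linarith) (by norm_num)]; linarith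

lemma tendsto_scaledDensity {n : ℕ → ℕ} (hn : Tendsto n atTop atTop) {τ : ℕ → ℂ} {τ₀ : ℂ}
    (hτ : Tendsto τ atTop (𝓝 τ₀)) :
    Tendsto (fun k => scaledDensity (n k) (τ k)) atTop
      (𝓝 ((√(2 * Real.pi))⁻¹ * Complex.exp (-(τ₀ ^ 2 / 2)))) := by
  have hsq : Tendsto (fun k => √(n k : ℝ)) atTop atTop :=
    Real.tendsto_sqrt_atTop.comp (tendsto_natCast_atTop_atTop.comp hn)
  have hinv : Tendsto (fun k => ((√(n k : ℝ) : ℝ) : ℂ)⁻¹) atTop (𝓝 0) := by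
    have := (Complex.continuous_ofReal.tendsto 0).comp (tendsto_inv_atTop_zero.comp hsq)
    simpa [Function.comp_def] using this
  set u : ℕ → ℂ := fun k => τ k / (√(n k : ℝ) : ℝ) with hu
  have hu0 : Tendsto u atTop (𝓝 0) := by
    simpa [hu, div_eq_mul_inv] using hτ.mul hinv
  have hn1 : ∀ᶠ k in atTop, 1 ≤ n k := hn.eventually_ge_atTop 1
  have hnu : ∀ᶠ k in atTop, (n k : ℂ) * u k ^ 2 = τ k ^ 2 := by
    filter_upwards [hn1] with k hk
    have hs : (0 : ℝ) < √(n k) := Real.sqrt_pos.2 (by exact_mod_cast hk)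
    have hs0 : ((√(n k : ℝ) : ℝ) : ℂ) ≠ 0 := by exact_mod_cast hs.ne'
    have hss : (n k : ℂ) = ((√(n k : ℝ) : ℝ) : ℂ) ^ 2 := by
      rw [← Complex.ofReal_pow, Real.sq_sqrt (by positivity)]; simp
    rw [hu, hss]
    simp only
    field_simp
  have hlog : Tendsto (fun k => (n k : ℂ) * (Complex.log (1 + u k) - u k)) atTop
      (𝓝 (-(τ₀ ^ 2 / 2))) := by
    -- The third-order Taylor remainder is at most `|u|³`, and `n|u|³ = |τ|²|u| → 0`; the surviving
    -- quadratic term gives the Gaussian.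
    have h1 : Tendsto (fun k => (n k : ℂ) * (Complex.log (1 + u k) - u k + u k ^ 2 / 2)) atTop
        (𝓝 0) := by
      have h2 : Tendsto (fun k => ‖τ k‖ ^ 2 * ‖u k‖) atTop (𝓝 0) := by
        simpa using (hτ.norm.pow 2).mul hu0.norm
      refine squeeze_zero_norm' ?_ h2
      filter_upwards [hn1, hnu, hu0.norm.eventually (eventually_le_nhds
        (show ‖(0 : ℂ)‖ < 1 / 2 by simp))] with k hk hk2 hk3
      have h3 := Complex.norm_log_sub_logTaylor_le 2 (z := u k) (by linarith)
      have h4 : Complex.log (1 + u k) - Complex.logTaylor (2 + 1) (u k) =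
          Complex.log (1 + u k) - u k + u k ^ 2 / 2 := by
        simp [Complex.logTaylor_succ, Complex.logTaylor_zero]
        ring
      rw [h4] at h3
      have h5 : (1 - ‖u k‖)⁻¹ ≤ 2 := by
        rw [inv_le_comm₀ (by linarith) (by norm_num)]; linarith
      have h6 : ‖Complex.log (1 + u k) - u k + u k ^ 2 / 2‖ ≤ ‖u k‖ ^ 3 := by
        refine h3.trans ?_
        have : 0 ≤ ‖u k‖ ^ 3 := by positivity
        have h7 : ‖u k‖ ^ (2 + 1) * (1 - ‖u k‖)⁻¹ ≤ ‖u k‖ ^ 3 * 2 :=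
          mul_le_mul_of_nonneg_left h5 this
        rw [div_le_iff₀ (by positivity)]
        push_cast
        linarith
      rw [norm_mul, Complex.norm_natCast]
      calc (n k : ℝ) * ‖Complex.log (1 + u k) - u k + u k ^ 2 / 2‖ ≤ n k * ‖u k‖ ^ 3 := by gcongr
        _ = (n k * ‖u k‖ ^ 2) * ‖u k‖ := by ring
        _ = ‖τ k‖ ^ 2 * ‖u k‖ := by rw [norm_natCast_mul_div_sqrt_sq hk]
    have h2 := h1.sub ((hτ.pow 2).div_const 2)
    rw [zero_sub] at h2
    refine h2.congr' ?_
    filter_upwards [hnu] with k hk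
    rw [← hk]; ring
  have hst : Tendsto (fun k => ((stirlingConst (n k) : ℝ) : ℂ)) atTop
      (𝓝 (((√(2 * Real.pi))⁻¹ : ℝ) : ℂ)) :=
    (Complex.continuous_ofReal.tendsto _).comp (tendsto_stirlingConst.comp hn)
  have h1u : Tendsto (fun k => 1 + u k) atTop (𝓝 1) := by simpa using hu0.const_add 1
  have h := hst.mul (hlog.cexp.div h1u one_ne_zero)
  rw [div_one] at h
  refine h.congr' ?_
  filter_upwards [hn1, h1u.eventually_ne one_ne_zero] with k hk hk2
  rw [scaledDensity_eq hk hk2, Pi.div_apply]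

/-- The increment of the rescaled truncated exponential series converges. -/
lemma tendsto_scaledTail_sub {n : ℕ → ℕ} (hn : Tendsto n atTop atTop) {x y : ℕ → ℂ} {x₀ y₀ : ℂ}
    (hx : Tendsto x atTop (𝓝 x₀)) (hy : Tendsto y atTop (𝓝 y₀)) :
    Tendsto (fun k => scaledTail (n k) (x k) - scaledTail (n k) (y k)) atTop
      (𝓝 ((y₀ - x₀) * ∫ t in (0 : ℝ)..1, (√(2 * Real.pi))⁻¹ *
        Complex.exp (-((x₀ + t • (y₀ - x₀)) ^ 2 / 2)))) := by
  have hint : Tendsto (fun k => ∫ t in (0 : ℝ)..1, scaledDensity (n k) (x k + t • (y k - x k)))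
      atTop (𝓝 (∫ t in (0 : ℝ)..1, (√(2 * Real.pi))⁻¹ *
        Complex.exp (-((x₀ + t • (y₀ - x₀)) ^ 2 / 2)))) := by
    obtain ⟨B, hB⟩ := exists_norm_scaledDensity_le (‖x₀‖ + 1 + (‖y₀ - x₀‖ + 1))
    refine intervalIntegral.tendsto_integral_filter_of_dominated_convergence (fun _ => B)
      (Eventually.of_forall fun k => ?_) ?_ (by simp) ?_
    · exact ((continuous_scaledDensity _).comp (by fun_prop)).aestronglyMeasurable
    · filter_upwards [hn.eventually hB, hx.norm.eventually (eventually_le_nhds (lt_add_one _)),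
        (hy.sub hx).norm.eventually (eventually_le_nhds (lt_add_one _))] with k h1 h2 h3
      refine Eventually.of_forall fun t ht => h1 _ ((norm_add_le _ _).trans (add_le_add h2 ?_))
      rw [Set.uIoc_of_le zero_le_one] at ht
      rw [norm_smul, Real.norm_of_nonneg ht.1.le]
      exact (mul_le_of_le_one_left (norm_nonneg _) ht.2).trans h3
    · exact Eventually.of_forall fun t _ =>
        tendsto_scaledDensity hn (hx.add ((hy.sub hx).const_smul t))
  refine ((hy.sub hx).mul hint).congr' ?_
  filter_upwards [hn.eventually_ge_atTop 1] with k hk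
  have h := intervalIntegral.integral_unitInterval_deriv_eq_sub (f := scaledTail (n k))
    (f' := fun τ => -scaledDensity (n k) τ) (z₀ := x k) (z₁ := y k - x k)
    ((continuous_scaledDensity _).neg.comp (by fun_prop)).continuousOn
    (fun t _ => hasDerivAt_scaledTail hk _)
  rw [intervalIntegral.integral_neg, smul_eq_mul, add_sub_cancel] at h
  linear_combination -h

lemma expTail_ofReal (n : ℕ) (x : ℝ) : expTail n x =
    ((Real.exp (-x) * ∑ j ∈ Finset.range n, x ^ j / j.factorial : ℝ) : ℂ) := by
  simp [expTail]

lemma scaledTail_ofReal (n : ℕ) (ξ : ℝ) : scaledTail n ξ = ((Real.exp (-(n + √n * ξ)) *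
    ∑ j ∈ Finset.range n, (n + √n * ξ) ^ j / j.factorial : ℝ) : ℂ) := by
  rw [← expTail_ofReal, scaledTail]; push_cast; rfl

/-- A Chernoff bound for a Poisson tail: `x^j ≤ q^n (x/q)^j` for `j < n`. The choice `q = 1 + 1/√n`
turns the exponent into exactly `(1 - ξ)/q`, and `q ≤ 2`. -/
lemma norm_scaledTail_le {n : ℕ} (hn : 1 ≤ n) {ξ : ℝ} (hξ : 1 ≤ ξ) :
    ‖scaledTail n ξ‖ ≤ Real.exp ((1 - ξ) / 2) := by
  have hn0 : (1 : ℝ) ≤ n := by exact_mod_cast hn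
  set s : ℝ := √n with hs
  have hs1 : 1 ≤ s := Real.one_le_sqrt.2 hn0
  have hss : (n : ℝ) = s ^ 2 := (Real.sq_sqrt (by positivity)).symm
  set x : ℝ := n + s * ξ with hx
  have hx0 : 0 ≤ x := by positivity
  rw [scaledTail_ofReal, Complex.norm_real, Real.norm_of_nonneg (mul_nonneg (Real.exp_pos _).le
    (Finset.sum_nonneg fun j _ => by positivity))]
  set q : ℝ := 1 + 1 / s with hq
  have hq1 : 1 ≤ q := by rw [hq]; linarith [show 0 ≤ 1 / s by positivity]
  have hq2 : q ≤ 2 := by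
    rw [hq]
    have : 1 / s ≤ 1 := by rw [div_le_one (by positivity)]; exact hs1
    linarith
  have hsum : ∑ j ∈ Finset.range n, x ^ j / j.factorial ≤ Real.exp s * Real.exp (x / q) := by
    calc ∑ j ∈ Finset.range n, x ^ j / j.factorial
        ≤ ∑ j ∈ Finset.range n, q ^ n * ((x / q) ^ j / j.factorial) := by
          refine Finset.sum_le_sum fun j hj => ?_
          have e : x ^ j = q ^ j * (x / q) ^ j := by rw [← mul_pow]; field_simp
          rw [e, mul_div_assoc]
          exact mul_le_mul_of_nonneg_right (pow_le_pow_right₀ hq1 (Finset.mem_range.1 hj).le)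
            (by positivity)
      _ = q ^ n * ∑ j ∈ Finset.range n, (x / q) ^ j / j.factorial := by rw [Finset.mul_sum]
      _ ≤ Real.exp s * Real.exp (x / q) := by
          refine mul_le_mul ?_ ?_ (Finset.sum_nonneg fun j _ => by positivity) (Real.exp_pos _).le
          · calc q ^ n ≤ Real.exp (1 / s) ^ n := by
                  gcongr; rw [hq, add_comm]; exact Real.add_one_le_exp _
              _ = Real.exp s := by
                  rw [← Real.exp_nat_mul, hss]; congr 1; field_simp
          · exact Real.sum_le_exp_of_nonneg (by positivity) n
  refine (mul_le_mul_of_nonneg_left hsum (Real.exp_pos _).le).trans ?_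
  rw [← Real.exp_add, ← Real.exp_add, Real.exp_le_exp]
  have h1 : -x + (s + x / q) = (1 - ξ) / q := by
    rw [hx, hss, hq]
    field_simp
    ring
  rw [h1]
  rw [div_le_div_iff₀ (by linarith) (by norm_num)]
  nlinarith

/-- Increments converge to Gaussian integrals, so only one value needs a limit. At `0` the values
are Cauchy: they differ from a convergent increment by the tail at a large `ξ`, which is uniformly
small. -/
lemma exists_tendsto_scaledTail : ∃ F : ℂ → ℂ, (∀ (n : ℕ → ℕ) (x : ℕ → ℂ) (x₀ : ℂ),
    Tendsto n atTop atTop → Tendsto x atTop (𝓝 x₀) →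
      Tendsto (fun k => scaledTail (n k) (x k)) atTop (𝓝 (F x₀))) ∧ ∀ s : ℝ, F s ≠ 0 := by
  have hC : CauchySeq fun n : ℕ => scaledTail n 0 := by
    rw [Metric.cauchySeq_iff]
    intro ε hε
    have hlim : Tendsto (fun ξ : ℝ => Real.exp ((1 - ξ) / 2)) atTop (𝓝 0) := by
      refine Real.tendsto_exp_atBot.comp (Tendsto.atBot_div_const (by norm_num) ?_)
      exact tendsto_atBot_add_const_left _ _ tendsto_neg_atTop_atBot
    obtain ⟨ξ, hξ1, hξ⟩ := ((eventually_ge_atTop 1).and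
      (hlim.eventually (gt_mem_nhds (show (0 : ℝ) < ε / 4 by positivity)))).exists
    have h := tendsto_scaledTail_sub tendsto_id (tendsto_const_nhds (x := (0 : ℂ)))
      (tendsto_const_nhds (x := (ξ : ℂ)))
    set I := ((ξ : ℂ) - 0) * ∫ t in (0 : ℝ)..1, ((√(2 * Real.pi))⁻¹ : ℝ) *
        Complex.exp (-((0 + t • ((ξ : ℂ) - 0)) ^ 2 / 2))
    obtain ⟨N, hN⟩ := eventually_atTop.1 (((Metric.tendsto_nhds.1 h (ε / 4)
      (by positivity))).and (eventually_ge_atTop 1))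
    have hI : ∀ k ≥ N, dist (scaledTail k 0) I < ε / 2 := by
      intro k hk
      obtain ⟨h1, h2⟩ := hN k hk
      have h3 := norm_scaledTail_le h2 hξ1
      have h4 : scaledTail k 0 - I = (scaledTail k 0 - scaledTail k ξ - I) + scaledTail k ξ := by
        ring
      rw [dist_eq_norm, h4]
      rw [dist_eq_norm] at h1
      refine (norm_add_le _ _).trans_lt ?_
      simp only [id] at h1
      linarith
    refine ⟨N, fun m hm k hk => ?_⟩
    linarith [dist_triangle_right (scaledTail m 0) (scaledTail k 0) I, hI m hm, hI k hk]
  obtain ⟨a, ha⟩ := cauchySeq_tendsto_of_complete hC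
  obtain ⟨F, hF⟩ : ∃ F : ℂ → ℂ, ∀ (n : ℕ → ℕ) (x : ℕ → ℂ) (x₀ : ℂ),
      Tendsto n atTop atTop → Tendsto x atTop (𝓝 x₀) →
        Tendsto (fun k => scaledTail (n k) (x k)) atTop (𝓝 (F x₀)) := by
    refine ⟨fun x₀ => a + (0 - x₀) * ∫ t in (0 : ℝ)..1, ((√(2 * Real.pi))⁻¹ : ℝ) *
        Complex.exp (-((x₀ + t • (0 - x₀)) ^ 2 / 2)), fun n x x₀ hn hx => ?_⟩
    refine ((ha.comp hn).add (tendsto_scaledTail_sub hn hx tendsto_const_nhds)).congr fun k => ?_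
    simp
  -- `F(s) - F(s+1)` is a positive Gaussian integral and `F(s+1) ≥ 0`, so `F(s) > 0` for real `s`.
  refine ⟨F, hF, fun s hs => ?_⟩
  have hn : Tendsto (fun k : ℕ => k) atTop atTop := tendsto_id
  have h1 := tendsto_scaledTail_sub hn (tendsto_const_nhds (x := (s : ℂ)))
    (tendsto_const_nhds (x := ((s + 1 : ℝ) : ℂ)))
  have h2 := tendsto_nhds_unique h1 ((hF _ _ _ hn tendsto_const_nhds).sub
    (hF _ _ _ hn tendsto_const_nhds))
  have h3 : 0 ≤ (F (s + 1 : ℝ)).re := by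
    refine ge_of_tendsto ((Complex.continuous_re.tendsto _).comp
      (hF _ _ _ hn (tendsto_const_nhds (x := ((s + 1 : ℝ) : ℂ))))) ?_
    have hsq : Tendsto (fun n : ℕ => √(n : ℝ)) atTop atTop :=
      Real.tendsto_sqrt_atTop.comp tendsto_natCast_atTop_atTop
    filter_upwards [hsq.eventually_ge_atTop (-(s + 1))] with k hk
    have h4 : 0 ≤ (k : ℝ) + √k * (s + 1) := by
      have : (k : ℝ) = √k * √k := (Real.mul_self_sqrt (by positivity)).symm
      rw [this, Real.sqrt_mul_self (by positivity), ← mul_add]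
      exact mul_nonneg (by positivity) (by linarith)
    rw [Function.comp_apply, scaledTail_ofReal, Complex.ofReal_re]
    positivity
  have h5 : (∫ t in (0 : ℝ)..1, (((√(2 * Real.pi))⁻¹ : ℝ) : ℂ) *
      Complex.exp (-(((s : ℂ) + t • (((s + 1 : ℝ) : ℂ) - s)) ^ 2 / 2))) =
      ((∫ t in (0 : ℝ)..1, (√(2 * Real.pi))⁻¹ * Real.exp (-((s + t) ^ 2 / 2)) : ℝ) : ℂ) := by
    rw [← intervalIntegral.integral_ofReal]
    refine intervalIntegral.integral_congr fun t _ => ?_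
    push_cast
    rw [Complex.real_smul]
    ring_nf
  have h6 : 0 < ∫ t in (0 : ℝ)..1, (√(2 * Real.pi))⁻¹ * Real.exp (-((s + t) ^ 2 / 2)) :=
    intervalIntegral.intervalIntegral_pos_of_pos
      (Continuous.intervalIntegrable (by fun_prop) _ _) (fun t => by positivity) one_pos
  rw [h5, hs, zero_sub] at h2
  have h7 := congrArg Complex.re h2
  rw [Complex.neg_re, ← Complex.ofReal_sub, ← Complex.ofReal_mul, Complex.ofReal_re] at h7
  have : s + 1 - s = 1 := by ring
  rw [this, one_mul] at h7
  linarith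

/-! ### Charge `0`: the explicit kernel and its edge limit. -/

lemma integral_areaMeasure (f : ℂ → ℂ) :
    ∫ z, f z ∂areaMeasure = (Real.pi⁻¹ : ℝ) * ∫ z, f z := by
  rw [areaMeasure, integral_smul_measure, ENNReal.toReal_ofReal (by positivity), Complex.real_smul]

lemma integral_pow_mul_conj_pow (i j : ℕ) :
    ∫ z : ℂ, z ^ i * conj (z ^ j) * (Real.exp (-‖z‖ ^ 2) : ℂ) ∂areaMeasure =
      if i = j then (i.factorial : ℂ) else 0 := by
  rw [integral_areaMeasure]
  split_ifs with h
  · subst h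
    have h1 : ∀ z : ℂ, z ^ i * conj (z ^ i) * (Real.exp (-‖z‖ ^ 2) : ℂ) =
        ((‖z‖ ^ (2 * i : ℝ) * Real.exp (-‖z‖ ^ (2 : ℝ)) : ℝ) : ℂ) := fun z => by
      rw [Complex.mul_conj', norm_pow, ← Complex.ofReal_pow, ← pow_mul, mul_comm i 2]
      have : (2 * i : ℝ) = ((2 * i : ℕ) : ℝ) := by push_cast; rfl
      rw [this, Real.rpow_natCast, Real.rpow_ofNat]
      push_cast
      rfl
    simp_rw [h1]
    rw [integral_complex_ofReal, Complex.integral_rpow_mul_exp_neg_rpow (by norm_num)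
      (by linarith [Nat.cast_nonneg (α := ℝ) i])]
    have : (2 * (i : ℝ) + 2) / 2 = i + 1 := by ring
    rw [this, Real.Gamma_nat_eq_factorial, ← Complex.ofReal_mul]
    have hpi := Real.pi_ne_zero
    have e : Real.pi⁻¹ * (2 * Real.pi / 2 * (i.factorial : ℝ)) = i.factorial := by field_simp
    rw [e]; simp
  · set f : ℂ → ℂ := fun z => z ^ i * conj (z ^ j) * (Real.exp (-‖z‖ ^ 2) : ℂ) with hf
    have hij : ((i : ℂ) - j) ≠ 0 := sub_ne_zero.2 (by exact_mod_cast h)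
    -- Rotation by the angle `π/(i-j)` multiplies `z^i conj(z^j)` by `-1` and preserves the measure.
    set a : Circle := Circle.exp (Real.pi / (i - j)) with ha
    have h1 : ∀ z, f (rotation a z) = -f z := fun z => by
      have h2 : (a : ℂ) ^ i * conj ((a : ℂ) ^ j) = -1 := by
        rw [ha, Circle.coe_exp, map_pow, ← Complex.exp_conj, ← Complex.exp_nat_mul,
          ← Complex.exp_nat_mul, ← Complex.exp_add, ← Complex.exp_pi_mul_I]
        congr 1
        simp only [map_mul, Complex.conj_ofReal, Complex.conj_I]
        push_cast
        field_simp
        ring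
      simp only [hf]
      rw [LinearIsometryEquiv.norm_map, rotation_apply, mul_pow, mul_pow, map_mul]
      linear_combination (z ^ i * conj (z ^ j) * (Real.exp (-‖z‖ ^ 2) : ℂ)) * h2
    have h2 := (rotation a).measurePreserving.integral_comp
      (rotation a).toHomeomorph.measurableEmbedding f
    simp only [h1] at h2
    rw [integral_neg] at h2
    rw [self_eq_neg.1 h2.symm, mul_zero]

/-- The orthonormal polynomials `(X - b)^j / √j!` of the Gaussian weight centred at `b`. -/
def shiftedMonomial (b : ℝ) (j : ℕ) : ℂ[X] :=
  C (((√(j.factorial : ℝ))⁻¹ : ℝ) : ℂ) * (X - C (b : ℂ)) ^ j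

lemma isOrthonormalPolys_shiftedMonomial (b : ℝ) :
    IsOrthonormalPolys 0 b 1 (shiftedMonomial b) := by
  refine ⟨fun j => ?_, fun j k => ?_⟩
  · have h : (((√(j.factorial : ℝ))⁻¹ : ℝ) : ℂ) ≠ 0 := by
      have : (0 : ℝ) < j.factorial := by exact_mod_cast j.factorial_pos
      exact_mod_cast (inv_pos.2 (Real.sqrt_pos.2 this)).ne'
    rw [shiftedMonomial, degree_C_mul h, degree_pow, degree_X_sub_C]
    simp
  · set f : ℂ → ℂ := fun z => (((√(j.factorial : ℝ))⁻¹ * (√(k.factorial : ℝ))⁻¹ : ℝ) : ℂ) *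
      (z ^ j * conj (z ^ k) * (Real.exp (-‖z‖ ^ 2) : ℂ)) with hf
    have h : ∀ ζ : ℂ, (shiftedMonomial b j).eval ζ * conj ((shiftedMonomial b k).eval ζ) *
        ((‖ζ‖ ^ (2 * (0 : ℝ)) * Real.exp (-((1 : ℕ) : ℝ) * Q b ζ) : ℝ) : ℂ) = f (ζ - b) :=
      fun ζ => by
        simp only [hf, shiftedMonomial, eval_mul, eval_C, eval_pow, eval_sub, eval_X, map_mul, Q,
          Complex.conj_ofReal, mul_zero, Real.rpow_zero, Nat.cast_one, one_mul, neg_one_mul]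
        push_cast
        ring
    simp_rw [h]
    rw [integral_areaMeasure, integral_sub_right_eq_self f, integral_const_mul, mul_left_comm,
      ← integral_areaMeasure, integral_pow_mul_conj_pow]
    split_ifs with hjk
    · subst hjk
      have : (0 : ℝ) < j.factorial := by exact_mod_cast j.factorial_pos
      rw [← mul_inv, Real.mul_self_sqrt this.le]
      push_cast
      exact inv_mul_cancel₀ (by exact_mod_cast this.ne')
    · simp

lemma sumKernel_shiftedMonomial (b : ℝ) (n : ℕ) (z w : ℂ) :
    sumKernel b n (shiftedMonomial b) z w =
      Complex.exp (z * conj w) * expTail n ((z - b) * (conj w - b)) := by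
  have h1 : Complex.exp (b * z - b ^ 2 / 2) * conj (Complex.exp (b * w - b ^ 2 / 2)) =
      Complex.exp (z * conj w) * Complex.exp (-((z - b) * (conj w - b))) := by
    rw [← Complex.exp_conj, ← Complex.exp_add, ← Complex.exp_add]
    congr 1
    simp only [map_sub, map_mul, map_div₀, map_pow, Complex.conj_ofReal, map_ofNat]
    ring
  rw [expTail, ← mul_assoc, ← h1, sumKernel, Finset.mul_sum]
  refine Finset.sum_congr rfl fun j _ => ?_
  have hj : (((√(j.factorial : ℝ))⁻¹ : ℝ) : ℂ) * (((√(j.factorial : ℝ))⁻¹ : ℝ) : ℂ) =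
      ((j.factorial : ℂ))⁻¹ := by
    rw [← Complex.ofReal_mul, ← mul_inv, Real.mul_self_sqrt (by positivity)]
    push_cast; rfl
  simp only [expPoly, shiftedMonomial, eval_mul, eval_C, eval_pow, eval_sub, eval_X, map_mul,
    map_pow, map_sub, Complex.conj_ofReal, div_eq_mul_inv, mul_pow]
  rw [← hj]
  ring

/-- The sequence `(n, b)` of degrees and shifts approaches the edge regime of parameter `S`. -/
structure EdgeSeq (S : ℝ) (n : ℕ → ℕ) (b : ℕ → ℝ) : Prop where
  tendsto_n : Tendsto n atTop atTop
  tendsto_b : Tendsto (fun k => b k - √(n k)) atTop (𝓝 (S / 2))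

lemma EdgeSeq.tendsto_sqrt {S : ℝ} {n : ℕ → ℕ} {b : ℕ → ℝ} (h : EdgeSeq S n b) :
    Tendsto (fun k => √(n k : ℝ)) atTop atTop :=
  Real.tendsto_sqrt_atTop.comp (tendsto_natCast_atTop_atTop.comp h.tendsto_n)

lemma EdgeSeq.tendsto_atTop {S : ℝ} {n : ℕ → ℕ} {b : ℕ → ℝ} (h : EdgeSeq S n b) :
    Tendsto b atTop atTop := by
  simpa using h.tendsto_sqrt.atTop_add h.tendsto_b

/-- In `(z - b)(w̄ - b) = n + √n τ`, the relation `b = √n + S/2 + o(1)` gives `τ → S - (z + w̄)`. At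
the origin `τ → S` is real, where the limit function does not vanish. -/
lemma exists_tendsto_sumKernel_shiftedMonomial {S : ℝ} {n : ℕ → ℕ} {b : ℕ → ℝ}
    (h : EdgeSeq S n b) : ∃ L₀ : ℂ → ℂ → ℂ, (∀ z w, Tendsto (fun k =>
      sumKernel (b k) (n k) (shiftedMonomial (b k)) z w) atTop (𝓝 (L₀ z w))) ∧ L₀ 0 0 ≠ 0 := by
  obtain ⟨F, hF, hF0⟩ := exists_tendsto_scaledTail
  refine ⟨fun z w => Complex.exp (z * conj w) * F (S - (z + conj w)), fun z w => ?_, ?_⟩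
  · simp_rw [sumKernel_shiftedMonomial]
    refine Tendsto.const_mul _ ?_
    set τ : ℕ → ℂ := fun k =>
      ((z - b k) * (conj w - b k) - n k) * ((√(n k : ℝ) : ℝ) : ℂ)⁻¹ with hτ
    have hs0 : ∀ᶠ k in atTop, ((√(n k : ℝ) : ℝ) : ℂ) ≠ 0 := by
      filter_upwards [h.tendsto_sqrt.eventually_gt_atTop 0] with k hk
      exact_mod_cast hk.ne'
    have hinv : Tendsto (fun k => ((√(n k : ℝ) : ℝ) : ℂ)⁻¹) atTop (𝓝 0) := by
      have := (Complex.continuous_ofReal.tendsto 0).comp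
        (tendsto_inv_atTop_zero.comp h.tendsto_sqrt)
      simpa [Function.comp_def] using this
    have hβ : Tendsto (fun k => ((b k - √(n k) : ℝ) : ℂ)) atTop (𝓝 ((S / 2 : ℝ) : ℂ)) :=
      (Complex.continuous_ofReal.tendsto _).comp h.tendsto_b
    have hlim : Tendsto τ atTop (𝓝 (S - (z + conj w))) := by
      have h1 := ((hβ.const_mul 2).add ((hβ.pow 2).mul hinv)).sub
        (((hβ.mul hinv).const_add 1).const_mul (z + conj w))
      have h2 := h1.add (hinv.const_mul (z * conj w))
      have e : (2 * ((S / 2 : ℝ) : ℂ) + ((S / 2 : ℝ) : ℂ) ^ 2 * 0 -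
          (z + conj w) * (1 + ((S / 2 : ℝ) : ℂ) * 0) + z * conj w * 0) = S - (z + conj w) := by
        push_cast; ring
      rw [e] at h2
      refine h2.congr' ?_
      filter_upwards [hs0] with k hk
      have hss : (n k : ℂ) = ((√(n k : ℝ) : ℝ) : ℂ) ^ 2 := by
        rw [← Complex.ofReal_pow, Real.sq_sqrt (by positivity)]; simp
      rw [hτ]
      simp only
      rw [hss]
      push_cast
      field_simp
      ring
    refine (hF n τ _ h.tendsto_n hlim).congr' ?_
    filter_upwards [hs0] with k hk
    rw [scaledTail, hτ]
    congr 1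
    field_simp
    ring
  · have := hF0 S
    simpa using this

/-! ### Existence of orthonormal polynomials by Gram–Schmidt. -/

/-- The `L²(fockMeasure c)` inner product of polynomials, through `expPoly`. -/
@[reducible]
def polyCore {c : ℝ} (hc : -1 < c) (b : ℝ) : InnerProductSpace.Core ℂ ℂ[X] where
  inner p q := ∫ z, expPoly b q z * conj (expPoly b p z) ∂fockMeasure c
  conj_inner_symm p q := by
    rw [← integral_conj]
    exact integral_congr_ae (Eventually.of_forall fun z => by simp [mul_comm])
  re_inner_nonneg p := by
    rw [integral_mul_conj_self c (differentiable_expPoly b p).continuous]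
    exact ENNReal.toReal_nonneg
  add_left p q r := by
    rw [← integral_add (integrable_expPoly_mul_conj hc b _ _)
      (integrable_expPoly_mul_conj hc b _ _)]
    simp [expPoly_add, mul_add]
  smul_left p q r := by
    rw [← integral_const_mul]
    refine integral_congr_ae (Eventually.of_forall fun z => ?_)
    simp only [expPoly_smul, Pi.smul_apply, smul_eq_mul, map_mul]
    ring
  definite p hp := by
    rw [integral_mul_conj_self c (differentiable_expPoly b p).continuous] at hp
    have hE : energy c (expPoly b p) = 0 := by
      have h := Complex.ofReal_eq_zero.1 hp
      exact ((ENNReal.toReal_eq_zero_iff _).1 h).resolve_right (energy_expPoly_ne_top hc b p)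
    refine Polynomial.funext fun z => ?_
    obtain ⟨C, hC⟩ := exists_enorm_sq_le_energy c ‖z‖
    have h := hC _ (differentiable_expPoly b p) z le_rfl
    rw [hE, mul_zero] at h
    have h2 : expPoly b p z = 0 := by simpa using h
    simpa [expPoly] using h2

lemma exists_isOrthonormalPolys {c : ℝ} (hc : -1 < c) (b : ℝ) :
    ∃ p, IsOrthonormalPolys c b 1 p := by
  let core := polyCore hc b
  let _ : NormedAddCommGroup ℂ[X] := core.toNormedAddCommGroup
  let _ : InnerProductSpace ℂ ℂ[X] := InnerProductSpace.ofCore core.toCore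
  have hli : LinearIndependent ℂ fun j : ℕ => (X : ℂ[X]) ^ j := by
    simpa [← X_pow_eq_monomial] using (Polynomial.basisMonomials ℂ).linearIndependent
  have hspan : ∀ j : ℕ, Submodule.span ℂ ((fun j : ℕ => (X : ℂ[X]) ^ j) '' Set.Iio j) ≤
      degreeLT ℂ j := fun j => by
    rw [Submodule.span_le]
    rintro _ ⟨i, hi, rfl⟩
    rw [SetLike.mem_coe, mem_degreeLT]
    simp only [degree_X_pow]
    exact_mod_cast hi
  have hdeg : ∀ j : ℕ, (InnerProductSpace.gramSchmidt ℂ (fun j : ℕ => (X : ℂ[X]) ^ j) j).degree =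
      (j : WithBot ℕ) := fun j => by
    rw [InnerProductSpace.gramSchmidt_def, degree_sub_eq_left_of_degree_lt, degree_X_pow]
    rw [degree_X_pow, ← mem_degreeLT]
    refine hspan j ?_
    rw [← InnerProductSpace.span_gramSchmidt_Iio ℂ]
    refine Submodule.sum_mem _ fun i hi => ?_
    rw [Submodule.starProjection_singleton]
    exact Submodule.smul_mem _ _ (Submodule.subset_span ⟨i, by simpa using hi, rfl⟩)
  refine ⟨InnerProductSpace.gramSchmidtNormed ℂ fun j : ℕ => (X : ℂ[X]) ^ j, fun j => ?_,
    fun j k => ?_⟩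
  · have h0 := norm_ne_zero_iff.2 (InnerProductSpace.gramSchmidt_ne_zero (𝕜 := ℂ) j hli)
    rw [InnerProductSpace.gramSchmidtNormed, smul_eq_C_mul, degree_C_mul, hdeg j]
    exact inv_ne_zero (Complex.ofReal_ne_zero.2 h0)
  · rw [← integral_expPoly_mul_conj]
    have h := orthonormal_iff_ite.1 (InnerProductSpace.gramSchmidtNormed_orthonormal hli) k j
    simp only [eq_comm (a := j)]
    exact h

/-! ### One limit for all edge sequences. -/

lemma tendsto_ite_even {α : Type*} {l : Filter α} {u v : ℕ → α} (hu : Tendsto u atTop l)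
    (hv : Tendsto v atTop l) :
    Tendsto (fun m => if Even m then u (m / 2) else v (m / 2)) atTop l := by
  have h : Tendsto (fun m : ℕ => m / 2) atTop atTop :=
    Nat.tendsto_div_const_atTop two_ne_zero
  exact (hu.comp h).if' (hv.comp h)

lemma tendsto_two_mul : Tendsto (fun k : ℕ => 2 * k) atTop atTop :=
  tendsto_id.const_mul_atTop' two_pos

lemma EdgeSeq.interlace {S : ℝ} {n n' : ℕ → ℕ} {b b' : ℕ → ℝ} (h : EdgeSeq S n b)
    (h' : EdgeSeq S n' b') : EdgeSeq S (fun m => if Even m then n (m / 2) else n' (m / 2))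
      (fun m => if Even m then b (m / 2) else b' (m / 2)) := by
  refine ⟨tendsto_ite_even h.tendsto_n h'.tendsto_n, ?_⟩
  refine (tendsto_ite_even h.tendsto_b h'.tendsto_b).congr fun m => ?_
  split_ifs <;> rfl

/-- The standard sequence of degrees and shifts with edge parameter `S`. -/
def edgeShift (S : ℝ) (N : ℕ) : ℝ := √N + S / 2

lemma edgeSeq_add_one (S : ℝ) : EdgeSeq S (fun k => k + 1) fun k => edgeShift S (k + 1) :=
  ⟨tendsto_add_atTop_nat 1, by simp [edgeShift]⟩

/-- Raising the degree by one at fixed shift changes `√n` by at most `1/√n`, so the edge parameter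
is unaffected. The recursion, which pairs degrees `n + 1` and `n`, relies on this. -/
lemma edgeSeq_add_two (S : ℝ) : EdgeSeq S (fun k => k + 1 + 1) fun k => edgeShift S (k + 1) := by
  refine ⟨(tendsto_add_atTop_nat 2).congr fun k => rfl, ?_⟩
  have h1 : Tendsto (fun k : ℕ => (√((k + 1 : ℕ) : ℝ))⁻¹) atTop (𝓝 0) :=
    tendsto_inv_atTop_zero.comp (edgeSeq_add_one S).tendsto_sqrt
  have h2 : Tendsto (fun k : ℕ => √((k + 1 + 1 : ℕ) : ℝ) - √((k + 1 : ℕ) : ℝ)) atTop (𝓝 0) := by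
    refine squeeze_zero (fun k => sub_nonneg.2 (Real.sqrt_le_sqrt (by push_cast; linarith)))
      (fun k => ?_) h1
    have h3 : (0 : ℝ) < √((k + 1 : ℕ) : ℝ) := by positivity
    have h4 : √((k + 1 + 1 : ℕ) : ℝ) ^ 2 = √((k + 1 : ℕ) : ℝ) ^ 2 + 1 := by
      rw [Real.sq_sqrt (by positivity), Real.sq_sqrt (by positivity)]; push_cast; ring
    have h5 : 0 ≤ √((k + 1 + 1 : ℕ) : ℝ) := Real.sqrt_nonneg _
    have h6 : √((k + 1 : ℕ) : ℝ) ≤ √((k + 1 + 1 : ℕ) : ℝ) := by nlinarith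
    rw [le_inv_comm₀ (by nlinarith) h3, le_inv_comm₀ h3 (by nlinarith)]
    rw [← one_div, le_div_iff₀ h3]
    nlinarith
  have h3 := h2.neg.add_const (S / 2)
  rw [neg_zero, zero_add] at h3
  refine h3.congr fun k => ?_
  rw [edgeShift]; ring

/-- The kernels of charge `c` along any edge sequence have a common limit. -/
lemma exists_edge_limit {c : ℝ} (hc : -1 < c) (S : ℝ) : ∃ K : ℂ → ℂ → ℂ, K 0 0 ≠ 0 ∧
    ∀ (n : ℕ → ℕ) (b : ℕ → ℝ) (L : ℕ → ℂ → ℂ → ℂ), EdgeSeq S n b →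
      (∀ k, IsReproducing c (n k) (b k) (L k)) →
      ∀ z w, Tendsto (fun k => L k z w) atTop (𝓝 (K z w)) := by
  have hex : ∀ (n : ℕ → ℕ) (b : ℕ → ℝ) (L : ℕ → ℂ → ℂ → ℂ), EdgeSeq S n b →
      (∀ k, IsReproducing c (n k) (b k) (L k)) →
      ∃ K : ℂ → ℂ → ℂ, K 0 0 ≠ 0 ∧ ∀ z w, Tendsto (fun k => L k z w) atTop (𝓝 (K z w)) := by
    intro n b L h hL
    obtain ⟨L₀, hL₀, hL₀0⟩ := exists_tendsto_sumKernel_shiftedMonomial h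
    have hp := fun k => isOrthonormalPolys_shiftedMonomial (b k)
    obtain ⟨K, hK⟩ := exists_kernel_limit hc h.tendsto_atTop hp hL₀ hL
    exact ⟨K, kernel_limit_ne_zero hc h.tendsto_atTop hp hL₀ hL₀0 hL hK, hK⟩
  choose p hp using fun k : ℕ => exists_isOrthonormalPolys hc (edgeShift S (k + 1))
  obtain ⟨K, hK0, hK⟩ := hex _ _ _ (edgeSeq_add_one S) fun k => (hp k).isReproducing hc (k + 1)
  refine ⟨K, hK0, fun n b L h hL z w => ?_⟩
  obtain ⟨K₁, -, hK₁⟩ := hex _ _ L h hL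
  -- The interlaced sequence also has a limit, and its even and odd terms tend to `K` and `K₁`.
  obtain ⟨K₂, -, hK₂⟩ := hex _ _ (fun m => if Even m then
      sumKernel (edgeShift S (m / 2 + 1)) (m / 2 + 1) (p (m / 2)) else L (m / 2))
    ((edgeSeq_add_one S).interlace h) fun m => by
      split_ifs
      · exact (hp _).isReproducing hc _
      · exact hL _
  have h1 : K z w = K₂ z w := tendsto_nhds_unique (hK z w)
    (((hK₂ z w).comp tendsto_two_mul).congr fun k => by simp)
  have h2 : K₁ z w = K₂ z w := tendsto_nhds_unique (hK₁ z w)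
    (((hK₂ z w).comp ((tendsto_add_atTop_nat 1).comp tendsto_two_mul)).congr fun k => by
      have h3 : ¬ Even (2 * k + 1) := by simp
      have h4 : (2 * k + 1) / 2 = k := by omega
      simp only [Function.comp_apply, h3, h4, if_false])
  rw [h1, ← h2]
  exact hK₁ z w

/-! ### Local uniformity and symmetry of the limit kernels. -/

lemma IsReproducing.exists_lipschitz {c : ℝ} (hc : -1 < c) (M : ℝ) : ∃ B : ℝ, 0 ≤ B ∧
    ∀ n b L, IsReproducing c n b L → ∀ z w z' w' : ℂ, ‖z‖ ≤ M → ‖w‖ ≤ M → ‖z'‖ ≤ M → ‖w'‖ ≤ M →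
      ‖L z w - L z' w'‖ ≤ B * (‖z - z'‖ + ‖w - w'‖) := by
  obtain ⟨A, hA, hAle⟩ := exists_energy_kernel_le hc M
  obtain ⟨B, hB0, hB⟩ := exists_lipschitz_of_energy_le c M hA
  refine ⟨B, hB0, fun n b L hL z w z' w' hz hw hz' hw' => ?_⟩
  have h1 := hB _ (hL.mem w).differentiable (hAle _ _ _ hL w hw) z z' hz hz'
  have h2 := hB _ (hL.mem z').differentiable (hAle _ _ _ hL z' hz') w w' hw hw'
  have h3 : ‖L w z' - L w' z'‖ = ‖L z' w - L z' w'‖ := by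
    rw [← hL.conj_symm z' w, ← hL.conj_symm z' w', ← map_sub, Complex.norm_conj]
  calc ‖L z w - L z' w'‖ = ‖(L z w - L z' w) + (L z' w - L z' w')‖ := by ring_nf
    _ ≤ ‖L z w - L z' w‖ + ‖L z' w - L z' w'‖ := norm_add_le _ _
    _ ≤ B * (‖z - z'‖ + ‖w - w'‖) := by rw [mul_add, ← h3]; exact add_le_add h1 h2

section Limit

variable {c : ℝ} {n : ℕ → ℕ} {b : ℕ → ℝ} {L : ℕ → ℂ → ℂ → ℂ} {K : ℂ → ℂ → ℂ}

lemma tendsto_kernel_prod (hc : -1 < c) (hL : ∀ k, IsReproducing c (n k) (b k) (L k))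
    (hK : ∀ z w, Tendsto (fun k => L k z w) atTop (𝓝 (K z w))) (q : ℂ × ℂ) :
    Tendsto (fun x : ℕ × ℂ × ℂ => L x.1 x.2.1 x.2.2) (atTop ×ˢ 𝓝 q) (𝓝 (K q.1 q.2)) := by
  obtain ⟨B, hB0, hB⟩ := IsReproducing.exists_lipschitz hc (‖q‖ + 1)
  have h1 : Tendsto (fun x : ℕ × ℂ × ℂ => L x.1 q.1 q.2) (atTop ×ˢ 𝓝 q) (𝓝 (K q.1 q.2)) :=
    (hK q.1 q.2).comp tendsto_fst
  have h2 : Tendsto (fun x : ℕ × ℂ × ℂ => B * (‖x.2.1 - q.1‖ + ‖x.2.2 - q.2‖)) (atTop ×ˢ 𝓝 q)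
      (𝓝 0) := by
    have : Tendsto (fun y : ℂ × ℂ => B * (‖y.1 - q.1‖ + ‖y.2 - q.2‖)) (𝓝 q) (𝓝 0) := by
      have h3 : Continuous fun y : ℂ × ℂ => B * (‖y.1 - q.1‖ + ‖y.2 - q.2‖) := by fun_prop
      simpa using h3.tendsto q
    exact this.comp tendsto_snd
  refine (tendsto_iff_of_dist
    (squeeze_zero' (Eventually.of_forall fun _ => dist_nonneg) ?_ h2)).2 h1
  have h3 : ∀ᶠ y : ℂ × ℂ in 𝓝 q, ‖y‖ ≤ ‖q‖ + 1 :=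
    (continuous_norm.tendsto q).eventually (eventually_le_nhds (lt_add_one _))
  filter_upwards [tendsto_snd.eventually h3] with x hx
  have hq : ‖q‖ ≤ ‖q‖ + 1 := by linarith
  rw [dist_eq_norm]
  exact hB _ _ _ (hL x.1) _ _ _ _ ((norm_fst_le _).trans hx) ((norm_snd_le _).trans hx)
    ((norm_fst_le _).trans hq) ((norm_snd_le _).trans hq)

lemma continuous_kernel_limit (hc : -1 < c) (hL : ∀ k, IsReproducing c (n k) (b k) (L k))
    (hK : ∀ z w, Tendsto (fun k => L k z w) atTop (𝓝 (K z w))) :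
    Continuous fun q : ℂ × ℂ => K q.1 q.2 := by
  rw [continuous_iff_continuousAt]
  intro q
  obtain ⟨B, hB0, hB⟩ := IsReproducing.exists_lipschitz hc (‖q‖ + 1)
  have h2 : Tendsto (fun y : ℂ × ℂ => B * (‖y.1 - q.1‖ + ‖y.2 - q.2‖)) (𝓝 q) (𝓝 0) := by
    have h3 : Continuous fun y : ℂ × ℂ => B * (‖y.1 - q.1‖ + ‖y.2 - q.2‖) := by fun_prop
    simpa using h3.tendsto q
  rw [ContinuousAt, tendsto_iff_dist_tendsto_zero]
  refine squeeze_zero' (Eventually.of_forall fun _ => dist_nonneg) ?_ h2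
  have h3 : ∀ᶠ y : ℂ × ℂ in 𝓝 q, ‖y‖ ≤ ‖q‖ + 1 :=
    (continuous_norm.tendsto q).eventually (eventually_le_nhds (lt_add_one _))
  filter_upwards [h3] with y hy
  have hq : ‖q‖ ≤ ‖q‖ + 1 := by linarith
  rw [dist_eq_norm]
  exact le_of_tendsto ((hK _ _).sub (hK _ _)).norm (Eventually.of_forall fun k =>
    hB _ _ _ (hL k) _ _ _ _ ((norm_fst_le _).trans hy) ((norm_snd_le _).trans hy)
      ((norm_fst_le _).trans hq) ((norm_snd_le _).trans hq))

lemma tendstoUniformlyOn_kernel (hc : -1 < c) (hL : ∀ k, IsReproducing c (n k) (b k) (L k))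
    (hK : ∀ z w, Tendsto (fun k => L k z w) atTop (𝓝 (K z w))) {C : Set (ℂ × ℂ)}
    (hC : IsCompact C) :
    TendstoUniformlyOn (fun k (q : ℂ × ℂ) => L k q.1 q.2) (fun q => K q.1 q.2) atTop C := by
  have h : TendstoLocallyUniformly (fun k (q : ℂ × ℂ) => L k q.1 q.2) (fun q => K q.1 q.2)
      atTop := by
    rw [tendstoLocallyUniformly_iff_forall_tendsto]
    intro q
    have h1 : Tendsto (fun x : ℕ × ℂ × ℂ => K x.2.1 x.2.2) (atTop ×ˢ 𝓝 q) (𝓝 (K q.1 q.2)) :=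
      ((continuous_kernel_limit hc hL hK).tendsto q).comp tendsto_snd
    exact (h1.prodMk_nhds (tendsto_kernel_prod hc hL hK q)).mono_right (nhds_le_uniformity _)
  exact (tendstoLocallyUniformlyOn_iff_tendstoUniformlyOn_of_compact hC).1
    h.tendstoLocallyUniformlyOn

lemma kernel_limit_conj_symm (hL : ∀ k, IsReproducing c (n k) (b k) (L k))
    (hK : ∀ z w, Tendsto (fun k => L k z w) atTop (𝓝 (K z w))) (z w : ℂ) :
    conj (K w z) = K z w :=
  tendsto_nhds_unique ((Complex.continuous_conj.tendsto _).comp (hK w z))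
    ((hK z w).congr fun k => ((hL k).conj_symm z w).symm)

lemma kernel_limit_self (hL : ∀ k, IsReproducing c (n k) (b k) (L k))
    (hK : ∀ z w, Tendsto (fun k => L k z w) atTop (𝓝 (K z w))) (z : ℂ) :
    0 ≤ (K z z).re ∧ K z z = ((K z z).re : ℂ) := by
  constructor
  · refine ge_of_tendsto ((Complex.continuous_re.tendsto _).comp (hK z z))
      (Eventually.of_forall fun k => ?_)
    rw [Function.comp_apply, (hL k).self_eq z]
    exact ENNReal.toReal_nonneg
  · exact (Complex.conj_eq_iff_re.1 (kernel_limit_conj_symm hL hK z z)).symm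

end Limit

/-! ### Inserting a unit charge at finite degree. -/

lemma IsWeightedPoly.exists_eq_mul_id {n : ℕ} {b : ℝ} {f : ℂ → ℂ} (hf : IsWeightedPoly (n + 1) b f)
    (h0 : f 0 = 0) : ∃ g, IsWeightedPoly n b g ∧ ∀ z, f z = z * g z := by
  obtain ⟨p, hp, hfp⟩ := hf
  have hroot : p.eval 0 = 0 := by simpa [hfp] using h0
  obtain ⟨q, rfl⟩ : X ∣ p := X_dvd_iff.2 (by rwa [coeff_zero_eq_eval_zero])
  refine ⟨fun z => q.eval z * Complex.exp (b * z), ⟨q, ?_, fun z => rfl⟩, fun z => ?_⟩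
  · by_cases hq : q = 0
    · simp [hq]
    · rw [degree_mul, degree_X, degree_eq_natDegree hq] at hp
      rw [degree_eq_natDegree hq]
      have h : 1 + q.natDegree < n + 1 := by exact_mod_cast hp
      exact_mod_cast (show q.natDegree < n by omega)
  · rw [hfp]; simp; ring

lemma IsWeightedPoly.mul_id {n : ℕ} {b : ℝ} {f : ℂ → ℂ} (hf : IsWeightedPoly n b f) :
    IsWeightedPoly (n + 1) b fun z => z * f z := by
  obtain ⟨p, hp, hfp⟩ := hf
  refine ⟨X * p, ?_, fun z => by simp [hfp]; ring⟩
  by_cases h : p = 0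
  · simp only [h, mul_zero, degree_zero]; exact WithBot.bot_lt_coe _
  · rw [degree_mul, degree_X, degree_eq_natDegree h]
    rw [degree_eq_natDegree h] at hp
    have h : p.natDegree < n := by exact_mod_cast hp
    exact_mod_cast (show 1 + p.natDegree < n + 1 by omega)

lemma IsWeightedPoly.sub_mul_const {n : ℕ} {b : ℝ} {f g : ℂ → ℂ} (hf : IsWeightedPoly n b f)
    (hg : IsWeightedPoly n b g) (a : ℂ) : IsWeightedPoly n b fun z => f z - g z * a := by
  obtain ⟨p, hp, hfp⟩ := hf
  obtain ⟨q, hq, hgq⟩ := hg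
  refine ⟨p - a • q, ?_, fun z => by simp [hfp, hgq]; ring⟩
  exact mem_degreeLT.1 (Submodule.sub_mem _ (mem_degreeLT.2 hp)
    (Submodule.smul_mem _ _ (mem_degreeLT.2 hq)))

/-- Inserting a unit charge at the origin: the kernel of charge `c + 1` in terms of that of
charge `c` and one degree more. -/
lemma IsReproducing.mul_conj_mul_eq {c : ℝ} (hc : -1 < c) {n : ℕ} {b : ℝ} {L L' : ℂ → ℂ → ℂ}
    (hL : IsReproducing c (n + 1) b L) (hL' : IsReproducing (c + 1) n b L') (h0 : L 0 0 ≠ 0)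
    (z w : ℂ) : z * conj w * L' z w = L z w - L z 0 * (L 0 w / L 0 0) := by
  -- `G` is the kernel of the subspace vanishing at `0`. Dividing by `z` gives `H`, which represents
  -- `f ↦ w f(w)` at charge `c + 1`, so `H = w̄ L'(·,w)`.
  have hG := (hL.mem w).sub_mul_const (hL.mem 0) (L 0 w / L 0 0)
  obtain ⟨H, hH, hGH⟩ := hG.exists_eq_mul_id (by field_simp; ring)
  have hpair : ∀ f, IsWeightedPoly n b f →
      ∫ ζ, f ζ * conj (H ζ) ∂fockMeasure (c + 1) = w * f w := by
    intro f hf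
    have hint : ∀ v, Integrable (fun ζ => (ζ * f ζ) * conj (L ζ v)) (fockMeasure c) := fun v =>
      integrable_mul_conj hf.mul_id.differentiable.continuous.aemeasurable
        (hL.mem v).differentiable.continuous.aemeasurable (hf.mul_id.energy_ne_top hc)
        ((hL.mem v).energy_ne_top hc)
    rw [integral_fockMeasure_add_one]
    simp_rw [← hGH]
    have e : ∀ ζ, ζ * f ζ * conj (L ζ w - L ζ 0 * (L 0 w / L 0 0)) =
        (ζ * f ζ) * conj (L ζ w) - conj (L 0 w / L 0 0) * ((ζ * f ζ) * conj (L ζ 0)) := fun ζ => by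
      rw [map_sub, map_mul]; ring
    simp_rw [e]
    rw [integral_sub (hint w) ((hint 0).const_mul _), integral_const_mul,
      hL.eval _ hf.mul_id w, hL.eval _ hf.mul_id 0]
    ring
  have h1 : conj (w * L' w z) = H z := by
    rw [← hpair _ (hL'.mem z), ← integral_conj, ← hL'.eval H hH z]
    refine integral_congr_ae (Eventually.of_forall fun ζ => ?_)
    simp [mul_comm]
  rw [hGH z, ← h1, map_mul, hL'.conj_symm z w]
  ring

/-! ### Rescaling by `√N` and the cocycle. -/

/-- The polynomial `s^{-(c+1)} p(z / s)`. -/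
def rescale (c s : ℝ) (p : ℂ[X]) : ℂ[X] :=
  C ((s ^ (-(c + 1)) : ℝ) : ℂ) * p.comp (C ((s⁻¹ : ℝ) : ℂ) * X)

lemma eval_rescale (c s : ℝ) (p : ℂ[X]) (z : ℂ) :
    (rescale c s p).eval z = ((s ^ (-(c + 1)) : ℝ) : ℂ) * p.eval (z / (s : ℂ)) := by
  simp only [rescale, eval_mul, eval_C, eval_comp, eval_X, Complex.ofReal_inv]
  rw [div_eq_inv_mul]

lemma rescale_rescale_inv (c : ℝ) {s : ℝ} (hs : 0 < s) (p : ℂ[X]) :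
    rescale c s (rescale c s⁻¹ p) = p := by
  refine Polynomial.funext fun z => ?_
  have hs0 : (s : ℂ) ≠ 0 := by exact_mod_cast hs.ne'
  have h : s ^ (-(c + 1)) * s⁻¹ ^ (-(c + 1)) = 1 := by
    rw [← Real.mul_rpow hs.le (inv_pos.2 hs).le, mul_inv_cancel₀ hs.ne', Real.one_rpow]
  rw [eval_rescale, eval_rescale, ← mul_assoc, ← Complex.ofReal_mul, h, Complex.ofReal_one,
    one_mul, Complex.ofReal_inv, div_inv_eq_mul, div_mul_cancel₀ _ hs0]

lemma degree_rescale (c : ℝ) {s : ℝ} (hs : 0 < s) (p : ℂ[X]) :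
    (rescale c s p).degree = p.degree := by
  have hs0 : ((s⁻¹ : ℝ) : ℂ) ≠ 0 := by exact_mod_cast (inv_pos.2 hs).ne'
  have hc0 : ((s ^ (-(c + 1)) : ℝ) : ℂ) ≠ 0 := by
    exact_mod_cast (Real.rpow_pos_of_pos hs _).ne'
  rw [rescale, degree_C_mul hc0, degree_comp (by rw [degree_C_mul_X hs0]; exact one_pos),
    degree_C_mul_X hs0, mul_one]

lemma integral_rescale (c a : ℝ) {N : ℕ} (hN : 1 ≤ N) (p q : ℂ[X]) :
    ∫ z, (rescale c (√N) p).eval z * conj ((rescale c (√N) q).eval z) *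
        ((‖z‖ ^ (2 * c) * Real.exp (-((1 : ℕ) : ℝ) * Q (√N * a) z) : ℝ) : ℂ) ∂areaMeasure =
      ∫ ζ, p.eval ζ * conj (q.eval ζ) *
        ((‖ζ‖ ^ (2 * c) * Real.exp (-(N : ℝ) * Q a ζ) : ℝ) : ℂ) ∂areaMeasure := by
  have hN0 : (0 : ℝ) < N := by exact_mod_cast hN
  set s : ℝ := √N with hs
  have hs0 : 0 < s := Real.sqrt_pos.2 hN0
  have hsC : (s : ℂ) ≠ 0 := by exact_mod_cast hs0.ne'
  have hss : (N : ℝ) = s ^ 2 := (Real.sq_sqrt hN0.le).symm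
  set f : ℂ → ℂ := fun ζ => p.eval ζ * conj (q.eval ζ) *
        ((‖ζ‖ ^ (2 * c) * Real.exp (-(N : ℝ) * Q a ζ) : ℝ) : ℂ) with hf
  have h : ∀ z : ℂ, (rescale c s p).eval z * conj ((rescale c s q).eval z) *
      ((‖z‖ ^ (2 * c) * Real.exp (-((1 : ℕ) : ℝ) * Q (s * a) z) : ℝ) : ℂ) =
      ((s ^ 2)⁻¹ : ℝ) * f (s⁻¹ • z) := fun z => by
    have h1 : z / s = s⁻¹ • z := by rw [Complex.real_smul, div_eq_inv_mul, Complex.ofReal_inv]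
    have h2 : (N : ℝ) * Q a (s⁻¹ • z) = Q (s * a) z := by
      rw [hss, Q, Q, ← mul_pow]
      congr 1
      rw [← h1]
      nth_rw 1 [← Real.norm_of_nonneg hs0.le]
      rw [← Complex.norm_real, ← norm_mul]
      congr 1
      push_cast
      field_simp
    have h3 : s ^ (-(c + 1)) * s ^ (-(c + 1)) * ‖z‖ ^ (2 * c) =
        (s ^ 2)⁻¹ * ‖s⁻¹ • z‖ ^ (2 * c) := by
      rw [norm_smul, Real.norm_of_nonneg (inv_pos.2 hs0).le,
        Real.mul_rpow (inv_pos.2 hs0).le (norm_nonneg _), Real.inv_rpow hs0.le, ← mul_assoc,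
        ← Real.rpow_natCast s 2, ← Real.rpow_neg hs0.le, ← Real.rpow_neg hs0.le,
        ← Real.rpow_add hs0, ← Real.rpow_add hs0]
      congr 2
      push_cast
      ring
    rw [eval_rescale, eval_rescale, h1]
    simp only [hf, map_mul, Complex.conj_ofReal]
    rw [Nat.cast_one, neg_one_mul, neg_mul, h2, Complex.ofReal_mul, Complex.ofReal_mul]
    have h3' := congrArg (fun x : ℝ => (x : ℂ)) h3
    simp only [Complex.ofReal_mul] at h3'
    linear_combination (p.eval (s⁻¹ • z) * conj (q.eval (s⁻¹ • z)) *
      ((Real.exp (-Q (s * a) z) : ℝ) : ℂ)) * h3'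
  change _ = ∫ ζ, f ζ ∂areaMeasure
  simp_rw [h]
  rw [integral_const_mul, integral_areaMeasure, integral_areaMeasure,
    Measure.integral_comp_smul volume f s⁻¹, Complex.finrank_real_complex, Complex.real_smul]
  have h4 : |(s⁻¹ ^ 2)⁻¹| = s ^ 2 := by
    rw [inv_pow, inv_inv, abs_of_nonneg (by positivity)]
  rw [h4]
  push_cast
  field_simp

lemma IsOrthonormalPolys.rescale {c a : ℝ} {N : ℕ} (hN : 1 ≤ N) {p : ℕ → ℂ[X]}
    (hp : IsOrthonormalPolys c a N p) :
    IsOrthonormalPolys c (√N * a) 1 fun j => rescale c (√N) (p j) := by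
  have hs0 : 0 < √(N : ℝ) := Real.sqrt_pos.2 (by exact_mod_cast hN)
  exact ⟨fun j => by rw [degree_rescale c hs0, hp.1 j],
    fun j k => by rw [integral_rescale c a hN, hp.2 j k]⟩

lemma exists_isOrthonormalPolys_nat {c : ℝ} (hc : -1 < c) (a : ℝ) {N : ℕ} (hN : 1 ≤ N) :
    ∃ p, IsOrthonormalPolys c a N p := by
  have hs0 : 0 < √(N : ℝ) := Real.sqrt_pos.2 (by exact_mod_cast hN)
  obtain ⟨p, hp⟩ := exists_isOrthonormalPolys hc (√N * a)
  refine ⟨fun j => EdgeRecursion.rescale c (√N)⁻¹ (p j), fun j => ?_, fun j k => ?_⟩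
  · rw [degree_rescale c (inv_pos.2 hs0), hp.1 j]
  · rw [← integral_rescale c a hN]
    simp_rw [rescale_rescale_inv c hs0]
    exact hp.2 j k

lemma div_ofReal_cpow (c : ℝ) {s : ℝ} (hs : 0 < s) (z : ℂ) :
    (z / (s : ℂ)) ^ (c : ℂ) = z ^ (c : ℂ) * ((s ^ (-c) : ℝ) : ℂ) := by
  have hsC : (s : ℂ) ≠ 0 := by exact_mod_cast hs.ne'
  by_cases hz : z = 0
  · subst hz
    by_cases hc : c = 0
    · simp [hc]
    · have : (c : ℂ) ≠ 0 := by exact_mod_cast hc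
      simp [Complex.zero_cpow this]
  · have h1 : z / (s : ℂ) = ((s⁻¹ : ℝ) : ℂ) * z := by
      rw [div_eq_inv_mul, Complex.ofReal_inv]
    rw [Complex.ofReal_cpow hs.le, Complex.cpow_def_of_ne_zero (div_ne_zero hz hsC),
      Complex.cpow_def_of_ne_zero hz, Complex.cpow_def_of_ne_zero hsC, h1,
      Complex.log_ofReal_mul (inv_pos.2 hs) hz, ← Complex.exp_add, ← Complex.ofReal_log hs.le,
      Real.log_inv]
    congr 1
    push_cast
    ring

/-- The factor `z^c conj (w^c) e^{-(|z|² + |w|²)/2}` of the kernels of charge `c`. -/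
def prefactor (c : ℝ) (z w : ℂ) : ℂ :=
  z ^ (c : ℂ) * conj (w ^ (c : ℂ)) * ((Real.exp (-(‖z‖ ^ 2 + ‖w‖ ^ 2) / 2) : ℝ) : ℂ)

/-- The unimodular factor `e^{ib Im z}`. -/
def phase (b : ℝ) (z : ℂ) : ℂ := Complex.exp (((b * z.im : ℝ) : ℂ) * Complex.I)

lemma norm_phase (b : ℝ) (z : ℂ) : ‖phase b z‖ = 1 := Complex.norm_exp_ofReal_mul_I _

/-- The modulus of `e^{bz-b²/2}` is `e^{b Re z - b²/2}` and its argument is `b Im z`; the phase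
restores the argument lost in the real weight. -/
lemma phase_mul_exp (b : ℝ) (z : ℂ) :
    phase b z * ((Real.exp (-(1 / 2) * Q b z) : ℝ) : ℂ) =
      ((Real.exp (-‖z‖ ^ 2 / 2) : ℝ) : ℂ) * Complex.exp (b * z - b ^ 2 / 2) := by
  have h : Q b z = ‖z‖ ^ 2 - 2 * (b * z.re) + b ^ 2 := by
    rw [Q, Complex.sq_norm, Complex.sq_norm, Complex.normSq_apply, Complex.normSq_apply]
    simp
    ring
  rw [phase, h, Complex.ofReal_exp, Complex.ofReal_exp, ← Complex.exp_add, ← Complex.exp_add]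
  congr 1
  push_cast
  linear_combination (b : ℂ) * Complex.re_add_im z

lemma phase_mul_rescaledKernel (c a : ℝ) {N : ℕ} (hN : 1 ≤ N) (p : ℕ → ℂ[X]) (z w : ℂ) :
    phase (√N * a) z * conj (phase (√N * a) w) * rescaledKernel c a N p z w =
      prefactor c z w * sumKernel (√N * a) N (fun j => rescale c (√N) (p j)) z w := by
  have hN0 : (0 : ℝ) < N := by exact_mod_cast hN
  set s : ℝ := √N with hs
  have hs0 : 0 < s := Real.sqrt_pos.2 hN0
  have hsC : (s : ℂ) ≠ 0 := by exact_mod_cast hs0.ne'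
  have hss : (N : ℝ) = s ^ 2 := (Real.sq_sqrt hN0.le).symm
  have hQ : ∀ z : ℂ, (N : ℝ) * Q a (z / s) = Q (s * a) z := fun z => by
    rw [hss, Q, Q, ← mul_pow]
    congr 1
    nth_rw 1 [← Real.norm_of_nonneg hs0.le]
    rw [← Complex.norm_real, ← norm_mul]
    congr 1
    push_cast
    field_simp
  have hexp : Real.exp (-((N : ℝ) / 2) * (Q a (z / s) + Q a (w / s))) =
      Real.exp (-(1 / 2) * Q (s * a) z) * Real.exp (-(1 / 2) * Q (s * a) w) := by
    rw [← Real.exp_add, ← hQ, ← hQ]; congr 1; ring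
  have hexp2 : Real.exp (-(‖z‖ ^ 2 + ‖w‖ ^ 2) / 2) =
      Real.exp (-‖z‖ ^ 2 / 2) * Real.exp (-‖w‖ ^ 2 / 2) := by
    rw [← Real.exp_add]; congr 1; ring
  have hz := phase_mul_exp (s * a) z
  have hw := congrArg conj (phase_mul_exp (s * a) w)
  simp only [map_mul, Complex.conj_ofReal] at hw
  have hpow : (s ^ (-(c + 1)) : ℝ) * (s ^ (-(c + 1)) : ℝ) =
      (1 / (N : ℝ)) * (s ^ (-c) * s ^ (-c)) := by
    rw [hss, one_div, ← Real.rpow_natCast s 2, ← Real.rpow_neg hs0.le, ← Real.rpow_add hs0,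
      ← Real.rpow_add hs0, ← Real.rpow_add hs0]
    congr 1
    push_cast
    ring
  have hpow' := congrArg (fun x : ℝ => (x : ℂ)) hpow
  simp only [Complex.ofReal_mul, Complex.ofReal_div, Complex.ofReal_one,
    Complex.ofReal_natCast] at hpow'
  rw [rescaledKernel, kernel, ← hs, div_ofReal_cpow c hs0, div_ofReal_cpow c hs0, hexp, prefactor,
    hexp2, sumKernel]
  have hsum : ∑ j ∈ Finset.range N, expPoly (s * a) (rescale c s (p j)) z *
      conj (expPoly (s * a) (rescale c s (p j)) w) =
      ((1 / (N : ℂ)) * (((s ^ (-c) : ℝ) : ℂ) * ((s ^ (-c) : ℝ) : ℂ))) *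
      (Complex.exp ((s * a : ℝ) * z - (s * a : ℝ) ^ 2 / 2) *
        conj (Complex.exp ((s * a : ℝ) * w - (s * a : ℝ) ^ 2 / 2))) *
      ∑ j ∈ Finset.range N, (p j).eval (z / s) * conj ((p j).eval (w / s)) := by
    rw [Finset.mul_sum]
    refine Finset.sum_congr rfl fun j _ => ?_
    rw [← hpow']
    simp only [expPoly, eval_rescale, map_mul, Complex.conj_ofReal]
    ring
  rw [hsum]
  simp only [Complex.ofReal_mul, map_mul, Complex.conj_ofReal] at hz hw ⊢
  set T := ∑ j ∈ Finset.range N, (p j).eval (z / s) * conj ((p j).eval (w / s))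
  set E₁ := Complex.exp (s * a * z - (s * a) ^ 2 / 2)
  set E₂ := conj (Complex.exp (s * a * w - (s * a) ^ 2 / 2))
  linear_combination (1 / (N : ℂ)) * z ^ (c : ℂ) * conj (w ^ (c : ℂ)) * ((s ^ (-c) : ℝ) : ℂ) *
    ((s ^ (-c) : ℝ) : ℂ) * T * (conj (phase (s * a) w) *
      ((Real.exp (-(1 / 2) * Q (s * a) w) : ℝ) : ℂ) * hz +
      ((Real.exp (-‖z‖ ^ 2 / 2) : ℝ) : ℂ) * E₁ * hw)

lemma sqrt_mul_critA (S : ℝ) {N : ℕ} (hN : 1 ≤ N) : √N * critA S N = edgeShift S N := by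
  have hs0 : 0 < √(N : ℝ) := Real.sqrt_pos.2 (by exact_mod_cast hN)
  rw [critA, edgeShift]
  field_simp

lemma IsOrthonormalPolys.isReproducing_rescale {S c : ℝ} (hc : -1 < c) {N : ℕ} (hN : 1 ≤ N)
    {p : ℕ → ℂ[X]} (hp : IsOrthonormalPolys c (critA S N) N p) :
    IsReproducing c N (edgeShift S N)
      (sumKernel (√N * critA S N) N fun j => EdgeRecursion.rescale c (√N) (p j)) := by
  have := (hp.rescale hN).isReproducing hc N
  rw [sqrt_mul_critA S hN] at this ⊢
  exact this

/-! ### Limiting edge kernels and the recursion. -/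

/-- `K` is the limit of the reproducing kernels of charge `c` along every edge sequence. -/
def IsEdgeLimit (S c : ℝ) (K : ℂ → ℂ → ℂ) : Prop :=
  ∀ (n : ℕ → ℕ) (b : ℕ → ℝ) (L : ℕ → ℂ → ℂ → ℂ), EdgeSeq S n b →
    (∀ k, IsReproducing c (n k) (b k) (L k)) →
    ∀ z w, Tendsto (fun k => L k z w) atTop (𝓝 (K z w))

lemma norm_prefactor (c : ℝ) (z w : ℂ) : ‖prefactor c z w‖ =
    ‖z‖ ^ c * ‖w‖ ^ c * Real.exp (-(‖z‖ ^ 2 + ‖w‖ ^ 2) / 2) := by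
  rw [prefactor, norm_mul, norm_mul, Complex.norm_conj, Complex.norm_cpow_real,
    Complex.norm_cpow_real, Complex.norm_real, Real.norm_of_nonneg (Real.exp_pos _).le]

lemma prefactor_self (c : ℝ) (z : ℂ) : prefactor c z z =
    (((‖z‖ ^ c) ^ 2 * Real.exp (-‖z‖ ^ 2) : ℝ) : ℂ) := by
  rw [prefactor, Complex.mul_conj', Complex.norm_cpow_real]
  have : -(‖z‖ ^ 2 + ‖z‖ ^ 2) / 2 = -‖z‖ ^ 2 := by ring
  rw [this]
  push_cast
  rfl

lemma exists_norm_prefactor_le {c : ℝ} {C : Set (ℂ × ℂ)} (hC : IsCompact C)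
    (hCc : C ⊆ finiteDomain c ×ˢ finiteDomain c) : ∃ B : ℝ, ∀ q ∈ C, ‖prefactor c q.1 q.2‖ ≤ B := by
  have h : ContinuousOn (fun q : ℂ × ℂ => ‖prefactor c q.1 q.2‖) C := by
    simp_rw [norm_prefactor]
    refine ((ContinuousOn.rpow_const (by fun_prop) fun q hq => ?_).mul
      (ContinuousOn.rpow_const (by fun_prop) fun q hq => ?_)).mul (by fun_prop)
    · exact (hCc hq).1.imp_left norm_ne_zero_iff.2
    · exact (hCc hq).2.imp_left norm_ne_zero_iff.2
  obtain ⟨B, hB⟩ := (hC.image_of_continuousOn h).bddAbove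
  exact ⟨B, fun q hq => hB ⟨q, hq, rfl⟩⟩

lemma isEdgeKernel_of_isEdgeLimit {S c : ℝ} (hc : -1 < c) {K : ℂ → ℂ → ℂ}
    (hK : IsEdgeLimit S c K) : IsEdgeKernel S c fun z w => prefactor c z w * K z w := by
  have hex : ∀ N : ℕ, ∃ p, 1 ≤ N → IsOrthonormalPolys c (critA S N) N p := fun N => by
    by_cases hN : 1 ≤ N
    · obtain ⟨p, hp⟩ := exists_isOrthonormalPolys_nat hc (critA S N) hN
      exact ⟨p, fun _ => hp⟩
    · exact ⟨0, fun h => absurd h hN⟩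
  choose p hp using hex
  refine ⟨p, hp, fun N => phase (√N * critA S N), fun N z => norm_phase _ z, fun C hC hCc => ?_⟩
  obtain ⟨B, hB⟩ := exists_norm_prefactor_le hC hCc
  -- The index starts at `N = k + 1`, since nothing is known about the polynomials for `N = 0`.
  set L : ℕ → ℂ → ℂ → ℂ := fun k => sumKernel (√(k + 1 : ℕ) * critA S (k + 1)) (k + 1)
    fun j => rescale c (√(k + 1 : ℕ)) (p (k + 1) j)
  have hL : ∀ k, IsReproducing c (k + 1) (edgeShift S (k + 1)) (L k) := fun k =>
    (hp (k + 1) k.succ_pos).isReproducing_rescale hc k.succ_pos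
  have hunif := tendstoUniformlyOn_kernel hc hL (hK _ _ _ (edgeSeq_add_one S) hL) hC
  rw [Metric.tendstoUniformlyOn_iff] at hunif ⊢
  intro ε hε
  have hB1 : 0 < |B| + 1 := by positivity
  obtain ⟨k₀, hk₀⟩ := eventually_atTop.1 (hunif (ε / (|B| + 1)) (by positivity))
  filter_upwards [eventually_ge_atTop (k₀ + 1)] with N hN q hq
  obtain ⟨k, rfl⟩ : ∃ k, N = k + 1 := ⟨N - 1, by omega⟩
  have h := hk₀ k (by omega) q hq
  rw [phase_mul_rescaledKernel c _ k.succ_pos, dist_eq_norm, ← mul_sub, norm_mul]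
  rw [dist_eq_norm] at h
  calc ‖prefactor c q.1 q.2‖ * ‖K q.1 q.2 - L k q.1 q.2‖
      ≤ |B| * ‖K q.1 q.2 - L k q.1 q.2‖ := by
        gcongr; exact (hB q hq).trans (le_abs_self B)
    _ ≤ (|B| + 1) * ‖K q.1 q.2 - L k q.1 q.2‖ := by gcongr; linarith
    _ < (|B| + 1) * (ε / (|B| + 1)) := by gcongr
    _ = ε := by field_simp

/-- Any limiting edge kernel is determined up to phases. -/
lemma IsEdgeKernel.eq_of_isEdgeLimit {S c : ℝ} (hc : -1 < c) {K K₀ : ℂ → ℂ → ℂ}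
    (hK : IsEdgeKernel S c K) (hK₀ : IsEdgeLimit S c K₀) :
    (∀ z ∈ finiteDomain c, ∀ w ∈ finiteDomain c, ‖K z w‖ = ‖prefactor c z w‖ * ‖K₀ z w‖) ∧
      ∀ z ∈ finiteDomain c, K z z = prefactor c z z * K₀ z z := by
  obtain ⟨p, hp, g, hg, hlim⟩ := hK
  set L : ℕ → ℂ → ℂ → ℂ := fun k => sumKernel (√(k + 1 : ℕ) * critA S (k + 1)) (k + 1)
    fun j => rescale c (√(k + 1 : ℕ)) (p (k + 1) j)
  have hL : ∀ k, IsReproducing c (k + 1) (edgeShift S (k + 1)) (L k) := fun k =>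
    (hp (k + 1) k.succ_pos).isReproducing_rescale hc k.succ_pos
  have hL₀ : ∀ z w, Tendsto (fun k => prefactor c z w * L k z w) atTop
      (𝓝 (prefactor c z w * K₀ z w)) := fun z w =>
    (hK₀ _ _ _ (edgeSeq_add_one S) hL z w).const_mul _
  have hpt : ∀ z ∈ finiteDomain c, ∀ w ∈ finiteDomain c, Tendsto (fun k : ℕ =>
      g (k + 1) z * conj (g (k + 1) w) * rescaledKernel c (critA S (k + 1 : ℕ)) (k + 1)
        (p (k + 1)) z w) atTop (𝓝 (K z w)) := fun z hz w hw => by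
    have := hlim {(z, w)} isCompact_singleton (by simpa using ⟨hz, hw⟩)
    exact (this.tendsto_at (Set.mem_singleton _)).comp (tendsto_add_atTop_nat 1)
  have hker := fun (k : ℕ) z w =>
    phase_mul_rescaledKernel c (critA S (k + 1 : ℕ)) k.succ_pos (p (k + 1)) z w
  refine ⟨fun z hz w hw => ?_, fun z hz => ?_⟩
  · rw [← norm_mul]
    refine tendsto_nhds_unique (hpt z hz w hw).norm ((hL₀ z w).norm.congr fun k => ?_)
    rw [← hker k z w]
    simp only [norm_mul, Complex.norm_conj, norm_phase, hg]
  · have hone : ∀ u : ℂ, ‖u‖ = 1 → u * conj u = 1 := fun u hu => by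
      rw [Complex.mul_conj', hu]; simp
    refine tendsto_nhds_unique (hpt z hz z hz) ((hL₀ z z).congr fun k => ?_)
    rw [← hker k z z, hone _ (hg _ _), hone _ (norm_phase _ _)]

lemma mem_finiteDomain_of_nonneg {c : ℝ} (hc : 0 ≤ c) (z : ℂ) : z ∈ finiteDomain c := Or.inr hc

/-- The recursion for the limits of the reproducing kernels. -/
lemma IsEdgeLimit.mul_conj_mul_eq {S c : ℝ} (hc : -1 < c) {K K' : ℂ → ℂ → ℂ}
    (hK : IsEdgeLimit S c K) (hK' : IsEdgeLimit S (c + 1) K') (h0 : K 0 0 ≠ 0) (z w : ℂ) :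
    z * conj w * K' z w = K z w - K z 0 * (K 0 w / K 0 0) := by
  choose p hp using fun k : ℕ => exists_isOrthonormalPolys hc (edgeShift S (k + 1))
  choose p' hp' using fun k : ℕ =>
    exists_isOrthonormalPolys (show -1 < c + 1 by linarith) (edgeShift S (k + 1))
  -- Charge `c` takes degree `k + 2` and charge `c + 1` degree `k + 1`, with the same shift. Both
  -- are edge sequences for `S`.
  have hL := fun k => (hp k).isReproducing hc (k + 1 + 1)
  have hL' := fun k => (hp' k).isReproducing (show -1 < c + 1 by linarith) (k + 1)
  have h := hK _ _ _ (edgeSeq_add_two S) hL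
  have h' := hK' _ _ _ (edgeSeq_add_one S) hL'
  refine tendsto_nhds_unique ((h' z w).const_mul _)
    (((h z w).sub ((h z 0).mul ((h 0 w).div (h 0 0) h0))).congr' ?_)
  filter_upwards [(h 0 0).eventually_ne h0] with k hk
  exact ((hL k).mul_conj_mul_eq hc (hL' k) hk z w).symm

lemma IsEdgeLimit.exists_seq {S c : ℝ} (hc : -1 < c) {K : ℂ → ℂ → ℂ} (hK : IsEdgeLimit S c K) :
    ∃ (n : ℕ → ℕ) (b : ℕ → ℝ) (L : ℕ → ℂ → ℂ → ℂ), (∀ k, IsReproducing c (n k) (b k) (L k)) ∧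
      ∀ z w, Tendsto (fun k => L k z w) atTop (𝓝 (K z w)) := by
  choose p hp using fun k : ℕ => exists_isOrthonormalPolys hc (edgeShift S (k + 1))
  have hL := fun k => (hp k).isReproducing hc (k + 1)
  exact ⟨_, _, _, hL, hK _ _ _ (edgeSeq_add_one S) hL⟩

/-- The limiting kernels are known only up to phases, which affect neither moduli nor diagonals. The
recursion for `K₀` and `K₁` on the diagonal, multiplied by `|z|^{2c} e^{-|z|²}`, is the claim. -/
lemma edge_recursion {S c : ℝ} (hc : -1 < c) {K K' : ℂ → ℂ → ℂ} (hK : IsEdgeKernel S c K)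
    (hK' : IsEdgeKernel S (c + 1) K') :
    (∀ᶠ w in 𝓝[≠] (0 : ℂ), 0 < onePoint K w) ∧
    (∀ z ∈ finiteDomain c, ∃ B : ℝ,
      Tendsto (fun w : ℂ => ‖K w z‖ ^ 2 / onePoint K w) (𝓝[≠] (0 : ℂ)) (𝓝 B) ∧
      onePoint K' z = onePoint K z - B) ∧
    (c = 0 → 0 < onePoint K 0 ∧
      ∀ z : ℂ, onePoint K' z = onePoint K z - ‖K 0 z‖ ^ 2 / onePoint K 0) := by
  have hc' : -1 < c + 1 := by linarith
  obtain ⟨K₀, h00, hK₀⟩ := exists_edge_limit hc S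
  obtain ⟨K₁, -, hK₁⟩ := exists_edge_limit hc' S
  obtain ⟨hnorm, hdiag⟩ := hK.eq_of_isEdgeLimit hc hK₀
  obtain ⟨-, hdiag'⟩ := hK'.eq_of_isEdgeLimit hc' hK₁
  obtain ⟨n, b, L, hL, hlim⟩ := IsEdgeLimit.exists_seq hc hK₀
  have hcont := continuous_kernel_limit hc hL hlim
  have hself := kernel_limit_self hL hlim
  have hsymm := kernel_limit_conj_symm hL hlim
  have hrec := IsEdgeLimit.mul_conj_mul_eq hc hK₀ hK₁ h00
  have hpos : 0 < (K₀ 0 0).re := by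
    refine lt_of_le_of_ne (hself 0).1 fun h => h00 ?_
    rw [(hself 0).2, ← h, Complex.ofReal_zero]
  have hone : ∀ z ∈ finiteDomain c,
      onePoint K z = (‖z‖ ^ c) ^ 2 * Real.exp (-‖z‖ ^ 2) * (K₀ z z).re := fun z hz => by
    rw [onePoint, hdiag z hz, prefactor_self, Complex.re_ofReal_mul]
  have hne : ∀ w : ℂ, w ≠ 0 → w ∈ finiteDomain c := fun w hw => Or.inl hw
  have hdiagcont : Continuous fun w : ℂ => (K₀ w w).re :=
    Complex.continuous_re.comp (hcont.comp (continuous_id.prodMk continuous_id))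
  have hposev : ∀ᶠ w in 𝓝[≠] (0 : ℂ), w ≠ 0 ∧ 0 < (K₀ w w).re :=
    (eventually_mem_nhdsWithin (a := (0 : ℂ)) (s := {0}ᶜ)).and
      (((hdiagcont.tendsto 0).eventually (lt_mem_nhds hpos)).filter_mono
      nhdsWithin_le_nhds)
  have hsq : ∀ z ∈ finiteDomain c, ∀ w ∈ finiteDomain c, ‖K w z‖ ^ 2 =
      ((‖w‖ ^ c) ^ 2 * Real.exp (-‖w‖ ^ 2)) *
        ((‖z‖ ^ c) ^ 2 * Real.exp (-‖z‖ ^ 2) * ‖K₀ w z‖ ^ 2) := fun z hz w hw => by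
    have e : Real.exp (-(‖w‖ ^ 2 + ‖z‖ ^ 2) / 2) ^ 2 =
        Real.exp (-‖w‖ ^ 2) * Real.exp (-‖z‖ ^ 2) := by
      rw [← Real.exp_nat_mul, ← Real.exp_add]; congr 1; push_cast; ring
    rw [hnorm w hw z hz, norm_prefactor, mul_pow, mul_pow, mul_pow, e]
    ring
  -- The limit of the quotient: the factors in `w` cancel for `w ≠ 0`, and what remains is
  -- continuous at `w = 0` because `K₀ 0 0` is nonzero.
  set B : ℂ → ℝ := fun z =>
    (‖z‖ ^ c) ^ 2 * Real.exp (-‖z‖ ^ 2) * ‖K₀ 0 z‖ ^ 2 / (K₀ 0 0).re with hB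
  have hone' : ∀ z ∈ finiteDomain c, onePoint K' z = onePoint K z - B z := fun z hz => by
    have h1 : ‖z‖ ^ (c + 1) = ‖z‖ ^ c * ‖z‖ := by
      by_cases hz0 : z = 0
      · rw [hz0, norm_zero, Real.zero_rpow (by linarith), mul_zero]
      · exact Real.rpow_add_one (norm_ne_zero_iff.2 hz0) c
    have h2 : ‖z‖ ^ 2 * (K₁ z z).re = (K₀ z z).re - ‖K₀ 0 z‖ ^ 2 / (K₀ 0 0).re := by
      have h3 := hrec z z
      rw [Complex.mul_conj', mul_div_assoc', ← hsymm z 0, mul_comm (conj _), Complex.mul_conj',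
        (hself 0).2, ← Complex.ofReal_pow, ← Complex.ofReal_pow, ← Complex.ofReal_div] at h3
      have h4 := congrArg Complex.re h3
      rwa [Complex.re_ofReal_mul, Complex.sub_re, Complex.ofReal_re] at h4
    rw [hone z hz, onePoint, hdiag' z (mem_finiteDomain_of_nonneg (by linarith) z),
      prefactor_self, Complex.re_ofReal_mul, h1, hB]
    linear_combination ((‖z‖ ^ c) ^ 2 * Real.exp (-‖z‖ ^ 2)) * h2
  refine ⟨?_, fun z hz => ⟨B z, ?_, hone' z hz⟩, fun hc0 => ⟨?_, fun z => ?_⟩⟩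
  · filter_upwards [hposev] with w hw
    rw [hone w (hne w hw.1)]
    have := Real.rpow_pos_of_pos (norm_pos_iff.2 hw.1) c
    have := hw.2
    positivity
  · have hcz : Continuous fun w : ℂ => ‖K₀ w z‖ ^ 2 :=
      (hcont.comp (continuous_id.prodMk continuous_const)).norm.pow 2
    have hquot : Tendsto (fun w : ℂ => (‖z‖ ^ c) ^ 2 * Real.exp (-‖z‖ ^ 2) * ‖K₀ w z‖ ^ 2 /
        (K₀ w w).re) (𝓝[≠] (0 : ℂ)) (𝓝 (B z)) :=
      ((((hcz.tendsto 0).const_mul _).div (hdiagcont.tendsto 0) hpos.ne')).mono_left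
        nhdsWithin_le_nhds
    refine hquot.congr' ?_
    filter_upwards [hposev] with w hw
    have h1 := Real.rpow_pos_of_pos (norm_pos_iff.2 hw.1) c
    rw [hsq z hz w (hne w hw.1), hone w (hne w hw.1), mul_div_mul_left]
    positivity
  · rw [hone 0 (mem_finiteDomain_of_nonneg hc0.ge 0), hc0]
    simpa using hpos
  · have hmem := mem_finiteDomain_of_nonneg hc0.ge
    rw [hone' z (hmem z), hsq z (hmem z) 0 (hmem 0), hone 0 (hmem 0), mul_div_mul_left]
    rw [hc0]
    simp

end EdgeRecursion

end

/-- For all real `S` and `c > -1` the limiting edge kernel exists, and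
`R^{c+1}(z) = R^c(z) - |K^c(0,z)|² / R^c(0)`. The quotient is the value at `w = 0` of
`|K^c(w,z)|² / R^c(w)`, that is its limit as `w → 0` (for `c ≠ 0` numerator and denominator carry
the common factor `|w|^{2c}`); for `c = 0` it is also the literal quotient. -/
theorem proposition1p2 (S c : ℝ) (hc : -1 < c) :
    (∃ K, EdgeRecursion.IsEdgeKernel S c K) ∧
    ∀ K K' : ℂ → ℂ → ℂ,
      EdgeRecursion.IsEdgeKernel S c K → EdgeRecursion.IsEdgeKernel S (c + 1) K' →
      (∀ᶠ w in 𝓝[≠] (0 : ℂ), 0 < EdgeRecursion.onePoint K w) ∧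
      (∀ z ∈ EdgeRecursion.finiteDomain c, ∃ B : ℝ,
        Tendsto (fun w : ℂ => ‖K w z‖ ^ 2 / EdgeRecursion.onePoint K w) (𝓝[≠] (0 : ℂ)) (𝓝 B) ∧
        EdgeRecursion.onePoint K' z = EdgeRecursion.onePoint K z - B) ∧
      (c = 0 → 0 < EdgeRecursion.onePoint K 0 ∧
        ∀ z : ℂ, EdgeRecursion.onePoint K' z =
          EdgeRecursion.onePoint K z - ‖K 0 z‖ ^ 2 / EdgeRecursion.onePoint K 0) := by
  refine ⟨?_, fun K K' hK hK' => EdgeRecursion.edge_recursion hc hK hK'⟩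
  obtain ⟨K, -, hK⟩ := EdgeRecursion.exists_edge_limit hc S
  exact ⟨_, EdgeRecursion.isEdgeKernel_of_isEdgeLimit hc hK⟩
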